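/- **Setting.** Contexts and reward vectors $(x_t,(r_t(a))_{a\in[A]})$, $t=1,\dots,T$ ($T\ge 2$), are drawn i.i.d. from a law $\mathcal D$ on $\mathcal X\times\mathbb R^{A}$ with rewards in $[0,1]$ a.s. ($\mathcal X\neq\emptyset$). The $A$ arms are the leaves of a balanced tree $\mathcal T$ of height $H=\lceil\log_p\lceil A/m\rceil\rceil+1$ (root at depth $0$): each node of depth $<H-1$ has at most $p\ge2$ children and each node of depth $H-1$ has at most $m>p$ children, which are single arms. Each node $e_{h,i}$ has a routing function $g_{h,i}:\mathcal X\to[0,1]$. For a context $x$, beam search of width $b\ge1$ starts from the root; for $h=1,\dots,H-1$ it forms the set of all depth-$h$ children of the current beam, keeps the $b$ of them with the largest $g_{h,i}(x)$ as the new beam (all, if there are fewer; ties broken by a fixed rule), and puts the others into $I_x$. The children of the final beam form the set $S_x$ of single arms. The members of $\mathcal A_x=S_x\cup I_x$ are the effective arms; as sets of arms they partition $[A]$. It is assumed that $|\mathcal A_x|=Z$ for all $x$, and they are listed in a fixed order $\mathbf a_{x,1},\dots,\mathbf a_{x,Z}$. Let $1\le k\le Z$. $\mathcal F$ is a finite class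 of functions $f:\mathcal X\times[A]\to[0,1]$ that is $(\mathcal T,g,b)$-constant: for all $f\in\mathcal F$ and $x$, $f(x,\cdot)$ is constant on every node in $I_x$. Put $\tilde f(x,z)=f(x,a)$ for a fixed $a\in\mathbf a_{x,z}$. Let $f^*\in\mathcal F$. Realizability means $\mathbb E[r_t(a)\mid x_t=x]=f^*(x,a)$ for all $a$ and (almost) all $x$; $\epsilon$-realizability means $|\mathbb E[r_t(a)\mid x_t=x]-f^*(x,a)|\le\epsilon$. **Algorithm.** Put $N_0=0$, $N_l=2^l$ for $l\ge1$; epoch $l$ consists of the rounds $N_{l-1}<t\le N_l$, $t\le T$. At the start of epoch $l$, $\hat y_l\in\{\tilde f:f\in\mathcal F\}$ minimizes the sum of squared errors over all rewards recorded so far, each assigned to the effective arm it was played for. In each round $t$ of epoch $l$ the learner selects the $k-1$ effective arms with the largest $\hat y_l(x_t,\cdot)$ and one further effective arm $z$ among the remaining $Z-k+1$, at random by inverse gap weighting: with $z_\star$ a maximizer of $\hat y_l(x_t,\cdot)$ among the remaining ones, each $z\ne z_\star$ has probability $1/\big(Z-k+1+\gamma_l(\hat y_l(x_t,z_\star)-\hat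 y_l(x_t,z))\big)$, and $z_\star$ the remaining mass. From each selected effective arm one single arm is played (sampled from it by any rule); $B_t$ is the set of the $k$ arms played. The rewards of a random set $\Phi_t\subseteq B_t$ are revealed. The choices of the learner and $\Phi_t$ are independent of $(r_t(a))_a$ given the history $\mathcal H_{t-1}$ of the first $t-1$ rounds and $x_t$, and $\mathbb P(a\in\Phi_t\mid \mathcal H_{t-1},x_t,B_t)\ge c$ for each $a\in B_t$, where $c\in(0,1]$. The regret is that of the top-$k$ problem over effective arms, $$R(T)=\sum_{t=1}^T\mathbb E\Big[\max_{B}\sum_{a\in B}f^*(x_t,a)-\sum_{a\in B_t}f^*(x_t,a)\,\Big|\,\mathcal H_{t-1}\Big],$$ where $B$ ranges over the sets of $k$ arms lying in $k$ different effective arms of $x_t$ (all single arms, if $k=1$). **Claim.** The number of effective arms satisfies $Z\le(p-1)b(H-1)+bm$, and $Z\le D\log A$ for $A\ge2$, with a constant $D$ depending only on $p,m,b$. There is an absolute constant $C$ such that, for every $\delta\in(0,1)$: (i) if realizability holds and $\gamma_l=\frac1{32}\sqrt{\dfrac{c(Z-k+1)N_{l-1}}{162\log(|\mathcal F|T^3/\delta)}}$,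 then with probability at least $1-\delta$ $$R(T)\le C\,k\sqrt{c^{-1}(Z-k+1)\,T\log(|\mathcal F|T/\delta)};$$ (ii) if $\epsilon$-realizability holds for some $\epsilon\ge0$ and $\gamma_l=\dfrac{\sqrt{c(Z-k+1)}}{32\sqrt{\frac{420}{N_{l-1}}\log(|\mathcal F|T^3/\delta)+2\epsilon^2}}$ ($\gamma_1=0$), then with probability at least $1-\delta$ $$R(T)\le C\Big(k\sqrt{c^{-1}(Z-k+1)\,T\log(|\mathcal F|T/\delta)}+\epsilon kT\sqrt{c^{-1}(Z-k+1)}\Big).$$ -/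

import Mathlib

open MeasureTheory ProbabilityTheory

noncomputable section

namespace XBandit

/-! ### The arm hierarchy and beam search -/

/-- The height `H` of the balanced tree: the root has depth `0`, the nodes of depth `H - 1` are the
ones whose children are singleton arms, and `⌈log_p ⌈A / m⌉⌉` levels of `p`-ary branching are
needed so that nodes with at most `m` arms can hold all `A` arms. -/
def treeHeight (A p m : ℕ) : ℕ := Nat.clog p ⌈(A : ℚ) / m⌉₊ + 1

/-- A hierarchical partition of the arms `Fin A`: a tree of height `H` that is `p`-ary (at most `p`
children) down to depth `H - 1`, where each node has at most `m` singleton arms as children.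
`node h a` is the index `i` of the node `e_{h,i}` of depth `h` whose subtree contains the arm `a`. -/
structure ArmTree (A p m H : ℕ) where
  node : ℕ → Fin A → ℕ
  root : ∀ a a', node 0 a = node 0 a'
  nested : ∀ h, h + 1 < H → ∀ a a', node (h + 1) a = node (h + 1) a' → node h a = node h a'
  branching : ∀ h, h + 1 < H → ∀ i,
    ((Finset.univ.filter fun a => node h a = i).image (node (h + 1))).card ≤ p
  leaf : ∀ i, (Finset.univ.filter fun a => node (H - 1) a = i).card ≤ m

variable {A p m H : ℕ} {X : Type*}

/-- The set of singleton arms in the subtree of the node `e_{h,i}`. -/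
def ArmTree.arms (𝒯 : ArmTree A p m H) (h i : ℕ) : Finset (Fin A) :=
  Finset.univ.filter fun a => 𝒯.node h a = i

/-- The indices of the children (of depth `h + 1`) of the node `e_{h,i}`, for `h + 1 < H`. -/
def ArmTree.children (𝒯 : ArmTree A p m H) (h i : ℕ) : Finset ℕ :=
  (𝒯.arms h i).image (𝒯.node (h + 1))

open Classical in
/-- The `b` members of `L` with the largest values of `v` (all of `L` if it has fewer members);
ties are broken in favour of the smaller index. -/
def topNodes (b : ℕ) (v : ℕ → ℝ) (L : Finset ℕ) : Finset ℕ :=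
  L.filter fun i => (L.filter fun j => v i < v j ∨ (v i = v j ∧ j < i)).card < b

/-- The beam (`codes`) of depth `h`; `g h i` is the routing function of `e_{h,i}`. -/
def beam (𝒯 : ArmTree A p m H) (g : ℕ → ℕ → X → ℝ) (b : ℕ) (x : X) : ℕ → Finset ℕ
  | 0 => Finset.univ.image (𝒯.node 0)
  | h + 1 => topNodes b (fun i => g (h + 1) i x) ((beam 𝒯 g b x h).biUnion (𝒯.children h))

/-- `I_x`: the nodes (as sets of arms) that are discarded during beam search. -/
def nodeArms (𝒯 : ArmTree A p m H) (g : ℕ → ℕ → X → ℝ) (b : ℕ) (x : X) :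
    Finset (Finset (Fin A)) :=
  (Finset.range (H - 1)).biUnion fun h =>
    ((beam 𝒯 g b x h).biUnion (𝒯.children h) \ beam 𝒯 g b x (h + 1)).image (𝒯.arms (h + 1))

/-- `S_x`: the singleton arms below the final beam. -/
def singletonArms (𝒯 : ArmTree A p m H) (g : ℕ → ℕ → X → ℝ) (b : ℕ) (x : X) :
    Finset (Finset (Fin A)) :=
  ((beam 𝒯 g b x (H - 1)).biUnion (𝒯.arms (H - 1))).image fun a => {a}

/-- `𝒜_x = S_x ∪ I_x`: the effective arms returned by beam search. -/
def effectiveArms (𝒯 : ArmTree A p m H) (g : ℕ → ℕ → X → ℝ) (b : ℕ) (x : X) :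
    Finset (Finset (Fin A)) :=
  singletonArms 𝒯 g b x ∪ nodeArms 𝒯 g b x

/-- `f` is `(𝒯, g, b)`-constant. -/
def IsTreeConstant (𝒯 : ArmTree A p m H) (g : ℕ → ℕ → X → ℝ) (b : ℕ) (f : X → Fin A → ℝ) :
    Prop :=
  ∀ x, ∀ e ∈ nodeArms 𝒯 g b x, ∀ a ∈ e, ∀ a' ∈ e, f x a = f x a'

/-- Every `𝒜_x` has exactly `Z` members, listed in a fixed order `arm x 0, …, arm x (Z - 1)`, with a
fixed representative arm `rep x z ∈ arm x z` used to define the reduced functions. -/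
structure ArmOrder [MeasurableSpace X] (𝒯 : ArmTree A p m H) (g : ℕ → ℕ → X → ℝ) (b Z : ℕ) where
  arm : X → Fin Z → Finset (Fin A)
  injective : ∀ x, Function.Injective (arm x)
  image_eq : ∀ x, Finset.univ.image (arm x) = effectiveArms 𝒯 g b x
  measurable_arm : ∀ z e, MeasurableSet {x | arm x z = e}
  rep : X → Fin Z → Fin A
  rep_mem : ∀ x z, rep x z ∈ arm x z
  measurable_rep : ∀ z a, MeasurableSet {x | rep x z = a}

/-- The reduced function `f̃(x, z) = f(x, a)` for the fixed representative `a` of the `z`-th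
effective arm of `x`. -/
def reduced {Z : ℕ} (rep : X → Fin Z → Fin A) (f : X → Fin A → ℝ) : X → Fin Z → ℝ :=
  fun x z => f x (rep x z)

/-! ### The environment -/

/-- Realizability by `f`: the conditional mean of the reward of arm `a` given the context is
`f x a`. The law `𝒟` is that of (context, vector of rewards). -/
def Realizable [MeasurableSpace X] (𝒟 : Measure (X × (Fin A → ℝ))) (f : X → Fin A → ℝ) : Prop :=
  ∀ a, ∀ᵐ w ∂𝒟,
    (𝒟[(fun w : X × (Fin A → ℝ) => w.2 a) | MeasurableSpace.comap Prod.fst inferInstance]) w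
      = f w.1 a

/-- `ε`-realizability by `f`. -/
def EpsRealizable [MeasurableSpace X] (𝒟 : Measure (X × (Fin A → ℝ))) (ε : ℝ)
    (f : X → Fin A → ℝ) : Prop :=
  ∀ a, ∀ᵐ w ∂𝒟,
    |(𝒟[(fun w : X × (Fin A → ℝ) => w.2 a) | MeasurableSpace.comap Prod.fst inferInstance]) w
      - f w.1 a| ≤ ε

/-! ### The algorithm -/

/-- `N_l`, the number of rounds in the first `l` epochs: `N_0 = 0` and `N_l = 2 ^ l` for `l ≥ 1`. -/
def epochEnd : ℕ → ℕ
  | 0 => 0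
  | l + 1 => 2 ^ (l + 1)

/-- The probability of `z` under inverse gap weighting on the set `S` with scores `v`, maximiser
`star` of `v` on `S` and scaling factor `γ`. -/
def igw {Z : ℕ} (S : Finset (Fin Z)) (γ : ℝ) (v : Fin Z → ℝ) (star z : Fin Z) : ℝ :=
  if z ∈ S then
    if z = star then 1 - ∑ z' ∈ S.erase star, 1 / ((S.card : ℝ) + γ * (v star - v z'))
    else 1 / ((S.card : ℝ) + γ * (v star - v z))
  else 0

/-- The `T` rounds, with one exploration slot (`r = 1`), of the extreme top-`k` inverse gap weighting
algorithm with scaling factors `γ 1, γ 2, …`, in an environment that draws (context, rewards)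
i.i.d. from `𝒟`. Rounds are numbered `0, …, T - 1`, and `ℋ t` is the history before round `t`, that
is, after the first `t` rounds. Epoch `l + 1` consists of the rounds `t` with
`epochEnd l ≤ t < epochEnd (l + 1)`, cut off at `T`. -/
structure ExtremeRun {Ω : Type*} [mΩ : MeasurableSpace Ω] (P : Measure Ω)
    [MeasurableSpace X] {𝒯 : ArmTree A p m H} {g : ℕ → ℕ → X → ℝ} {b Z : ℕ}
    (ord : ArmOrder 𝒯 g b Z) (𝒟 : Measure (X × (Fin A → ℝ))) (F : Finset (X → Fin A → ℝ))
    (k T : ℕ) (γ : ℕ → ℝ) where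
  /-- the history -/
  ℋ : Filtration ℕ mΩ
  /-- the context of round `t` -/
  x : ℕ → Ω → X
  /-- the rewards of all arms in round `t` -/
  r : ℕ → Ω → Fin A → ℝ
  /-- the regression estimate of epoch `l` -/
  yhat : ℕ → Ω → X → Fin Z → ℝ
  /-- the `k - 1` effective arms chosen greedily in round `t` -/
  greedy : ℕ → Ω → Finset (Fin Z)
  /-- the best remaining effective arm according to the estimate -/
  star : ℕ → Ω → Fin Z
  /-- the effective arm sampled by inverse gap weighting -/
  explore : ℕ → Ω → Fin Z
  /-- the set of singleton arms played in round `t` -/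
  B : ℕ → Ω → Finset (Fin A)
  /-- the played arms whose rewards are revealed in round `t` -/
  Φ : ℕ → Ω → Finset (Fin A)
  measurable_x : ∀ t < T, Measurable[ℋ (t + 1)] (x t)
  measurable_r : ∀ t < T, Measurable[ℋ (t + 1)] (r t)
  measurable_explore : ∀ t < T, ∀ z, MeasurableSet[ℋ (t + 1)] {ω | explore t ω = z}
  measurable_B : ∀ t < T, ∀ s, MeasurableSet[ℋ (t + 1)] {ω | B t ω = s}
  measurable_Φ : ∀ t < T, ∀ s, MeasurableSet[ℋ (t + 1)] {ω | Φ t ω = s}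
  /-- the context and the rewards of each round have law `𝒟` and are independent of the past -/
  law : ∀ t < T, P.map (fun ω => (x t ω, r t ω)) = 𝒟
  indep : ∀ t < T,
    Indep (MeasurableSpace.comap (fun ω => (x t ω, r t ω)) inferInstance) (ℋ t) P
  /-- the estimate of an epoch is a least squares fit, within the reduced class, to the rewards
  recorded in all earlier epochs, each mapped back to the effective arm it was played for -/
  yhat_mem : ∀ l, epochEnd l < T → ∀ ω, ∃ f ∈ F, yhat (l + 1) ω = reduced ord.rep f
  measurable_yhat : ∀ l, epochEnd l < T → ∀ f ∈ F,
    MeasurableSet[ℋ (epochEnd l)] {ω | yhat (l + 1) ω = reduced ord.rep f}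
  yhat_argmin : ∀ l, epochEnd l < T → ∀ ω, ∀ f ∈ F,
    ∑ t ∈ Finset.range (epochEnd l), ∑ z ∈ insert (explore t ω) (greedy t ω),
        ∑ a ∈ Φ t ω ∩ ord.arm (x t ω) z, (yhat (l + 1) ω (x t ω) z - r t ω a) ^ 2
      ≤ ∑ t ∈ Finset.range (epochEnd l), ∑ z ∈ insert (explore t ω) (greedy t ω),
        ∑ a ∈ Φ t ω ∩ ord.arm (x t ω) z, (reduced ord.rep f (x t ω) z - r t ω a) ^ 2
  /-- greedy slots: `k - 1` effective arms with the largest estimates -/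
  greedy_card : ∀ t < T, ∀ ω, (greedy t ω).card = k - 1
  greedy_top : ∀ l, ∀ t < T, epochEnd l ≤ t → t < epochEnd (l + 1) → ∀ ω,
    ∀ z ∈ greedy t ω, ∀ z' ∉ greedy t ω, yhat (l + 1) ω (x t ω) z' ≤ yhat (l + 1) ω (x t ω) z
  measurable_greedy : ∀ t < T, ∀ s,
    MeasurableSet[ℋ t ⊔ MeasurableSpace.comap (x t) inferInstance] {ω | greedy t ω = s}
  star_notMem : ∀ t < T, ∀ ω, star t ω ∉ greedy t ω
  star_max : ∀ l, ∀ t < T, epochEnd l ≤ t → t < epochEnd (l + 1) → ∀ ω, ∀ z ∉ greedy t ω,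
    yhat (l + 1) ω (x t ω) z ≤ yhat (l + 1) ω (x t ω) (star t ω)
  measurable_star : ∀ t < T, ∀ z,
    MeasurableSet[ℋ t ⊔ MeasurableSpace.comap (x t) inferInstance] {ω | star t ω = z}
  /-- exploration slot: inverse gap weighting on the remaining effective arms -/
  explore_law : ∀ l, ∀ t < T, epochEnd l ≤ t → t < epochEnd (l + 1) → ∀ z,
    (P⟦{ω | explore t ω = z} | ℋ t ⊔ MeasurableSpace.comap (x t) inferInstance⟧)
      =ᵐ[P] fun ω =>
        igw (greedy t ω)ᶜ (γ (l + 1)) (yhat (l + 1) ω (x t ω)) (star t ω) z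
  /-- one singleton arm is played from each chosen effective arm, and no other arm -/
  B_inter : ∀ t < T, ∀ ω, ∀ z ∈ insert (explore t ω) (greedy t ω),
    (B t ω ∩ ord.arm (x t ω) z).card = 1
  B_subset : ∀ t < T, ∀ ω,
    B t ω ⊆ (insert (explore t ω) (greedy t ω)).biUnion (ord.arm (x t ω))
  Φ_subset : ∀ t < T, ∀ ω, Φ t ω ⊆ B t ω
  /-- given the past and the context, the choices of the learner and the feedback set do not depend
  on the rewards of the round -/
  choice_indep : ∀ t < T, ∀ z s φ,
    (P⟦{ω | explore t ω = z ∧ B t ω = s ∧ Φ t ω = φ} |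
        ℋ t ⊔ MeasurableSpace.comap (x t) inferInstance
          ⊔ MeasurableSpace.comap (r t) inferInstance⟧)
      =ᵐ[P] P⟦{ω | explore t ω = z ∧ B t ω = s ∧ Φ t ω = φ} |
        ℋ t ⊔ MeasurableSpace.comap (x t) inferInstance⟧

section Run

variable {Ω : Type*} [mΩ : MeasurableSpace Ω] {P : Measure Ω} [MeasurableSpace X]
  {𝒯 : ArmTree A p m H} {g : ℕ → ℕ → X → ℝ} {b Z : ℕ} {ord : ArmOrder 𝒯 g b Z}
  {𝒟 : Measure (X × (Fin A → ℝ))} {F : Finset (X → Fin A → ℝ)} {k T : ℕ} {γ : ℕ → ℝ}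

/-- Given the past, the context and the played arms, the reward of each played arm is revealed with
probability at least `c`. -/
def ExtremeRun.Feedback (R : ExtremeRun P ord 𝒟 F k T γ) (c : ℝ) : Prop :=
  ∀ t < T, ∀ a, ∀ᵐ ω ∂P, a ∈ R.B t ω →
    c ≤ (P⟦{ω' | a ∈ R.Φ t ω'} |
      R.ℋ t ⊔ MeasurableSpace.comap (R.x t) inferInstance
        ⊔ MeasurableSpace.comap (R.B t) ⊤⟧) ω

/-- The largest total value of `k` arms that lie in `k` different members of the partition `E`.
For `k = 1` this is the maximum over all arms. -/
def bestValue (k : ℕ) (E : Finset (Finset (Fin A))) (v : Fin A → ℝ) : ℝ :=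
  ⨆ s : {s : Finset (Fin A) // s.card = k ∧ ∀ e ∈ E, (s ∩ e).card ≤ 1}, ∑ a ∈ s.1, v a

/-- The regret after `T` rounds: the sum over the rounds of the expected regret of the round given
the past, in the top-`k` problem over the effective arms. -/
def ExtremeRun.regret (R : ExtremeRun P ord 𝒟 F k T γ) (f : X → Fin A → ℝ) (ω : Ω) : ℝ :=
  ∑ t ∈ Finset.range T,
    (P[(fun ω' => bestValue k (effectiveArms 𝒯 g b (R.x t ω')) (f (R.x t ω'))
        - ∑ a ∈ R.B t ω', f (R.x t ω') a) | R.ℋ t]) ω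

end Run

/-! ### The scaling factors -/

/-- `γ_l` for exact realizability, with `n` the number of arms and `M` the size of the class. -/
def gammaExact (c : ℝ) (n k M T : ℕ) (δ : ℝ) (l : ℕ) : ℝ :=
  1 / 32 * Real.sqrt (c * ((n : ℝ) - k + 1) * (epochEnd (l - 1) : ℝ)
    / (162 * Real.log ((M : ℝ) * (T : ℝ) ^ 3 / δ)))

/-- `γ_l` for `ε`-realizability; in the first epoch, where there are no data, it is `0`, the limit of
the formula. -/
def gammaEps (c ε : ℝ) (n k M T : ℕ) (δ : ℝ) (l : ℕ) : ℝ :=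
  if epochEnd (l - 1) = 0 then 0 else
    Real.sqrt (c * ((n : ℝ) - k + 1))
      / (32 * Real.sqrt (420 / (epochEnd (l - 1) : ℝ) * Real.log ((M : ℝ) * (T : ℝ) ^ 3 / δ)
          + 2 * ε ^ 2))

end XBandit

end

/-!
The bound combines a regression oracle argument with inverse gap weighting, carried out for top-`k`
selections over the effective arms, which partition the arms (`effectiveArms_eq_of_mem`,
`exists_mem_effectiveArms`).

*Regression.* Conditionally on the past, the excess squared error of `f` over `f*` in a round is
bounded by `k`, its mean is at least half the mean squared distance of `f` and `f*` on the revealed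
arms up to `2 k ε ^ 2`, and its second moment is at most `4 k` times that distance. Hence the
exponential of minus the excess over `16 k`, suitably compensated, is a supermartingale
(`integral_exp_sum_increment_le`), and by Markov's inequality and a union bound over the class and
the epochs, every least squares estimate is close to `f*` on the data it was fitted to
(`exists_bad_event`). These data select each effective arm `z` with probability at least its
`coverage`, which is a function of the context and of the scores in use that does not depend on how
ties are broken (`integral_coverage_le`).

*Transfer between epochs.* For a selection `S` of `k` effective arms, the sum of the inverse coverages
is at most `k (Z - k + 1)` plus `γ` times the regret of `S` with respect to the scores in use
(`sum_inv_coverage_le`), so that these scores explore exactly the selections they do not already know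
to be bad. If the regrets with respect to all earlier scores are at most twice the true regrets plus
a slack, then the inequality of the arithmetic and geometric means turns the regression error into
the same statement for the new scores, and into its converse (`topRegret_transfer`). The comparison
holds at every single context, with a slack that is a function of the context and whose mean is of
order `k (Z - k + 1) / γ` (`exists_slack`).

*Regret.* The estimated regret of a round is that of its exploration slot, at most
`(Z - k + 1) / γ` in mean (`condExp_scoreGap_le`), so the true regret of a round is of order
`k (Z - k + 1) / γ` (`ae_condExp_roundRegret_le`). Summing over the rounds gives `regret_le`, into
which the two choices of `γ` are inserted.
-/

noncomputable section

namespace XBandit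

/-! ### The effective arms form a partition, and their number -/

section Tree

variable {A p m H : ℕ} {X : Type*} (𝒯 : ArmTree A p m H) (g : ℕ → ℕ → X → ℝ) (b : ℕ) (x : X)

theorem topNodes_subset (v : ℕ → ℝ) (L : Finset ℕ) : topNodes b v L ⊆ L :=
  Finset.filter_subset _ _

/-- The tie-breaking rule makes the rank a bijection from `L` onto `{0, …, #L - 1}`, so the elements
of rank `< b` number exactly `min b #L`. -/
theorem card_topNodes (v : ℕ → ℝ) (L : Finset ℕ) : (topNodes b v L).card = min b L.card := by
  classical
  set lt : ℕ → ℕ → Prop := fun i j => v i < v j ∨ (v i = v j ∧ j < i) with hlt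
  set rk : ℕ → ℕ := fun i => (L.filter fun j => lt i j).card with hrk
  have htop : topNodes b v L = L.filter fun i => rk i < b := by
    ext i
    simp only [topNodes, hrk, hlt, Finset.mem_filter]
  have hmono : ∀ i ∈ L, ∀ j ∈ L, lt i j → rk j < rk i := by
    intro i _ j hj hij
    refine Finset.card_lt_card ?_
    rw [Finset.ssubset_iff_of_subset]
    · refine ⟨j, Finset.mem_filter.2 ⟨hj, hij⟩, ?_⟩
      simp [hlt]
    · intro l hl
      rw [Finset.mem_filter] at hl ⊢
      refine ⟨hl.1, ?_⟩
      rcases hij with h | ⟨h, h'⟩ <;> rcases hl.2 with h2 | ⟨h2, h2'⟩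
      · exact Or.inl (h.trans h2)
      · exact Or.inl (h2 ▸ h)
      · exact Or.inl (h ▸ h2)
      · exact Or.inr ⟨h.trans h2, h2'.trans h'⟩
  have hinj : Set.InjOn rk L := by
    intro i hi j hj hij
    rcases lt_trichotomy (v i) (v j) with h | h | h
    · exact absurd hij (hmono i hi j hj (Or.inl h)).ne'
    · rcases lt_trichotomy i j with h' | h' | h'
      · exact absurd hij (hmono j hj i hi (Or.inr ⟨h.symm, h'⟩)).ne
      · exact h'
      · exact absurd hij (hmono i hi j hj (Or.inr ⟨h, h'⟩)).ne'
    · exact absurd hij (hmono j hj i hi (Or.inl h)).ne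
  have himg : L.image rk = Finset.range L.card := by
    refine Finset.eq_of_subset_of_card_le ?_ ?_
    · intro n hn
      obtain ⟨i, hi, rfl⟩ := Finset.mem_image.1 hn
      refine Finset.mem_range.2 (Finset.card_lt_card ?_)
      rw [Finset.ssubset_iff_of_subset (Finset.filter_subset _ _)]
      exact ⟨i, hi, by simp [hlt]⟩
    · rw [Finset.card_range, Finset.card_image_of_injOn hinj]
  have h1 : (L.filter fun i => rk i < b).image rk = Finset.range (min b L.card) := by
    ext n
    simp only [Finset.mem_image, Finset.mem_filter, Finset.mem_range, lt_min_iff]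
    constructor
    · rintro ⟨i, ⟨hi, hb⟩, rfl⟩
      exact ⟨hb, Finset.mem_range.1 (himg ▸ Finset.mem_image_of_mem rk hi)⟩
    · rintro ⟨hb, hn⟩
      obtain ⟨i, hi, rfl⟩ := Finset.mem_image.1 (himg.symm ▸ Finset.mem_range.2 hn)
      exact ⟨i, ⟨hi, hb⟩, rfl⟩
  rw [htop, ← Finset.card_range (min b L.card), ← h1, Finset.card_image_of_injOn]
  exact hinj.mono fun i hi => (Finset.mem_filter.1 hi).1

theorem mem_arms {h i : ℕ} {a : Fin A} : a ∈ 𝒯.arms h i ↔ 𝒯.node h a = i := by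
  simp [ArmTree.arms]

theorem mem_children_beam {h i : ℕ} :
    i ∈ (beam 𝒯 g b x h).biUnion (𝒯.children h) ↔
      ∃ a, 𝒯.node h a ∈ beam 𝒯 g b x h ∧ 𝒯.node (h + 1) a = i := by
  simp [ArmTree.children, mem_arms]

theorem beam_succ_subset (h : ℕ) :
    beam 𝒯 g b x (h + 1) ⊆ (beam 𝒯 g b x h).biUnion (𝒯.children h) :=
  topNodes_subset _ _ _

/-- A child of the beam which contains `a` witnesses that the ancestor of `a` is in the beam. -/
theorem node_mem_beam_of_child {h : ℕ} (hh : h + 1 < H) {a : Fin A}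
    (ha : 𝒯.node (h + 1) a ∈ (beam 𝒯 g b x h).biUnion (𝒯.children h)) :
    𝒯.node h a ∈ beam 𝒯 g b x h := by
  obtain ⟨a', ha', he⟩ := (mem_children_beam 𝒯 g b x).1 ha
  rwa [𝒯.nested h hh a a' he.symm]

theorem node_mem_beam_of_le {h h' : ℕ} (hle : h ≤ h') (hh : h' < H) {a : Fin A}
    (ha : 𝒯.node h' a ∈ beam 𝒯 g b x h') : 𝒯.node h a ∈ beam 𝒯 g b x h := by
  induction h', hle using Nat.le_induction with
  | base => exact ha
  | succ n _ ih =>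
    exact ih (by omega) (node_mem_beam_of_child 𝒯 g b x hh (beam_succ_subset 𝒯 g b x n ha))

theorem mem_nodeArms {e : Finset (Fin A)} :
    e ∈ nodeArms 𝒯 g b x ↔ ∃ h, h < H - 1 ∧ ∃ i,
      i ∈ (beam 𝒯 g b x h).biUnion (𝒯.children h) ∧ i ∉ beam 𝒯 g b x (h + 1) ∧
        𝒯.arms (h + 1) i = e := by
  simp [nodeArms, and_assoc]

theorem mem_singletonArms {e : Finset (Fin A)} :
    e ∈ singletonArms 𝒯 g b x ↔ ∃ a, 𝒯.node (H - 1) a ∈ beam 𝒯 g b x (H - 1) ∧ {a} = e := by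
  simp [singletonArms, mem_arms]

/-- Every arm lies in some effective arm: follow its ancestors until one of them is discarded. -/
theorem exists_mem_effectiveArms (a : Fin A) : ∃ e ∈ effectiveArms 𝒯 g b x, a ∈ e := by
  have key : ∀ h ≤ H - 1, 𝒯.node h a ∈ beam 𝒯 g b x h ∨ ∃ e ∈ nodeArms 𝒯 g b x, a ∈ e := by
    intro h
    induction h with
    | zero => exact fun _ => Or.inl (Finset.mem_image_of_mem _ (Finset.mem_univ a))
    | succ n ih =>
      intro hn
      rcases ih (by omega) with h1 | h1
      · by_cases h2 : 𝒯.node (n + 1) a ∈ beam 𝒯 g b x (n + 1)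
        · exact Or.inl h2
        · refine Or.inr ⟨𝒯.arms (n + 1) (𝒯.node (n + 1) a), ?_, (mem_arms 𝒯).2 rfl⟩
          exact (mem_nodeArms 𝒯 g b x).2 ⟨n, by omega, _,
            (mem_children_beam 𝒯 g b x).2 ⟨a, h1, rfl⟩, h2, rfl⟩
      · exact Or.inr h1
  rcases key (H - 1) le_rfl with h | ⟨e, he, ha⟩
  · exact ⟨{a}, Finset.mem_union_left _ ((mem_singletonArms 𝒯 g b x).2 ⟨a, h, rfl⟩), by simp⟩
  · exact ⟨e, Finset.mem_union_right _ he, ha⟩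

/-- Distinct effective arms are disjoint: the ancestors of an arm leave the beam only once. -/
theorem effectiveArms_eq_of_mem {e e' : Finset (Fin A)} (he : e ∈ effectiveArms 𝒯 g b x)
    (he' : e' ∈ effectiveArms 𝒯 g b x) {a : Fin A} (ha : a ∈ e) (ha' : a ∈ e') : e = e' := by
  have mixed : ∀ e ∈ singletonArms 𝒯 g b x, ∀ e' ∈ nodeArms 𝒯 g b x, a ∈ e → a ∉ e' := by
    intro e he e' he' ha ha'
    obtain ⟨a₁, h1, rfl⟩ := (mem_singletonArms 𝒯 g b x).1 he
    obtain ⟨h, hh, i, -, h2, rfl⟩ := (mem_nodeArms 𝒯 g b x).1 he'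
    obtain rfl := Finset.mem_singleton.1 ha
    obtain rfl := (mem_arms 𝒯).1 ha'
    exact h2 (node_mem_beam_of_le 𝒯 g b x (by omega) (by omega) h1)
  rcases Finset.mem_union.1 he with h | h <;> rcases Finset.mem_union.1 he' with h' | h'
  · obtain ⟨a₁, -, rfl⟩ := (mem_singletonArms 𝒯 g b x).1 h
    obtain ⟨a₂, -, rfl⟩ := (mem_singletonArms 𝒯 g b x).1 h'
    rw [← Finset.mem_singleton.1 ha, ← Finset.mem_singleton.1 ha']
  · exact absurd ha' (mixed e h e' h' ha)
  · exact absurd ha (mixed e' h' e h ha')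
  · obtain ⟨n, hn, i, h1, h2, rfl⟩ := (mem_nodeArms 𝒯 g b x).1 h
    obtain ⟨n', hn', i', h1', h2', rfl⟩ := (mem_nodeArms 𝒯 g b x).1 h'
    obtain rfl := (mem_arms 𝒯).1 ha
    obtain rfl := (mem_arms 𝒯).1 ha'
    have k1 := node_mem_beam_of_child 𝒯 g b x (by omega) h1
    have k1' := node_mem_beam_of_child 𝒯 g b x (by omega) h1'
    rcases lt_trichotomy n n' with h3 | rfl | h3
    · exact absurd (node_mem_beam_of_le 𝒯 g b x (by omega) (by omega) k1') h2
    · rfl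
    · exact absurd (node_mem_beam_of_le 𝒯 g b x (by omega) (by omega) k1) h2'

theorem card_beam_le (hb : 1 ≤ b) (h : ℕ) : (beam 𝒯 g b x h).card ≤ b := by
  cases h with
  | zero =>
    refine le_trans (Finset.card_le_one.2 ?_) hb
    intro i hi j hj
    obtain ⟨a, -, rfl⟩ := Finset.mem_image.1 hi
    obtain ⟨a', -, rfl⟩ := Finset.mem_image.1 hj
    exact 𝒯.root a a'
  | succ n =>
    rw [beam, card_topNodes]
    exact min_le_left _ _

theorem card_effectiveArms_le (hp : 1 ≤ p) (hb : 1 ≤ b) :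
    (effectiveArms 𝒯 g b x).card ≤ (p - 1) * b * (H - 1) + b * m := by
  have hS : (singletonArms 𝒯 g b x).card ≤ b * m := by
    refine Finset.card_image_le.trans ?_
    exact (Finset.card_biUnion_le_card_mul _ _ m fun i _ => 𝒯.leaf i).trans
      (Nat.mul_le_mul_right _ (card_beam_le 𝒯 g b x hb _))
  have hI : (nodeArms 𝒯 g b x).card ≤ (p - 1) * b * (H - 1) := by
    rw [mul_comm _ (H - 1), nodeArms]
    refine (Finset.card_biUnion_le_card_mul _ _ ((p - 1) * b) fun h hh => ?_).trans
      (by rw [Finset.card_range])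
    refine Finset.card_image_le.trans ?_
    rw [Finset.card_sdiff_of_subset (beam_succ_subset 𝒯 g b x h), beam, card_topNodes]
    have h1 : ((beam 𝒯 g b x h).biUnion (𝒯.children h)).card ≤ b * p :=
      (Finset.card_biUnion_le_card_mul _ _ p fun i _ =>
        𝒯.branching h (by have := Finset.mem_range.1 hh; omega) i).trans
        (Nat.mul_le_mul_right _ (card_beam_le 𝒯 g b x hb _))
    have h2 : (p - 1) * b + b = b * p := by
      obtain ⟨q, rfl⟩ : ∃ q, p = q + 1 := ⟨p - 1, by omega⟩
      simp only [Nat.add_sub_cancel]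
      ring
    omega
  have := Finset.card_union_le (singletonArms 𝒯 g b x) (nodeArms 𝒯 g b x)
  rw [effectiveArms]
  omega

theorem ArmOrder.card_eq [MeasurableSpace X] {Z : ℕ} (ord : ArmOrder 𝒯 g b Z) :
    (effectiveArms 𝒯 g b x).card = Z := by
  rw [← ord.image_eq x, Finset.card_image_of_injective _ (ord.injective x), Finset.card_univ,
    Fintype.card_fin]

end Tree

/-- The height of the tree is logarithmic in the number of arms. -/
theorem treeHeight_sub_one_le {A p m : ℕ} (hp : 2 ≤ p) (hA : 2 ≤ A) (hm : 1 ≤ m) :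
    ((treeHeight A p m - 1 : ℕ) : ℝ) ≤ 2 / Real.log 2 * Real.log A := by
  have hlog2 : 0 < Real.log 2 := Real.log_pos (by norm_num)
  have hAlog : Real.log 2 ≤ Real.log A :=
    Real.log_le_log (by norm_num) (by exact_mod_cast hA)
  have hceil : ⌈(A : ℚ) / m⌉₊ ≤ A := by
    refine Nat.ceil_le.2 (div_le_self (by positivity) (by exact_mod_cast hm))
  have h1 : treeHeight A p m - 1 ≤ Nat.clog 2 A := by
    rw [treeHeight, Nat.add_sub_cancel]
    exact (Nat.clog_mono_right p hceil).trans (Nat.clog_anti_left (by norm_num) hp)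
  have h2 : 2 ^ (Nat.clog 2 A - 1) < A := Nat.pow_pred_clog_lt_self (by norm_num) (by omega)
  have h3 : ((Nat.clog 2 A - 1 : ℕ) : ℝ) * Real.log 2 ≤ Real.log A := by
    rw [← Real.log_pow]
    exact Real.log_le_log (by positivity) (by exact_mod_cast h2.le)
  have h4 : (treeHeight A p m - 1 : ℕ) ≤ (Nat.clog 2 A - 1) + 1 := by omega
  have h5 : ((treeHeight A p m - 1 : ℕ) : ℝ) ≤ ((Nat.clog 2 A - 1 : ℕ) : ℝ) + 1 := by
    exact_mod_cast h4
  rw [div_mul_eq_mul_div, le_div_iff₀ hlog2]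
  nlinarith

/-! ### Top-`k` sums and inverse gap weighting -/

section TopK

variable {ι : Type*}

/-- The largest sum of `k` values of `v`. -/
def topSum (k : ℕ) (v : ι → ℝ) : ℝ :=
  ⨆ S : {S : Finset ι // S.card = k}, ∑ i ∈ S.1, v i

/-- The regret of the selection `S` in the top-`k` problem with values `v`. -/
def topRegret (k : ℕ) (v : ι → ℝ) (S : Finset ι) : ℝ :=
  topSum k v - ∑ i ∈ S, v i

/-- The `k`-th largest value of `v`. -/
def threshold (k : ℕ) (v : ι → ℝ) : ℝ :=
  topSum k v - topSum (k - 1) v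

/-- A lower bound for the probability that top-`k` inverse gap weighting with scores `v` selects `z`,
where `K` is the number of candidates for the exploration slot. Unlike that probability it does not
depend on how ties are broken. -/
def coverage (k : ℕ) (K γ : ℝ) (v : ι → ℝ) (z : ι) : ℝ :=
  1 / (K + γ * max (threshold k v - v z) 0)

/-- The squared distance of `u` and `v`, weighted by the coverage of scores `w`. -/
def coveredError [Fintype ι] (k : ℕ) (K γ : ℝ) (w u v : ι → ℝ) : ℝ :=
  ∑ z, coverage k K γ w z * (v z - u z) ^ 2

/-- `G` consists of `k - 1` indices with the largest values of `v`, and `s` is the best of the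
others. -/
structure IsTopSplit (k : ℕ) (v : ι → ℝ) (G : Finset ι) (s : ι) : Prop where
  card : G.card = k - 1
  notMem : s ∉ G
  top : ∀ z ∈ G, ∀ z' ∉ G, v z' ≤ v z
  max : ∀ z ∉ G, v z ≤ v s

theorem coverage_pos {k : ℕ} {K γ : ℝ} (hK : 1 ≤ K) (hγ : 0 ≤ γ) (v : ι → ℝ) (z : ι) :
    0 < coverage k K γ v z := by
  have : 0 ≤ γ * max (threshold k v - v z) 0 := mul_nonneg hγ (le_max_right _ _)
  exact one_div_pos.2 (by linarith)

theorem coverage_le_one {k : ℕ} {K γ : ℝ} (hK : 1 ≤ K) (hγ : 0 ≤ γ) (v : ι → ℝ) (z : ι) :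
    coverage k K γ v z ≤ 1 := by
  have : 0 ≤ γ * max (threshold k v - v z) 0 := mul_nonneg hγ (le_max_right _ _)
  exact (div_le_one (by linarith)).2 (by linarith)

theorem topRegret_sub_le {k : ℕ} (u v : ι → ℝ) {S S' : Finset ι}
    (hmax : ∑ i ∈ S', v i = topSum k v) :
    topRegret k v S - topRegret k u S
      ≤ ∑ z ∈ S', |v z - u z| + ∑ z ∈ S, |v z - u z| - topRegret k u S' := by
  have h1 : ∑ z ∈ S', v z - ∑ z ∈ S', u z ≤ ∑ z ∈ S', |v z - u z| := by
    rw [← Finset.sum_sub_distrib]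
    exact Finset.sum_le_sum fun z _ => le_abs_self _
  have h2 : ∑ z ∈ S, u z - ∑ z ∈ S, v z ≤ ∑ z ∈ S, |v z - u z| := by
    rw [← Finset.sum_sub_distrib]
    exact Finset.sum_le_sum fun z _ => by rw [abs_sub_comm]; exact le_abs_self _
  simp only [topRegret, ← hmax]
  linarith

section

variable [Fintype ι]

theorem nonempty_card_eq {k : ℕ} (hk : k ≤ Fintype.card ι) :
    Nonempty {S : Finset ι // S.card = k} := by
  obtain ⟨S, -, hS⟩ := Finset.exists_subset_card_eq (s := (Finset.univ : Finset ι)) hk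
  exact ⟨S, hS⟩

theorem sum_le_topSum {k : ℕ} (v : ι → ℝ) {S : Finset ι} (hS : S.card = k) :
    ∑ i ∈ S, v i ≤ topSum k v :=
  le_ciSup (f := fun S : {S : Finset ι // S.card = k} => ∑ i ∈ S.1, v i)
    (Set.finite_range _).bddAbove ⟨S, hS⟩

theorem exists_sum_eq_topSum {k : ℕ} (hk : k ≤ Fintype.card ι) (v : ι → ℝ) :
    ∃ S : Finset ι, S.card = k ∧ ∑ i ∈ S, v i = topSum k v := by
  have := nonempty_card_eq hk
  obtain ⟨S, hS⟩ := exists_eq_ciSup_of_finite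
    (f := fun S : {S : Finset ι // S.card = k} => ∑ i ∈ S.1, v i)
  exact ⟨S.1, S.2, hS⟩

theorem topRegret_nonneg {k : ℕ} (v : ι → ℝ) {S : Finset ι} (hS : S.card = k) :
    0 ≤ topRegret k v S :=
  sub_nonneg.2 (sum_le_topSum v hS)

theorem topRegret_le {k : ℕ} (hk : k ≤ Fintype.card ι) {v : ι → ℝ}
    (hv : ∀ z, v z ∈ Set.Icc (0 : ℝ) 1) (S : Finset ι) : topRegret k v S ≤ k := by
  obtain ⟨S', hS', h⟩ := exists_sum_eq_topSum hk v
  have h1 : ∑ i ∈ S', v i ≤ S'.card • (1 : ℝ) := Finset.sum_le_card_nsmul _ _ _ fun i _ => (hv i).2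
  have h2 : 0 ≤ ∑ i ∈ S, v i := Finset.sum_nonneg fun i _ => (hv i).1
  rw [hS', nsmul_eq_mul, mul_one] at h1
  rw [topRegret, ← h]
  linarith

theorem coveredError_nonneg {k : ℕ} {K γ : ℝ} (hK : 1 ≤ K) (hγ : 0 ≤ γ) (w u v : ι → ℝ) :
    0 ≤ coveredError k K γ w u v :=
  Finset.sum_nonneg fun z _ => mul_nonneg (coverage_pos hK hγ w z).le (sq_nonneg _)

end

variable [DecidableEq ι]

theorem sum_le_sum_of_top {v : ι → ℝ} {G S : Finset ι} (hG : ∀ z ∈ G, ∀ z' ∉ G, v z' ≤ v z)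
    (hS : S.card = G.card) : ∑ i ∈ S, v i ≤ ∑ i ∈ G, v i := by
  rw [← sub_nonpos, ← Finset.sum_sdiff_sub_sum_sdiff, sub_nonpos]
  have hcard : (S \ G).card = (G \ S).card := Finset.card_sdiff_comm hS
  rcases (S \ G).eq_empty_or_nonempty with h | h
  · have h' : G \ S = ∅ := by rw [← Finset.card_eq_zero, ← hcard, h, Finset.card_empty]
    rw [h, h']
  · obtain ⟨c, hc, hmax⟩ := Finset.exists_max_image _ v h
    calc ∑ i ∈ S \ G, v i ≤ (S \ G).card • v c := Finset.sum_le_card_nsmul _ _ _ hmax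
      _ = (G \ S).card • v c := by rw [hcard]
      _ ≤ ∑ i ∈ G \ S, v i := Finset.card_nsmul_le_sum _ _ _ fun i hi =>
          hG i (Finset.mem_sdiff.1 hi).1 c (Finset.mem_sdiff.1 hc).2

namespace IsTopSplit

variable {k : ℕ} {v : ι → ℝ} {G : Finset ι} {s : ι}

theorem top_insert (h : IsTopSplit k v G s) :
    ∀ z ∈ insert s G, ∀ z' ∉ insert s G, v z' ≤ v z := by
  intro z hz z' hz'
  have hz'' : z' ∉ G := fun h' => hz' (Finset.mem_insert_of_mem h')
  rcases Finset.mem_insert.1 hz with rfl | hz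
  · exact h.max z' hz''
  · exact h.top z hz z' hz''

theorem card_insert (h : IsTopSplit k v G s) (hk : 1 ≤ k) {z : ι} (hz : z ∉ G) :
    (insert z G).card = k := by
  rw [Finset.card_insert_of_notMem hz, h.card]
  omega

end IsTopSplit

variable [Fintype ι]

theorem topSum_eq_of_top {v : ι → ℝ} {G : Finset ι} (hG : ∀ z ∈ G, ∀ z' ∉ G, v z' ≤ v z) :
    topSum G.card v = ∑ i ∈ G, v i := by
  have : Nonempty {S : Finset ι // S.card = G.card} := ⟨⟨G, rfl⟩⟩
  exact le_antisymm (ciSup_le fun S => sum_le_sum_of_top hG S.2) (sum_le_topSum v rfl)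

namespace IsTopSplit

variable {k : ℕ} {v : ι → ℝ} {G : Finset ι} {s : ι}

theorem topSum_eq (h : IsTopSplit k v G s) (hk : 1 ≤ k) :
    topSum k v = v s + ∑ i ∈ G, v i := by
  rw [← Finset.sum_insert h.notMem, ← topSum_eq_of_top h.top_insert, h.card_insert hk h.notMem]

theorem threshold_eq (h : IsTopSplit k v G s) (hk : 1 ≤ k) : threshold k v = v s := by
  rw [threshold, h.topSum_eq hk, ← h.card, topSum_eq_of_top h.top]
  ring

theorem topRegret_insert (h : IsTopSplit k v G s) (hk : 1 ≤ k) {z : ι} (hz : z ∉ G) :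
    topRegret k v (insert z G) = v s - v z := by
  rw [topRegret, h.topSum_eq hk, Finset.sum_insert hz]
  ring

end IsTopSplit

theorem exists_isTopSplit {k : ℕ} (hk : 1 ≤ k) (hk' : k ≤ Fintype.card ι) (v : ι → ℝ) :
    ∃ G s, IsTopSplit k v G s := by
  obtain ⟨n, rfl⟩ : ∃ n, k = n + 1 := ⟨k - 1, by omega⟩
  clear hk
  have split : ∀ n, n + 1 ≤ Fintype.card ι → ∀ G : Finset ι, G.card = n →
      (∀ z ∈ G, ∀ z' ∉ G, v z' ≤ v z) → ∃ s, IsTopSplit (n + 1) v G s := by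
    intro n hn G hG htop
    have hne : Gᶜ.Nonempty := by
      rw [← Finset.card_pos, Finset.card_compl]
      omega
    obtain ⟨s, hs, hmax⟩ := Finset.exists_max_image _ v hne
    exact ⟨s, hG, Finset.mem_compl.1 hs, htop, fun z hz => hmax z (Finset.mem_compl.2 hz)⟩
  induction n with
  | zero => exact ⟨∅, split 0 hk' ∅ rfl (by simp)⟩
  | succ n ih =>
    obtain ⟨G, s, h⟩ := ih (by omega)
    exact ⟨insert s G, split _ hk' _ (h.card_insert (by omega) h.notMem) h.top_insert⟩

/-- Replacing each value by its maximum with the threshold does not change the top sum, whence the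
total shortfall of a selection below the threshold is at most its regret. -/
theorem sum_max_threshold_le {k : ℕ} (hk : 1 ≤ k) (hk' : k ≤ Fintype.card ι) (v : ι → ℝ)
    {S : Finset ι} (hS : S.card = k) :
    ∑ z ∈ S, max (threshold k v - v z) 0 ≤ topRegret k v S := by
  obtain ⟨G, s, h⟩ := exists_isTopSplit hk hk' v
  rw [h.threshold_eq hk, topRegret, h.topSum_eq hk, ← Finset.sum_insert h.notMem, le_sub_iff_add_le,
    ← Finset.sum_add_distrib]
  have hge : ∀ z ∈ insert s G, v s ≤ v z := by
    intro z hz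
    rcases Finset.mem_insert.1 hz with rfl | hz
    · exact le_rfl
    · exact h.top z hz s h.notMem
  have h1 : ∀ z, max (v s - v z) 0 + v z = max (v s) (v z) := by
    intro z
    rw [max_add_add_right (v s - v z) 0 (v z) |>.symm]
    simp
  simp only [h1]
  refine (sum_le_sum_of_top (G := insert s G) ?_ ?_).trans (le_of_eq ?_)
  · intro z hz z' hz'
    exact max_le_max le_rfl (h.top_insert z hz z' hz')
  · rw [hS, h.card_insert hk h.notMem]
  · exact Finset.sum_congr rfl fun z hz => max_eq_right (hge z hz)

theorem sum_inv_coverage_le {k : ℕ} (hk : 1 ≤ k) (hk' : k ≤ Fintype.card ι) {K γ : ℝ}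
    (hγ : 0 ≤ γ) (v : ι → ℝ) {S : Finset ι} (hS : S.card = k) :
    ∑ z ∈ S, (coverage k K γ v z)⁻¹ ≤ k * K + γ * topRegret k v S := by
  have h := mul_le_mul_of_nonneg_left (sum_max_threshold_le hk hk' v hS) hγ
  simp only [coverage, one_div, inv_inv]
  rw [Finset.sum_add_distrib, Finset.sum_const, hS, nsmul_eq_mul, ← Finset.mul_sum]
  linarith

/-- The estimation error of a selection `S` is paid for by the data collected with scores `w`: by
the inequality of the arithmetic and geometric means, `|v - u| ≤ 1 / (4 γ q) + γ q (v - u) ^ 2`. -/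
theorem sum_abs_sub_le {k : ℕ} (hk : 1 ≤ k) (hk' : k ≤ Fintype.card ι) {K γ' γ W' : ℝ}
    (hK : 1 ≤ K) (hγ' : 0 ≤ γ') (hγ : 0 < γ) (hle : γ' ≤ γ) (w u v : ι → ℝ)
    {S : Finset ι} (hS : S.card = k) (hw : topRegret k w S ≤ 2 * topRegret k u S + W') :
    ∑ z ∈ S, |v z - u z| ≤ 1 / 2 * topRegret k u S +
      (1 / (4 * γ) * (k * K + γ' * W') + γ * coveredError k K γ' w u v) := by
  have h1 : ∀ z ∈ S, |v z - u z| ≤ 1 / (4 * γ) * (coverage k K γ' w z)⁻¹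
      + γ * (coverage k K γ' w z * (v z - u z) ^ 2) := by
    intro z _
    have hq := coverage_pos (k := k) hK hγ' w z
    set q := coverage k K γ' w z
    set d := |v z - u z| with hd
    have hd2 : (v z - u z) ^ 2 = d ^ 2 := by rw [hd, sq_abs]
    have h2 : 1 / (4 * γ) * q⁻¹ + γ * (q * (v z - u z) ^ 2) - d
        = (1 - 2 * γ * q * d) ^ 2 / (4 * γ * q) := by
      rw [hd2]
      field_simp
      ring
    have h3 : 0 ≤ (1 - 2 * γ * q * d) ^ 2 / (4 * γ * q) := by positivity
    linarith
  have h2 : ∑ z ∈ S, coverage k K γ' w z * (v z - u z) ^ 2 ≤ coveredError k K γ' w u v :=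
    Finset.sum_le_univ_sum_of_nonneg fun z => mul_nonneg (coverage_pos hK hγ' w z).le (sq_nonneg _)
  have h3 := sum_inv_coverage_le hk hk' (K := K) hγ' w hS
  have h4 : γ' * topRegret k w S ≤ γ' * W' + 2 * γ * topRegret k u S := by
    have := mul_le_mul_of_nonneg_left hw hγ'
    have := mul_le_mul_of_nonneg_right hle (topRegret_nonneg u hS)
    linarith
  refine (Finset.sum_le_sum h1).trans ?_
  rw [Finset.sum_add_distrib, ← Finset.mul_sum, ← Finset.mul_sum]
  have h5 : 1 / (4 * γ) * ∑ z ∈ S, (coverage k K γ' w z)⁻¹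
      ≤ 1 / (4 * γ) * (k * K + (γ' * W' + 2 * γ * topRegret k u S)) :=
    mul_le_mul_of_nonneg_left (by linarith) (by positivity)
  have h6 : 1 / (4 * γ) * (k * K + (γ' * W' + 2 * γ * topRegret k u S))
      = 1 / 2 * topRegret k u S + 1 / (4 * γ) * (k * K + γ' * W') := by
    field_simp
    ring
  have h7 := mul_le_mul_of_nonneg_left h2 hγ.le
  linarith

/-- If the regrets with respect to old scores `w` are controlled by the true regrets, and `v` is
close to the truth `u` on the data collected with `w`, then the regrets with respect to `v` and `u`
control each other. -/
theorem topRegret_transfer {k : ℕ} (hk : 1 ≤ k) (hk' : k ≤ Fintype.card ι) {K γ' γ W' : ℝ}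
    (hK : 1 ≤ K) (hγ' : 0 ≤ γ') (hγ : 0 < γ) (hle : γ' ≤ γ) (w u v : ι → ℝ)
    (hw : ∀ S : Finset ι, S.card = k → topRegret k w S ≤ 2 * topRegret k u S + W')
    {S : Finset ι} (hS : S.card = k) :
    topRegret k v S ≤ 2 * topRegret k u S +
        (1 / (2 * γ) * (k * K + γ' * W') + 2 * γ * coveredError k K γ' w u v) ∧
      topRegret k u S ≤ 2 * topRegret k v S +
        2 * (1 / (2 * γ) * (k * K + γ' * W') + 2 * γ * coveredError k K γ' w u v) := by
  have herr : ∀ S : Finset ι, S.card = k → ∑ z ∈ S, |v z - u z| ≤ 1 / 2 * topRegret k u S +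
      (1 / (4 * γ) * (k * K + γ' * W') + γ * coveredError k K γ' w u v) := fun S hS =>
    sum_abs_sub_le hk hk' hK hγ' hγ hle w u v hS (hw S hS)
  have hhalf : 1 / (4 * γ) * (k * K + γ' * W') = 1 / 2 * (1 / (2 * γ) * (k * K + γ' * W')) := by
    field_simp
    ring
  obtain ⟨S₁, hS₁, hm₁⟩ := exists_sum_eq_topSum hk' v
  obtain ⟨S₂, hS₂, hm₂⟩ := exists_sum_eq_topSum hk' u
  have h0 := topRegret_nonneg u hS
  constructor
  · have h1 := topRegret_sub_le u v (S := S) hm₁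
    have h2 := herr S hS
    have h3 := herr S₁ hS₁
    have h4 := topRegret_nonneg u hS₁
    linarith
  · have h1 := topRegret_sub_le v u (S := S) hm₂
    simp only [abs_sub_comm (u _) (v _)] at h1
    have h2 := herr S hS
    have h3 := herr S₂ hS₂
    have h4 := topRegret_nonneg v hS₂
    have h5 : topRegret k u S₂ = 0 := by rw [topRegret, hm₂, sub_self]
    linarith

end TopK

section IGW

variable {k Z : ℕ} {v : Fin Z → ℝ} {G : Finset (Fin Z)} {s : Fin Z}

theorem IsTopSplit.card_compl (h : IsTopSplit k v G s) (hk : 1 ≤ k) (hkZ : k ≤ Z) :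
    ((Gᶜ.card : ℕ) : ℝ) = (Z : ℝ) - k + 1 := by
  rw [Finset.card_compl, Fintype.card_fin, h.card, Nat.cast_sub (by omega), Nat.cast_sub hk]
  push_cast
  ring

theorem igw_eq_zero (γ : ℝ) {z : Fin Z} (hz : z ∈ G) : igw Gᶜ γ v s z = 0 := by
  simp [igw, hz]

/-- The maximiser keeps at least the mass `1 / #Gᶜ`, since every other index gets at most that. -/
theorem IsTopSplit.coverage_le_igw (h : IsTopSplit k v G s) (hk : 1 ≤ k) {γ : ℝ} (hγ : 0 ≤ γ)
    {z : Fin Z} (hz : z ∉ G) : coverage k Gᶜ.card γ v z ≤ igw Gᶜ γ v s z := by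
  have hcard : (1 : ℝ) ≤ Gᶜ.card := by
    exact_mod_cast Finset.card_pos.2 ⟨z, Finset.mem_compl.2 hz⟩
  rw [coverage, h.threshold_eq hk, igw, if_pos (Finset.mem_compl.2 hz)]
  split_ifs with hzs
  · subst hzs
    rw [sub_self, max_self, mul_zero, add_zero]
    have h1 : ∑ z' ∈ Gᶜ.erase z, 1 / ((Gᶜ.card : ℝ) + γ * (v z - v z'))
        ≤ (Gᶜ.erase z).card • (1 / (Gᶜ.card : ℝ)) := by
      refine Finset.sum_le_card_nsmul _ _ _ fun z' hz' => ?_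
      refine one_div_le_one_div_of_le (by linarith) ?_
      have := mul_nonneg hγ (sub_nonneg.2
        (h.max z' (Finset.mem_compl.1 (Finset.mem_of_mem_erase hz'))))
      linarith
    rw [Finset.card_erase_of_mem (Finset.mem_compl.2 hz), nsmul_eq_mul, Nat.cast_sub
      (by exact_mod_cast hcard), Nat.cast_one] at h1
    have h2 : ((Gᶜ.card : ℝ) - 1) * (1 / (Gᶜ.card : ℝ)) = 1 - 1 / (Gᶜ.card : ℝ) := by
      field_simp
    linarith
  · rw [max_eq_left (sub_nonneg.2 (h.max z hz))]

/-- The expected estimated regret of the exploration slot. -/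
theorem IsTopSplit.sum_igw_mul_le (h : IsTopSplit k v G s) {γ : ℝ} (hγ : 0 < γ) :
    ∑ z, (v s - v z) * igw Gᶜ γ v s z ≤ Gᶜ.card / γ := by
  have h1 : ∀ z ∈ Gᶜ, (v s - v z) * igw Gᶜ γ v s z ≤ 1 / γ := by
    intro z hz
    by_cases hzs : z = s
    · rw [hzs, sub_self, zero_mul]
      positivity
    · have hgap := sub_nonneg.2 (h.max z (Finset.mem_compl.1 hz))
      have hcard : (1 : ℝ) ≤ Gᶜ.card := by exact_mod_cast Finset.card_pos.2 ⟨z, hz⟩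
      have hden : 0 < (Gᶜ.card : ℝ) + γ * (v s - v z) := by
        have := mul_nonneg hγ.le hgap
        linarith
      rw [igw, if_pos hz, if_neg hzs, mul_one_div, div_le_div_iff₀ hden hγ]
      linarith
  rw [← Finset.sum_subset (Finset.subset_univ Gᶜ) fun z _ hz => by
    rw [igw_eq_zero γ (by simpa using hz), mul_zero]]
  refine (Finset.sum_le_card_nsmul _ _ _ h1).trans (le_of_eq ?_)
  rw [nsmul_eq_mul, mul_one_div]

end IGW

/-! ### Comparison of true and estimated regrets over the epochs -/

section Epochs

variable {X ι : Type*} [MeasurableSpace X]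

theorem measurable_topSum [Finite ι] (k : ℕ) {V : X → ι → ℝ}
    (hV : ∀ z, Measurable fun x => V x z) : Measurable fun x => topSum k (V x) :=
  Measurable.iSup fun _ => Finset.measurable_sum _ fun z _ => hV z

theorem measurable_coverage [Finite ι] (k : ℕ) (K γ : ℝ) {V : X → ι → ℝ}
    (hV : ∀ z, Measurable fun x => V x z) (z : ι) :
    Measurable fun x => coverage k K γ (V x) z := by
  have h : Measurable fun x => threshold k (V x) :=
    (measurable_topSum k hV).sub (measurable_topSum (k - 1) hV)
  exact measurable_const.div (measurable_const.add
    (measurable_const.mul ((h.sub (hV z)).max measurable_const)))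

theorem measurable_coveredError [Fintype ι] (k : ℕ) (K γ : ℝ) {W U V : X → ι → ℝ}
    (hW : ∀ z, Measurable fun x => W x z) (hU : ∀ z, Measurable fun x => U x z)
    (hV : ∀ z, Measurable fun x => V x z) :
    Measurable fun x => coveredError k K γ (W x) (U x) (V x) :=
  Finset.measurable_sum _ fun z _ =>
    (measurable_coverage k K γ hW z).mul (((hV z).sub (hU z)).pow_const 2)

theorem sq_sub_le_one {s t : ℝ} (hs : s ∈ Set.Icc (0 : ℝ) 1) (ht : t ∈ Set.Icc (0 : ℝ) 1) :
    (s - t) ^ 2 ≤ 1 := by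
  rw [sq_le_one_iff_abs_le_one, abs_le]
  constructor <;> linarith [hs.1, hs.2, ht.1, ht.2]

theorem coveredError_le [Fintype ι] {k : ℕ} {K γ : ℝ} (hK : 1 ≤ K) (hγ : 0 ≤ γ) (w : ι → ℝ)
    {u v : ι → ℝ} (hu : ∀ z, u z ∈ Set.Icc (0 : ℝ) 1) (hv : ∀ z, v z ∈ Set.Icc (0 : ℝ) 1) :
    coveredError k K γ w u v ≤ Fintype.card ι := by
  refine (Finset.sum_le_card_nsmul _ _ 1 fun z _ => ?_).trans (by simp)
  exact mul_le_one₀ (coverage_le_one hK hγ _ z) (sq_nonneg _) (sq_sub_le_one (hv z) (hu z))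

theorem integrable_coveredError [Fintype ι] {μ : Measure X} [IsFiniteMeasure μ] {k : ℕ} {K γ : ℝ}
    (hK : 1 ≤ K) (hγ : 0 ≤ γ) {W U V : X → ι → ℝ}
    (hW : ∀ z, Measurable fun x => W x z) (hU : ∀ z, Measurable fun x => U x z)
    (hV : ∀ z, Measurable fun x => V x z) (hU1 : ∀ x z, U x z ∈ Set.Icc (0 : ℝ) 1)
    (hV1 : ∀ x z, V x z ∈ Set.Icc (0 : ℝ) 1) :
    Integrable (fun x => coveredError k K γ (W x) (U x) (V x)) μ := by
  refine Integrable.of_bound (measurable_coveredError k K γ hW hU hV).aestronglyMeasurable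
    (Fintype.card ι) (ae_of_all _ fun x => ?_)
  rw [Real.norm_eq_abs, abs_of_nonneg (coveredError_nonneg hK hγ _ _ _)]
  exact coveredError_le hK hγ _ (hU1 x) (hV1 x)

/-- Comparison of regrets over the epochs. `V l` are the scores used in epoch `l`, `U` is the truth,
and epoch `l` is fitted to the rounds `s < 2 ^ l`, of which round `s` belongs to epoch `log₂ s`. If
the scores of each epoch are close to the truth on the data they are fitted to, then there is a
slack function `W` of small mean with which regrets with respect to `V l` and `U` control each
other at every context and for every selection. The slack of an epoch is the average over the
rounds `s < 2 ^ l` of what `topRegret_transfer` gives for the epoch of round `s`. Since that slack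
is halved before it is passed on, the constant `5` reproduces itself: `(1 + 5) / 2 + 2 = 5`. -/
theorem exists_slack [Fintype ι] [DecidableEq ι] (μ : Measure X) [IsProbabilityMeasure μ] {k : ℕ}
    (hk : 1 ≤ k)
    (hk' : k ≤ Fintype.card ι) {K : ℝ} (hK : 1 ≤ K) {γ : ℕ → ℝ} (hγ0 : γ 0 = 0) (hmono : Monotone γ)
    (hpos : ∀ l, 1 ≤ l → 0 < γ l) {U : X → ι → ℝ} {V : ℕ → X → ι → ℝ} (L : ℕ)
    (hU : ∀ z, Measurable fun x => U x z) (hV : ∀ l ≤ L, ∀ z, Measurable fun x => V l x z)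
    (hU1 : ∀ x z, U x z ∈ Set.Icc (0 : ℝ) 1) (hV1 : ∀ l ≤ L, ∀ x z, V l x z ∈ Set.Icc (0 : ℝ) 1)
    (hfit : ∀ l, 1 ≤ l → l ≤ L → γ l ^ 2 * ∑ s ∈ Finset.range (2 ^ l),
      ∫ x, coveredError k K (γ (Nat.log 2 s)) (V (Nat.log 2 s) x) (U x) (V l x) ∂μ
        ≤ k * K * 2 ^ l) :
    ∀ l ≤ L, ∃ W : X → ℝ, Measurable W ∧ Integrable W μ ∧ γ l * ∫ x, W x ∂μ ≤ 5 * (k * K) ∧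
      ∀ x, ∀ S : Finset ι, S.card = k → topRegret k (V l x) S ≤ 2 * topRegret k (U x) S + W x ∧
        topRegret k (U x) S ≤ 2 * topRegret k (V l x) S + 2 * W x := by
  have hnn : ∀ l, 0 ≤ γ l := fun l => hγ0 ▸ hmono (Nat.zero_le l)
  intro l
  induction l using Nat.strong_induction_on with
  | _ l ih =>
  intro hl
  rcases Nat.eq_zero_or_pos l with rfl | hl1
  · refine ⟨fun _ => k, measurable_const, integrable_const _, ?_, fun x S hS => ⟨?_, ?_⟩⟩
    · rw [hγ0, zero_mul]
      positivity
    · have h1 := topRegret_le hk' (hV1 0 hl x) S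
      have h2 := topRegret_nonneg (U x) hS
      linarith
    · have h1 := topRegret_le hk' (hU1 x) S
      have h2 := topRegret_nonneg (V 0 x) hS
      have h3 : (0 : ℝ) ≤ k := Nat.cast_nonneg k
      linarith
  · have hlog : ∀ s ∈ Finset.range (2 ^ l), Nat.log 2 s < l := fun s hs =>
      Nat.log_lt_of_lt_pow' (by omega) (Finset.mem_range.1 hs)
    choose! W hWm hWi hWγ hW using fun j (hj : j < l) => ih j hj (by omega)
    have hγl := hpos l hl1
    set N : ℝ := 2 ^ l with hN
    have hNpos : 0 < N := by positivity
    have hcard : ((Finset.range (2 ^ l)).card : ℝ) = N := by simp [hN]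
    set w : ℕ → X → ℝ := fun s x => 1 / (2 * γ l) *
      (k * K + γ (Nat.log 2 s) * W (Nat.log 2 s) x) + 2 * γ l *
        coveredError k K (γ (Nat.log 2 s)) (V (Nat.log 2 s) x) (U x) (V l x) with hw
    have hcm : ∀ s ∈ Finset.range (2 ^ l), Measurable fun x =>
        coveredError k K (γ (Nat.log 2 s)) (V (Nat.log 2 s) x) (U x) (V l x) := fun s hs =>
      measurable_coveredError k K _ (hV _ ((hlog s hs).le.trans hl)) hU (hV l hl)
    have hci : ∀ s ∈ Finset.range (2 ^ l), Integrable (fun x =>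
        coveredError k K (γ (Nat.log 2 s)) (V (Nat.log 2 s) x) (U x) (V l x)) μ := fun s hs =>
      integrable_coveredError hK (hnn _) (hV _ ((hlog s hs).le.trans hl)) hU (hV l hl) hU1 (hV1 l hl)
    have hwm : ∀ s ∈ Finset.range (2 ^ l), Measurable (w s) := fun s hs =>
      (measurable_const.mul (measurable_const.add (measurable_const.mul (hWm _ (hlog s hs))))).add
        (measurable_const.mul (hcm s hs))
    have hwi1 : ∀ s ∈ Finset.range (2 ^ l), Integrable (fun x => 1 / (2 * γ l) *
      (k * K + γ (Nat.log 2 s) * W (Nat.log 2 s) x)) μ := fun s hs =>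
      ((integrable_const _).add ((hWi _ (hlog s hs)).const_mul _)).const_mul _
    have hwi : ∀ s ∈ Finset.range (2 ^ l), Integrable (w s) μ := fun s hs =>
      (hwi1 s hs).add ((hci s hs).const_mul _)
    have hwint : ∀ s ∈ Finset.range (2 ^ l), ∫ x, w s x ∂μ = 1 / (2 * γ l) *
      (k * K + γ (Nat.log 2 s) * ∫ x, W (Nat.log 2 s) x ∂μ) + 2 * γ l *
        ∫ x, coveredError k K (γ (Nat.log 2 s)) (V (Nat.log 2 s) x) (U x) (V l x) ∂μ := by
      intro s hs
      rw [hw, integral_add (hwi1 s hs) ((hci s hs).const_mul _), integral_const_mul,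
        integral_const_mul, integral_add (integrable_const _) ((hWi _ (hlog s hs)).const_mul _),
        integral_const_mul (γ (Nat.log 2 s)), integral_const]
      simp
    have havg : ∀ (a : ℝ) x, (∀ s ∈ Finset.range (2 ^ l), a ≤ w s x) →
        a ≤ N⁻¹ * ∑ s ∈ Finset.range (2 ^ l), w s x := by
      intro a x h
      have h1 := Finset.card_nsmul_le_sum _ _ _ h
      rw [nsmul_eq_mul, hcard] at h1
      rw [inv_mul_eq_div, le_div_iff₀ hNpos]
      linarith
    refine ⟨fun x => N⁻¹ * ∑ s ∈ Finset.range (2 ^ l), w s x,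
      measurable_const.mul (Finset.measurable_sum _ hwm),
      (integrable_finsetSum _ hwi).const_mul _, ?_, fun x S hS => ⟨?_, ?_⟩⟩
    · rw [integral_const_mul, integral_finsetSum _ hwi, Finset.sum_congr rfl hwint,
        Finset.sum_add_distrib, ← Finset.mul_sum, ← Finset.mul_sum]
      have h1 : ∑ s ∈ Finset.range (2 ^ l),
          (k * K + γ (Nat.log 2 s) * ∫ x, W (Nat.log 2 s) x ∂μ) ≤ N * (6 * (k * K)) := by
        refine (Finset.sum_le_card_nsmul _ _ (6 * (k * K)) fun s hs => ?_).trans (le_of_eq ?_)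
        · have := hWγ _ (hlog s hs)
          linarith
        · rw [nsmul_eq_mul, hcard]
      have h2 := hfit l hl1 hl
      set A := ∑ s ∈ Finset.range (2 ^ l),
          (k * K + γ (Nat.log 2 s) * ∫ x, W (Nat.log 2 s) x ∂μ)
      set B := ∑ s ∈ Finset.range (2 ^ l),
        ∫ x, coveredError k K (γ (Nat.log 2 s)) (V (Nat.log 2 s) x) (U x) (V l x) ∂μ
      have h3 : γ l * (N⁻¹ * (1 / (2 * γ l) * A + 2 * γ l * B))
          = (A / 2 + 2 * (γ l ^ 2 * B)) / N := by
        field_simp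
      rw [h3, div_le_iff₀ hNpos]
      linarith
    · have := havg (topRegret k (V l x) S - 2 * topRegret k (U x) S) x fun s hs => by
        have := (topRegret_transfer hk hk' hK (hnn _) hγl (hmono (hlog s hs).le)
          (V (Nat.log 2 s) x) (U x) (V l x) (fun S hS => (hW _ (hlog s hs) x S hS).1) hS).1
        simp only [hw]
        linarith
      linarith
    · have := havg ((topRegret k (U x) S - 2 * topRegret k (V l x) S) / 2) x fun s hs => by
        have := (topRegret_transfer hk hk' hK (hnn _) hγl (hmono (hlog s hs).le)
          (V (Nat.log 2 s) x) (U x) (V l x) (fun S hS => (hW _ (hlog s hs) x S hS).1) hS).2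
        simp only [hw]
        linarith
      linarith

end Epochs

/-! ### Conditional expectations -/

section CondExp

variable {Ω : Type*} {m mΩ : MeasurableSpace Ω} {P : Measure Ω}

theorem integral_mul_condExp [IsFiniteMeasure P] (hm : m ≤ mΩ) {ξ f : Ω → ℝ}
    (hξ : Measurable[m] ξ) {C : ℝ}
    (hC : ∀ᵐ ω ∂P, |ξ ω| ≤ C) (hf : Integrable f P) :
    ∫ ω, ξ ω * (P[f | m]) ω ∂P = ∫ ω, ξ ω * f ω ∂P := by
  have h := condExp_stronglyMeasurable_mul_of_bound₀ hm hξ.stronglyMeasurable.aestronglyMeasurable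
    hf C hC
  rw [← integral_condExp (f := fun ω => ξ ω * f ω) hm]
  exact integral_congr_ae h.symm

/-- A function of `ω` which depends on `ω` also through a random element `y` of a finite set is
measurable if it is so for each fixed value of `y`. -/
theorem measurable_of_finite_range {β : Type*} {s : Finset β} {y : Ω → β} (hy : ∀ ω, y ω ∈ s)
    (hm : ∀ w ∈ s, MeasurableSet[m] {ω | y ω = w}) {φ : β → Ω → ℝ}
    (hφ : ∀ w ∈ s, Measurable[m] (φ w)) : Measurable[m] fun ω => φ (y ω) ω := by
  have h : (fun ω => φ (y ω) ω) = fun ω => ∑ w ∈ s, {ω | y ω = w}.indicator (φ w) ω := by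
    funext ω
    rw [Finset.sum_eq_single_of_mem (y ω) (hy ω)]
    · simp
    · intro w _ hw
      have h : ω ∉ {ω | y ω = w} := fun h => hw (Eq.symm h)
      simp [h]
  rw [h]
  exact Finset.measurable_sum _ fun w hw => (hφ w hw).indicator (hm w hw)

theorem isPiSystem_inter (m₁ m₂ : MeasurableSpace Ω) :
    IsPiSystem {s | ∃ u v, MeasurableSet[m₁] u ∧ MeasurableSet[m₂] v ∧ s = u ∩ v} := by
  rintro _ ⟨u, v, hu, hv, rfl⟩ _ ⟨u', v', hu', hv', rfl⟩ -
  exact ⟨u ∩ u', v ∩ v', hu.inter hu', hv.inter hv', Set.inter_inter_inter_comm _ _ _ _⟩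

theorem sup_eq_generateFrom_inter (m₁ m₂ : MeasurableSpace Ω) :
    m₁ ⊔ m₂ = MeasurableSpace.generateFrom
      {s | ∃ u v, MeasurableSet[m₁] u ∧ MeasurableSet[m₂] v ∧ s = u ∩ v} := by
  refine le_antisymm (sup_le ?_ ?_) (MeasurableSpace.generateFrom_le ?_)
  · exact fun u hu => MeasurableSpace.measurableSet_generateFrom
      ⟨u, Set.univ, hu, MeasurableSet.univ, (Set.inter_univ u).symm⟩
  · exact fun v hv => MeasurableSpace.measurableSet_generateFrom
      ⟨Set.univ, v, MeasurableSet.univ, hv, (Set.univ_inter v).symm⟩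
  · rintro _ ⟨u, v, hu, hv, rfl⟩
    exact MeasurableSet.inter ((le_sup_left : m₁ ≤ m₁ ⊔ m₂) u hu) ((le_sup_right : m₂ ≤ m₁ ⊔ m₂) v hv)

theorem integral_mul_comp_of_indep [IsProbabilityMeasure P] {E : Type*} {mE : MeasurableSpace E}
    {W : Ω → E} (hW : Measurable W) (hm : m ≤ mΩ) (hind : Indep (mE.comap W) m P)
    {ξ : Ω → ℝ} (hξ : Measurable[m] ξ) {φ : E → ℝ} (hφ : Measurable φ) :
    ∫ ω, ξ ω * φ (W ω) ∂P = (∫ ω, ξ ω ∂P) * ∫ w, φ w ∂(P.map W) := by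
  have h : IndepFun ξ (fun ω => φ (W ω)) P := by
    rw [IndepFun_iff_Indep]
    refine indep_of_indep_of_le_left (indep_of_indep_of_le_right hind.symm ?_) hξ.comap_le
    exact (hφ.comp (comap_measurable W)).comap_le
  rw [integral_map hW.aemeasurable hφ.aestronglyMeasurable]
  exact h.integral_fun_mul_eq_mul_integral (hξ.mono hm le_rfl).aestronglyMeasurable
    (hφ.comp hW).aestronglyMeasurable

/-- Enlarging the conditioning by an independent `σ`-algebra does not change a conditional
expectation; here for a random element `W` of law `𝒟` and conditioning on a part `mF` of `W`. -/
theorem condExp_sup_comap_of_indep [IsProbabilityMeasure P] {E : Type*} {mF mE : MeasurableSpace E}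
    {𝒟 : Measure E} [IsProbabilityMeasure 𝒟] {W : Ω → E} (hW : Measurable W) (hlaw : P.map W = 𝒟)
    (hm : m ≤ mΩ) (hF : mF ≤ mE) (hind : Indep (mE.comap W) m P) {φ : E → ℝ} (hφ : Integrable φ 𝒟) :
    P[fun ω => φ (W ω) | m ⊔ mF.comap W] =ᵐ[P] fun ω => (𝒟[φ | mF]) (W ω) := by
  have hFc : mF.comap W ≤ mΩ := (MeasurableSpace.comap_mono hF).trans hW.comap_le
  have hsup : m ⊔ mF.comap W ≤ mΩ := sup_le hm hFc
  have hint : ∀ {ψ : E → ℝ}, Integrable ψ 𝒟 → Integrable (fun ω => ψ (W ω)) P := by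
    intro ψ hψ
    rw [← hlaw] at hψ
    exact hψ.comp_measurable hW
  have hκ : Integrable (𝒟[φ | mF]) 𝒟 := integrable_condExp
  have hset : ∀ s, MeasurableSet[m ⊔ mF.comap W] s →
      ∫ ω in s, (𝒟[φ | mF]) (W ω) ∂P = ∫ ω in s, φ (W ω) ∂P := by
    intro s hs
    induction s, hs using MeasurableSpace.induction_on_inter (sup_eq_generateFrom_inter _ _)
      (isPiSystem_inter m (mF.comap W)) with
    | empty => simp
    | basic s hs =>
      obtain ⟨u, v, hu, ⟨v, hv, rfl⟩, rfl⟩ := hs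
      -- on a rectangle both sides factor by independence
      have key : ∀ {ψ : E → ℝ}, Integrable ψ 𝒟 → ∫ ω in u ∩ W ⁻¹' v, ψ (W ω) ∂P
          = P.real u * ∫ w in v, ψ w ∂𝒟 := by
        intro ψ hψ
        obtain ⟨ψ', hψ', hae⟩ := hψ.aestronglyMeasurable.aemeasurable
        have hae' : (fun ω => ψ (W ω)) =ᵐ[P] fun ω => ψ' (W ω) := by
          rw [← hlaw] at hae
          exact ae_of_ae_map hW.aemeasurable hae
        rw [integral_congr_ae (ae_restrict_of_ae hae'), integral_congr_ae (ae_restrict_of_ae hae),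
          ← integral_indicator ((hm u hu).inter (hW (hF v hv))), ← integral_indicator (hF v hv)]
        have h1 : ((u ∩ W ⁻¹' v).indicator fun ω => ψ' (W ω))
            = fun ω => u.indicator (fun _ => (1 : ℝ)) ω * v.indicator ψ' (W ω) := by
          funext ω
          by_cases h1 : ω ∈ u <;> by_cases h2 : W ω ∈ v <;> simp [h1, h2]
        rw [h1, integral_mul_comp_of_indep hW hm hind (measurable_const.indicator hu)
          (hψ'.indicator (hF v hv)), hlaw, integral_indicator_const _ (hm u hu)]
        simp
      rw [key hκ, key hφ, setIntegral_condExp hF hφ hv]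
    | compl s hs ih =>
      have h1 := integral_add_compl (hsup s hs) (hint hκ)
      have h2 := integral_add_compl (hsup s hs) (hint hφ)
      have h3 : ∫ ω, (𝒟[φ | mF]) (W ω) ∂P = ∫ ω, φ (W ω) ∂P := by
        have e1 := integral_map (μ := P) hW.aemeasurable (f := 𝒟[φ | mF])
          (hlaw.symm ▸ hκ.aestronglyMeasurable)
        have e2 := integral_map (μ := P) hW.aemeasurable (f := φ)
          (hlaw.symm ▸ hφ.aestronglyMeasurable)
        rw [← e1, ← e2, hlaw, integral_condExp hF]
      linarith
    | iUnion f hd hf ih =>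
      rw [integral_iUnion (fun i => hsup _ (hf i)) hd (hint hκ).integrableOn,
        integral_iUnion (fun i => hsup _ (hf i)) hd (hint hφ).integrableOn]
      exact tsum_congr ih
  refine (ae_eq_condExp_of_forall_setIntegral_eq hsup (hint hφ)
    (fun s _ _ => (hint hκ).integrableOn) (fun s hs _ => hset s hs) ?_).symm
  refine StronglyMeasurable.aestronglyMeasurable ?_
  have h1 : Measurable[mF.comap W] fun ω => (𝒟[φ | mF]) (W ω) :=
    (stronglyMeasurable_condExp (m := mF)).measurable.comp (comap_measurable W)
  exact (h1.mono (le_sup_right : mF.comap W ≤ m ⊔ mF.comap W) le_rfl).stronglyMeasurable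

end CondExp

/-! ### The choices made in one round -/

section Arms

variable {A p m H b Z : ℕ} {X : Type*} [MeasurableSpace X] {𝒯 : ArmTree A p m H}
  {g : ℕ → ℕ → X → ℝ}

/-- A class of measurable, tree-constant functions with values in `[0, 1]`. -/
structure IsRegularClass (𝒯 : ArmTree A p m H) (g : ℕ → ℕ → X → ℝ) (b : ℕ)
    (F : Finset (X → Fin A → ℝ)) : Prop where
  measurable : ∀ f ∈ F, ∀ a, Measurable fun x => f x a
  mem_Icc : ∀ f ∈ F, ∀ x a, f x a ∈ Set.Icc (0 : ℝ) 1
  const : ∀ f ∈ F, IsTreeConstant 𝒯 g b f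

variable (ord : ArmOrder 𝒯 g b Z)

theorem ArmOrder.arm_mem (x : X) (z : Fin Z) : ord.arm x z ∈ effectiveArms 𝒯 g b x :=
  ord.image_eq x ▸ Finset.mem_image_of_mem _ (Finset.mem_univ z)

theorem ArmOrder.eq_of_mem {x : X} {z z' : Fin Z} {a : Fin A} (h : a ∈ ord.arm x z)
    (h' : a ∈ ord.arm x z') : z = z' :=
  ord.injective x (effectiveArms_eq_of_mem 𝒯 g b x (ord.arm_mem x z) (ord.arm_mem x z') h h')

theorem ArmOrder.exists_mem (x : X) (a : Fin A) : ∃ z, a ∈ ord.arm x z := by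
  obtain ⟨e, he, ha⟩ := exists_mem_effectiveArms 𝒯 g b x a
  rw [← ord.image_eq x] at he
  obtain ⟨z, -, rfl⟩ := Finset.mem_image.1 he
  exact ⟨z, ha⟩

theorem ArmOrder.eq_reduced {f : X → Fin A → ℝ} (hf : IsTreeConstant 𝒯 g b f) {x : X} {z : Fin Z}
    {a : Fin A} (ha : a ∈ ord.arm x z) : f x a = reduced ord.rep f x z := by
  have hrep := ord.rep_mem x z
  rcases Finset.mem_union.1 (ord.arm_mem x z) with h | h
  · obtain ⟨a', -, h⟩ := (mem_singletonArms 𝒯 g b x).1 h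
    rw [← h, Finset.mem_singleton] at ha hrep
    rw [reduced, ha, hrep]
  · exact hf x _ h a ha _ hrep

theorem ArmOrder.measurable_reduced {f : X → Fin A → ℝ} (hf : ∀ a, Measurable fun x => f x a)
    (z : Fin Z) : Measurable fun x => reduced ord.rep f x z :=
  measurable_of_finite_range (s := Finset.univ) (fun _ => Finset.mem_univ _)
    (fun a _ => ord.measurable_rep z a) (φ := fun a x => f x a) fun a _ => hf a

/-- The optimal value of a round is at most the top sum of the reduced values: arms in different
effective arms have different indices, and every arm has one. -/
theorem ArmOrder.bestValue_le {k : ℕ} (hkZ : k ≤ Z) {f : X → Fin A → ℝ}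
    (hf : IsTreeConstant 𝒯 g b f) (hf0 : ∀ x a, 0 ≤ f x a) (x : X) :
    bestValue k (effectiveArms 𝒯 g b x) (f x) ≤ topSum k (reduced ord.rep f x) := by
  refine Real.iSup_le (fun s => ?_) ?_
  · choose ζ hζ using ord.exists_mem x
    have hinj : Set.InjOn ζ s.1 := by
      intro a ha a' ha' h
      refine Finset.card_le_one.1 (s.2.2 _ (ord.arm_mem x (ζ a))) a ?_ a' ?_
      · exact Finset.mem_inter.2 ⟨ha, hζ a⟩
      · exact Finset.mem_inter.2 ⟨ha', h ▸ hζ a'⟩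
    calc ∑ a ∈ s.1, f x a = ∑ a ∈ s.1, reduced ord.rep f x (ζ a) :=
          Finset.sum_congr rfl fun a _ => ord.eq_reduced hf (hζ a)
      _ = ∑ z ∈ s.1.image ζ, reduced ord.rep f x z := (Finset.sum_image hinj).symm
      _ ≤ _ := sum_le_topSum _ (by rw [Finset.card_image_of_injOn hinj, s.2.1])
  · obtain ⟨S, hS, -⟩ := exists_sum_eq_topSum (ι := Fin Z) (k := k)
      (by rwa [Fintype.card_fin]) (reduced ord.rep f x)
    exact (Finset.sum_nonneg fun z _ => hf0 x _).trans (sum_le_topSum _ hS)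

end Arms

theorem epochEnd_log_le (t : ℕ) : epochEnd (Nat.log 2 t) ≤ t := by
  rcases h : Nat.log 2 t with _ | l
  · exact Nat.zero_le t
  · rw [epochEnd, ← h]
    exact Nat.pow_log_le_self 2 fun h0 => by simp [h0] at h

theorem lt_epochEnd_log (t : ℕ) : t < epochEnd (Nat.log 2 t + 1) :=
  Nat.lt_pow_succ_log_self (by norm_num) t

namespace ExtremeRun

variable {A p m H b Z : ℕ} {X : Type*} [MeasurableSpace X] {𝒯 : ArmTree A p m H}
  {g : ℕ → ℕ → X → ℝ} {Ω : Type*} [mΩ : MeasurableSpace Ω] {P : Measure Ω}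
  {ord : ArmOrder 𝒯 g b Z} {𝒟 : Measure (X × (Fin A → ℝ))} {F : Finset (X → Fin A → ℝ)}
  {k T : ℕ} {γ : ℕ → ℝ} (R : ExtremeRun P ord 𝒟 F k T γ)

/-- What is known when the arms of round `t` are selected: the history and the context. -/
abbrev obs (t : ℕ) : MeasurableSpace Ω := R.ℋ t ⊔ MeasurableSpace.comap (R.x t) inferInstance

/-- The regression estimate in use in round `t`, whose epoch has the number `⌊log₂ t⌋ + 1`. -/
def score (t : ℕ) (ω : Ω) : X → Fin Z → ℝ := R.yhat (Nat.log 2 t + 1) ω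

/-- The effective arms selected in round `t`. -/
def chosen (t : ℕ) (ω : Ω) : Finset (Fin Z) := insert (R.explore t ω) (R.greedy t ω)

open Classical in
/-- The reduced class. -/
def scoreClass (_ : ExtremeRun P ord 𝒟 F k T γ) : Finset (X → Fin Z → ℝ) :=
  F.image (reduced ord.rep)

variable {R} {t : ℕ}

theorem mem_scoreClass {w : X → Fin Z → ℝ} :
    w ∈ R.scoreClass ↔ ∃ f ∈ F, reduced ord.rep f = w := by
  classical
  simp [scoreClass]

theorem yhat_mem_scoreClass {l : ℕ} (hl : epochEnd l < T) (ω : Ω) :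
    R.yhat (l + 1) ω ∈ R.scoreClass := by
  obtain ⟨f, hf, h⟩ := R.yhat_mem l hl ω
  exact mem_scoreClass.2 ⟨f, hf, h.symm⟩

theorem score_mem (ht : t < T) (ω : Ω) : R.score t ω ∈ R.scoreClass :=
  yhat_mem_scoreClass ((epochEnd_log_le t).trans_lt ht) ω

theorem measurableSet_yhat {l : ℕ} (hl : epochEnd l < T) (hlt : epochEnd l ≤ t) :
    ∀ w ∈ R.scoreClass, MeasurableSet[R.ℋ t] {ω | R.yhat (l + 1) ω = w} := by
  intro w hw
  obtain ⟨f, hf, rfl⟩ := mem_scoreClass.1 hw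
  exact R.ℋ.mono hlt _ (R.measurable_yhat l hl f hf)

theorem measurableSet_score (ht : t < T) :
    ∀ w ∈ R.scoreClass, MeasurableSet[R.ℋ t] {ω | R.score t ω = w} :=
  measurableSet_yhat ((epochEnd_log_le t).trans_lt ht) (epochEnd_log_le t)

theorem le_obs : R.ℋ t ≤ R.obs t := le_sup_left

theorem measurable_x_obs : Measurable[R.obs t] (R.x t) :=
  (comap_measurable (R.x t)).mono
    (le_sup_right : _ ≤ R.ℋ t ⊔ MeasurableSpace.comap (R.x t) inferInstance) le_rfl

theorem obs_le_succ (ht : t < T) : R.obs t ≤ R.ℋ (t + 1) :=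
  sup_le (R.ℋ.mono (Nat.le_succ t)) (R.measurable_x t ht).comap_le

theorem obs_le (ht : t < T) : R.obs t ≤ mΩ := (obs_le_succ ht).trans (R.ℋ.le _)

theorem measurable_score_apply (hF : IsRegularClass 𝒯 g b F) (ht : t < T) (z : Fin Z) :
    Measurable[R.obs t] fun ω => R.score t ω (R.x t ω) z := by
  refine measurable_of_finite_range (score_mem ht) (fun w hw => le_obs _ (measurableSet_score ht w hw))
    (φ := fun w ω => w (R.x t ω) z) fun w hw => ?_
  obtain ⟨f, hf, rfl⟩ := mem_scoreClass.1 hw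
  exact (ord.measurable_reduced (hF.measurable f hf) z).comp measurable_x_obs

theorem score_mem_Icc (hF : IsRegularClass 𝒯 g b F) (ht : t < T) (ω : Ω) (x : X) (z : Fin Z) :
    R.score t ω x z ∈ Set.Icc (0 : ℝ) 1 := by
  obtain ⟨f, hf, h⟩ := mem_scoreClass.1 (score_mem (R := R) ht ω)
  rw [← h]
  exact hF.mem_Icc f hf x _

theorem isTopSplit (ht : t < T) (ω : Ω) :
    IsTopSplit k (R.score t ω (R.x t ω)) (R.greedy t ω) (R.star t ω) where
  card := R.greedy_card t ht ω
  notMem := R.star_notMem t ht ω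
  top := R.greedy_top _ t ht (epochEnd_log_le t) (lt_epochEnd_log t) ω
  max := R.star_max _ t ht (epochEnd_log_le t) (lt_epochEnd_log t) ω

theorem sum_inter_arm (S : Finset (Fin A)) (ht : t < T) (ω : Ω) (hS : S ⊆ R.B t ω)
    (φ : Fin A → ℝ) :
    ∑ z ∈ R.chosen t ω, ∑ a ∈ S ∩ ord.arm (R.x t ω) z, φ a = ∑ a ∈ S, φ a := by
  rw [← Finset.sum_biUnion fun z _ z' _ hne => Finset.disjoint_left.2 fun a h h' =>
    hne (ord.eq_of_mem (Finset.mem_inter.1 h).2 (Finset.mem_inter.1 h').2)]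
  refine Finset.sum_congr ?_ fun _ _ => rfl
  rw [← Finset.inter_biUnion]
  exact Finset.inter_eq_left.2 (hS.trans (R.B_subset t ht ω))

theorem sum_B_eq (ht : t < T) (ω : Ω) (φ : Fin A → ℝ) (ψ : Fin Z → ℝ)
    (h : ∀ z, ∀ a ∈ ord.arm (R.x t ω) z, φ a = ψ z) :
    ∑ a ∈ R.B t ω, φ a = ∑ z ∈ R.chosen t ω, ψ z := by
  rw [← sum_inter_arm _ ht ω subset_rfl]
  refine Finset.sum_congr rfl fun z hz => ?_
  rw [Finset.sum_congr rfl fun a ha => h z a (Finset.mem_inter.1 ha).2, Finset.sum_const,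
    R.B_inter t ht ω z hz, one_smul]

theorem card_chosen_le (hk : 1 ≤ k) (ht : t < T) (ω : Ω) : (R.chosen t ω).card ≤ k := by
  have := Finset.card_insert_le (R.explore t ω) (R.greedy t ω)
  rw [R.greedy_card t ht ω] at this
  rw [chosen]
  omega

theorem card_Φ_le (hk : 1 ≤ k) (ht : t < T) (ω : Ω) : ((R.Φ t ω).card : ℝ) ≤ k := by
  have h1 := sum_B_eq (R := R) ht ω (fun _ => 1) (fun _ => 1) fun _ _ _ => rfl
  simp only [Finset.sum_const, nsmul_eq_mul, mul_one] at h1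
  have h2 := Finset.card_le_card (R.Φ_subset t ht ω)
  have h3 := card_chosen_le (R := R) hk ht ω
  rw [← Nat.cast_le (α := ℝ)] at h2 h3
  linarith

theorem measurable_B_top (ht : t < T) : Measurable[R.ℋ (t + 1), ⊤] (R.B t) :=
  @measurable_to_countable' _ _ ⊤ _ (R.ℋ (t + 1)) _ fun z => R.measurable_B t ht z

theorem measurable_Φ_top (ht : t < T) : Measurable[R.ℋ (t + 1), ⊤] (R.Φ t) :=
  @measurable_to_countable' _ _ ⊤ _ (R.ℋ (t + 1)) _ fun z => R.measurable_Φ t ht z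

theorem measurable_greedy_top (ht : t < T) : Measurable[R.obs t, ⊤] (R.greedy t) :=
  @measurable_to_countable' _ _ ⊤ _ (R.obs t) _ fun z => R.measurable_greedy t ht z

theorem measurableSet_mem_Φ (ht : t < T) (a : Fin A) :
    MeasurableSet[R.ℋ (t + 1)] {ω | a ∈ R.Φ t ω} :=
  measurable_Φ_top (R := R) ht (show MeasurableSet[⊤] {s | a ∈ s} from trivial)

theorem measurableSet_mem_B (ht : t < T) (a : Fin A) :
    MeasurableSet[R.ℋ (t + 1)] {ω | a ∈ R.B t ω} :=
  measurable_B_top (R := R) ht (show MeasurableSet[⊤] {s | a ∈ s} from trivial)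

theorem measurableSet_mem_greedy (ht : t < T) (z : Fin Z) :
    MeasurableSet[R.obs t] {ω | z ∈ R.greedy t ω} :=
  measurable_greedy_top (R := R) ht (show MeasurableSet[⊤] {s | z ∈ s} from trivial)

theorem measurableSet_mem_chosen (ht : t < T) (z : Fin Z) :
    MeasurableSet[R.ℋ (t + 1)] {ω | z ∈ R.chosen t ω} := by
  have h : {ω | z ∈ R.chosen t ω} = {ω | R.explore t ω = z} ∪ {ω | z ∈ R.greedy t ω} := by
    ext ω
    simp [chosen, eq_comm]
  rw [h]
  exact (R.measurable_explore t ht z).union (obs_le_succ ht _ (measurableSet_mem_greedy ht z))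

end ExtremeRun

/-! ### The law of the choices and of the feedback -/

section Indicator

variable {Ω : Type*} {m mΩ : MeasurableSpace Ω} {P : Measure Ω}

/-- The real-valued indicator function of an event. -/
abbrev ind (s : Set Ω) : Ω → ℝ := s.indicator fun _ => 1

theorem ind_nonneg (s : Set Ω) (ω : Ω) : 0 ≤ ind s ω := Set.indicator_nonneg (by simp) _

theorem ind_le_one (s : Set Ω) (ω : Ω) : ind s ω ≤ 1 :=
  Set.indicator_apply_le' (fun _ => le_rfl) fun _ => zero_le_one

theorem measurable_ind {s : Set Ω} (hs : MeasurableSet[m] s) : Measurable[m] (ind s) :=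
  measurable_const.indicator hs

theorem integrable_of_abs_le [IsFiniteMeasure P] {f : Ω → ℝ} (hf : Measurable f) {C : ℝ}
    (hC : ∀ᵐ ω ∂P, |f ω| ≤ C) : Integrable f P :=
  Integrable.of_bound hf.aestronglyMeasurable C hC

theorem abs_mul_ind_le {x C : ℝ} (hx : |x| ≤ C) (s : Set Ω) (ω : Ω) : |x * ind s ω| ≤ C := by
  rw [abs_mul, abs_of_nonneg (ind_nonneg s ω)]
  exact (mul_le_of_le_one_right (abs_nonneg x) (ind_le_one s ω)).trans hx

theorem integrable_mul_ind [IsFiniteMeasure P] (hm : m ≤ mΩ) {ξ : Ω → ℝ} (hξ : Measurable[m] ξ)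
    {C : ℝ} (hC : ∀ᵐ ω ∂P, |ξ ω| ≤ C) {s : Set Ω} (hs : MeasurableSet s) :
    Integrable (fun ω => ξ ω * ind s ω) P :=
  integrable_of_abs_le ((hξ.mono hm le_rfl).mul (measurable_ind hs))
    (hC.mono fun ω h => abs_mul_ind_le h s ω)

theorem integral_mul_ind_eq [IsFiniteMeasure P] (hm : m ≤ mΩ) {ξ : Ω → ℝ} (hξ : Measurable[m] ξ)
    {C : ℝ} (hC : ∀ᵐ ω ∂P, |ξ ω| ≤ C) {s : Set Ω} (hs : MeasurableSet s) :
    ∫ ω, ξ ω * ind s ω ∂P = ∫ ω, ξ ω * (P⟦s | m⟧) ω ∂P :=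
  (integral_mul_condExp hm hξ hC ((integrable_const (1 : ℝ)).indicator hs)).symm

theorem condProb_mem_Icc [IsFiniteMeasure P] (hm : m ≤ mΩ) {s : Set Ω} (hs : MeasurableSet s) :
    ∀ᵐ ω ∂P, (P⟦s | m⟧) ω ∈ Set.Icc (0 : ℝ) 1 := by
  have h1 : 0 ≤ᵐ[P] P⟦s | m⟧ := condExp_nonneg (ae_of_all _ (ind_nonneg s))
  have h2 : P⟦s | m⟧ ≤ᵐ[P] P[fun _ => (1 : ℝ) | m] :=
    condExp_mono ((integrable_const (1 : ℝ)).indicator hs) (integrable_const _)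
      (ae_of_all _ (ind_le_one s))
  rw [condExp_const hm] at h2
  filter_upwards [h1, h2] with ω a b using ⟨a, b⟩

end Indicator

namespace ExtremeRun

variable {A p m H b Z : ℕ} {X : Type*} [MeasurableSpace X] {𝒯 : ArmTree A p m H}
  {g : ℕ → ℕ → X → ℝ} {Ω : Type*} [mΩ : MeasurableSpace Ω] {P : Measure Ω}
  [IsProbabilityMeasure P]
  {ord : ArmOrder 𝒯 g b Z} {𝒟 : Measure (X × (Fin A → ℝ))} {F : Finset (X → Fin A → ℝ)}
  {k T : ℕ} {γ : ℕ → ℝ} {R : ExtremeRun P ord 𝒟 F k T γ} {t : ℕ}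

theorem mul_integral_B_le {c : ℝ} (hR : R.Feedback c) (ht : t < T) {ξ : Ω → ℝ}
    (hξ : Measurable[R.obs t] ξ) (h0 : ∀ ω, 0 ≤ ξ ω) {C : ℝ} (hC : ∀ᵐ ω ∂P, |ξ ω| ≤ C)
    (a : Fin A) :
    c * ∫ ω, ξ ω * ind {ω | a ∈ R.B t ω} ω ∂P ≤ ∫ ω, ξ ω * ind {ω | a ∈ R.Φ t ω} ω ∂P := by
  have hBm : MeasurableSpace.comap (R.B t) ⊤ ≤ mΩ :=
    (measurable_B_top ht).comap_le.trans (R.ℋ.le _)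
  have hm : R.obs t ⊔ MeasurableSpace.comap (R.B t) ⊤ ≤ mΩ := sup_le (obs_le ht) hBm
  have hBa : MeasurableSet[R.obs t ⊔ MeasurableSpace.comap (R.B t) ⊤] {ω | a ∈ R.B t ω} :=
    (le_sup_right : MeasurableSpace.comap (R.B t) ⊤ ≤ _) _ ⟨{s | a ∈ s}, trivial, rfl⟩
  have hΦ : MeasurableSet {ω | a ∈ R.Φ t ω} := R.ℋ.le _ _ (measurableSet_mem_Φ ht a)
  have hξB : Measurable[R.obs t ⊔ MeasurableSpace.comap (R.B t) ⊤]
      fun ω => ξ ω * ind {ω | a ∈ R.B t ω} ω :=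
    (hξ.mono le_sup_left le_rfl).mul (measurable_ind hBa)
  have hξBC : ∀ᵐ ω ∂P, |ξ ω * ind {ω | a ∈ R.B t ω} ω| ≤ C :=
    hC.mono fun ω h => abs_mul_ind_le h _ ω
  have h1 : ∀ ω, ξ ω * ind {ω | a ∈ R.Φ t ω} ω
      = ξ ω * ind {ω | a ∈ R.B t ω} ω * ind {ω | a ∈ R.Φ t ω} ω := by
    intro ω
    by_cases h : a ∈ R.Φ t ω
    · have hB : a ∈ R.B t ω := R.Φ_subset t ht ω h
      simp [h, hB]
    · simp [h]
  rw [integral_congr_ae (ae_of_all _ h1), integral_mul_ind_eq hm hξB hξBC hΦ, ← integral_const_mul]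
  have hp := condProb_mem_Icc (P := P) hm hΦ
  refine integral_mono_ae ((integrable_mul_ind (obs_le ht) hξ hC (hm _ hBa)).const_mul c) ?_ ?_
  · refine integrable_of_abs_le (C := C) ((hξB.mono hm le_rfl).mul
      ((stronglyMeasurable_condExp.mono hm).measurable)) ?_
    filter_upwards [hξBC, hp] with ω h h'
    rw [abs_mul, abs_of_nonneg h'.1]
    exact (mul_le_of_le_one_right (abs_nonneg _) h'.2).trans h
  · filter_upwards [hR t ht a] with ω h
    by_cases hB : a ∈ R.B t ω
    · have := mul_le_mul_of_nonneg_left (h hB) (h0 ω)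
      simpa [hB, mul_comm c] using this
    · simp [hB]

/-- The exploration slot is filled by an effective arm outside the greedy ones. -/
theorem ae_explore_notMem (ht : t < T) : ∀ᵐ ω ∂P, R.explore t ω ∉ R.greedy t ω := by
  have h : ∀ z, ∀ᵐ ω ∂P, ¬ (z ∈ R.greedy t ω ∧ R.explore t ω = z) := by
    intro z
    have hg := measurableSet_mem_greedy (R := R) ht z
    have he : MeasurableSet {ω | R.explore t ω = z} := R.ℋ.le _ _ (R.measurable_explore t ht z)
    have h1 : ∫ ω, ind {ω | z ∈ R.greedy t ω} ω * ind {ω | R.explore t ω = z} ω ∂P = 0 := by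
      rw [integral_mul_ind_eq (obs_le ht) (measurable_ind hg) (C := 1)
        (ae_of_all _ fun ω => by rw [abs_of_nonneg (ind_nonneg _ ω)]; exact ind_le_one _ ω) he]
      refine integral_eq_zero_of_ae ?_
      filter_upwards [R.explore_law _ t ht (epochEnd_log_le t) (lt_epochEnd_log t) z] with ω hω
      rw [hω]
      by_cases hz : z ∈ R.greedy t ω
      · simp [igw_eq_zero _ hz]
      · simp [hz]
    rw [integral_eq_zero_iff_of_nonneg (fun ω => mul_nonneg (ind_nonneg _ ω) (ind_nonneg _ ω))
      (integrable_mul_ind (obs_le ht) (measurable_ind hg) (C := 1)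
        (ae_of_all _ fun ω => by rw [abs_of_nonneg (ind_nonneg _ ω)]; exact ind_le_one _ ω) he)] at h1
    filter_upwards [h1] with ω hω hz
    simp [hz.1, hz.2] at hω
  filter_upwards [ae_all_iff.2 h] with ω hω hmem
  exact hω _ ⟨hmem, rfl⟩

/-- Each effective arm is selected with probability at least its coverage. -/
theorem integral_coverage_le (hF : IsRegularClass 𝒯 g b F) (hk : 1 ≤ k) (hkZ : k ≤ Z)
    (hγ : ∀ l, 0 ≤ γ (l + 1)) (ht : t < T) {ξ : Ω → ℝ} (hξ : Measurable[R.obs t] ξ)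
    (h0 : ∀ ω, 0 ≤ ξ ω) {C : ℝ} (hC : ∀ᵐ ω ∂P, |ξ ω| ≤ C) (z : Fin Z) :
    ∫ ω, ξ ω * coverage k ((Z : ℝ) - k + 1) (γ (Nat.log 2 t + 1)) (R.score t ω (R.x t ω)) z ∂P
      ≤ ∫ ω, ξ ω * ind {ω | z ∈ R.chosen t ω} ω ∂P := by
  have hK : (1 : ℝ) ≤ (Z : ℝ) - k + 1 := by
    have : (k : ℝ) ≤ Z := by exact_mod_cast hkZ
    linarith
  have hg := measurableSet_mem_greedy (R := R) ht z
  have he : MeasurableSet {ω | R.explore t ω = z} := R.ℋ.le _ _ (R.measurable_explore t ht z)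
  have hc : MeasurableSet {ω | z ∈ R.chosen t ω} := R.ℋ.le _ _ (measurableSet_mem_chosen ht z)
  have hm := obs_le (R := R) ht
  set ξ' : Ω → ℝ := fun ω => ξ ω * ind {ω | z ∈ R.greedy t ω}ᶜ ω with hξ'
  have hξ'm : Measurable[R.obs t] ξ' := hξ.mul (measurable_ind hg.compl)
  have hξ'C : ∀ᵐ ω ∂P, |ξ' ω| ≤ C := hC.mono fun ω h => abs_mul_ind_le h _ ω
  have hsplit : ∀ ω, ξ ω * ind {ω | z ∈ R.chosen t ω} ω
      = ξ ω * ind {ω | z ∈ R.greedy t ω} ω + ξ' ω * ind {ω | R.explore t ω = z} ω := by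
    intro ω
    by_cases h1 : z ∈ R.greedy t ω
    · simp [hξ', chosen, h1]
    · by_cases h2 : R.explore t ω = z
      · simp [hξ', chosen, h1, h2]
      · have h3 : ¬ z = R.explore t ω := fun h => h2 h.symm
        simp [hξ', chosen, h1, h2, h3]
  have hi1 := integrable_mul_ind (P := P) hm hξ hC (hm _ hg)
  have hp := condProb_mem_Icc (P := P) hm he
  have hi2 : Integrable (fun ω => ξ' ω * (P⟦{ω | R.explore t ω = z} | R.obs t⟧) ω) P := by
    refine integrable_of_abs_le (C := C) ((hξ'm.mono hm le_rfl).mul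
      ((stronglyMeasurable_condExp.mono hm).measurable)) ?_
    filter_upwards [hξ'C, hp] with ω h h'
    rw [abs_mul, abs_of_nonneg h'.1]
    exact (mul_le_of_le_one_right (abs_nonneg _) h'.2).trans h
  rw [integral_congr_ae (ae_of_all _ hsplit), integral_add hi1
    (integrable_mul_ind hm hξ'm hξ'C he), integral_mul_ind_eq hm hξ'm hξ'C he, ← integral_add hi1 hi2]
  have hcm : Measurable fun ω =>
      coverage k ((Z : ℝ) - k + 1) (γ (Nat.log 2 t + 1)) (R.score t ω (R.x t ω)) z :=
    measurable_coverage (V := fun ω => R.score t ω (R.x t ω)) k _ _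
      (fun z => (measurable_score_apply hF ht z).mono hm le_rfl) z
  refine integral_mono_ae ?_ (hi1.add hi2) ?_
  · refine integrable_of_abs_le (C := C) ((hξ.mono hm le_rfl).mul hcm) ?_
    filter_upwards [hC] with ω h
    rw [abs_mul, abs_of_pos (coverage_pos hK (hγ _) _ z)]
    exact (mul_le_of_le_one_right (abs_nonneg _) (coverage_le_one hK (hγ _) _ z)).trans h
  · filter_upwards [R.explore_law _ t ht (epochEnd_log_le t) (lt_epochEnd_log t) z] with ω hω
    by_cases h1 : z ∈ R.greedy t ω
    · have := mul_le_mul_of_nonneg_left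
        (coverage_le_one (k := k) hK (hγ (Nat.log 2 t)) (R.score t ω (R.x t ω)) z) (h0 ω)
      simpa [hξ', h1] using this
    · have h2 := (isTopSplit (R := R) ht ω).coverage_le_igw hk (hγ (Nat.log 2 t)) h1
      rw [(isTopSplit (R := R) ht ω).card_compl hk hkZ] at h2
      have h3 : ξ' ω = ξ ω := by simp [hξ', h1]
      have h4 : ind {ω | z ∈ R.greedy t ω} ω = 0 := by simp [h1]
      simp only [h3, h4, mul_zero, zero_add]
      exact mul_le_mul_of_nonneg_left (h2.trans hω.ge) (h0 ω)

end ExtremeRun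

/-! ### Unbiasedness of the feedback -/

namespace ExtremeRun

variable {A p m H b Z : ℕ} {X : Type*} [MeasurableSpace X] {𝒯 : ArmTree A p m H}
  {g : ℕ → ℕ → X → ℝ} {Ω : Type*} [mΩ : MeasurableSpace Ω] {P : Measure Ω}
  {ord : ArmOrder 𝒯 g b Z} {𝒟 : Measure (X × (Fin A → ℝ))}
  {F : Finset (X → Fin A → ℝ)}
  {k T : ℕ} {γ : ℕ → ℝ} {R : ExtremeRun P ord 𝒟 F k T γ} {t : ℕ}

variable (R) in
/-- The excess squared error of `f` over `f'` on the rewards revealed in round `t`. -/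
def excess (f f' : X → Fin A → ℝ) (t : ℕ) (ω : Ω) : ℝ :=
  ∑ a ∈ R.Φ t ω, ((f (R.x t ω) a - R.r t ω a) ^ 2 - (f' (R.x t ω) a - R.r t ω a) ^ 2)

variable (R) in
/-- The squared distance of `f` and `f'` on the arms whose rewards are revealed in round `t`. -/
def sqDist (f f' : X → Fin A → ℝ) (t : ℕ) (ω : Ω) : ℝ :=
  ∑ a ∈ R.Φ t ω, (f (R.x t ω) a - f' (R.x t ω) a) ^ 2

variable (R) in
/-- The mean, over a fresh context, of the squared distance of the reduced `f` and `f'`, weighted by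
the coverage of the scores used in round `t`. It is a random variable through these scores. -/
def meanError (f f' : X → Fin A → ℝ) (t : ℕ) (ω : Ω) : ℝ :=
  ∫ x, coveredError k ((Z : ℝ) - k + 1) (γ (Nat.log 2 t + 1)) (R.score t ω x)
    (reduced ord.rep f' x) (reduced ord.rep f x) ∂(𝒟.map Prod.fst)

theorem sum_Φ_eq (φ : Fin A → ℝ) (ω : Ω) :
    ∑ a ∈ R.Φ t ω, φ a = ∑ a, φ a * ind {ω | a ∈ R.Φ t ω} ω := by
  classical
  simp [Set.indicator_apply, Finset.sum_ite_mem]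

theorem sum_B_eq_ind (φ : Fin A → ℝ) (ω : Ω) :
    ∑ a ∈ R.B t ω, φ a = ∑ a, φ a * ind {ω | a ∈ R.B t ω} ω := by
  classical
  simp [Set.indicator_apply, Finset.sum_ite_mem]

theorem sum_chosen_eq_ind (φ : Fin Z → ℝ) (ω : Ω) :
    ∑ z ∈ R.chosen t ω, φ z = ∑ z, φ z * ind {ω | z ∈ R.chosen t ω} ω := by
  classical
  simp [Set.indicator_apply, Finset.sum_ite_mem]

theorem measurable_pair (ht : t < T) : Measurable fun ω => (R.x t ω, R.r t ω) :=
  ((R.measurable_x t ht).mono (R.ℋ.le _) le_rfl).prodMk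
    ((R.measurable_r t ht).mono (R.ℋ.le _) le_rfl)

theorem measurable_x_ambient (ht : t < T) : Measurable (R.x t) :=
  (R.measurable_x t ht).mono (R.ℋ.le _) le_rfl

theorem map_x (ht : t < T) : P.map (R.x t) = 𝒟.map Prod.fst := by
  have h := Measure.map_map (μ := P) measurable_fst (measurable_pair (R := R) ht)
  rw [R.law t ht] at h
  exact h.symm

theorem indep_x (ht : t < T) :
    Indep (MeasurableSpace.comap (R.x t) inferInstance) (R.ℋ t) P := by
  refine indep_of_indep_of_le_left (R.indep t ht) ?_
  exact (measurable_fst.comp (comap_measurable fun ω => (R.x t ω, R.r t ω))).comap_le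

theorem measurable_meanError (f f' : X → Fin A → ℝ) (ht : t < T) :
    Measurable[R.ℋ t] (R.meanError f f' t) :=
  measurable_of_finite_range (score_mem ht) (measurableSet_score ht)
    (φ := fun w _ => ∫ x, coveredError k ((Z : ℝ) - k + 1) (γ (Nat.log 2 t + 1)) (w x)
      (reduced ord.rep f' x) (reduced ord.rep f x) ∂(𝒟.map Prod.fst)) fun _ _ => measurable_const

theorem ae_of_law (ht : t < T) {q : X × (Fin A → ℝ) → Prop} (h : ∀ᵐ w ∂𝒟, q w) :
    ∀ᵐ ω ∂P, q (R.x t ω, R.r t ω) :=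
  ae_of_ae_map (measurable_pair (R := R) ht).aemeasurable (by rwa [R.law t ht])

variable [IsProbabilityMeasure P] [IsProbabilityMeasure 𝒟]

/-- The conditional mean of a reward given the past and the context is that given the context. -/
theorem abs_condExp_reward_sub_le (h𝒟 : ∀ᵐ w ∂𝒟, ∀ a, w.2 a ∈ Set.Icc (0 : ℝ) 1) {ε : ℝ}
    {fstar : X → Fin A → ℝ} (hε : EpsRealizable 𝒟 ε fstar) (ht : t < T) (a : Fin A) :
    ∀ᵐ ω ∂P, |(P[fun ω => R.r t ω a | R.obs t]) ω - fstar (R.x t ω) a| ≤ ε := by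
  have hφ : Integrable (fun w : X × (Fin A → ℝ) => w.2 a) 𝒟 := by
    refine integrable_of_abs_le (C := 1) ((measurable_pi_apply a).comp measurable_snd) ?_
    filter_upwards [h𝒟] with w hw
    rw [abs_of_nonneg (hw a).1]
    exact (hw a).2
  have h := condExp_sup_comap_of_indep (measurable_pair (R := R) ht) (R.law t ht) (R.ℋ.le t)
    (mF := MeasurableSpace.comap Prod.fst inferInstance) measurable_fst.comap_le (R.indep t ht) hφ
  rw [MeasurableSpace.comap_comp] at h
  filter_upwards [h, ae_of_law (R := R) ht (hε a)] with ω h1 h2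
  have h3 : (P[fun ω => R.r t ω a | R.obs t]) ω
      = (𝒟[(fun w : X × (Fin A → ℝ) => w.2 a) | MeasurableSpace.comap Prod.fst inferInstance])
        (R.x t ω, R.r t ω) := h1
  rw [h3]
  exact h2

/-- Feedback is unbiased up to the misspecification error: whether a reward is revealed does not
depend on the rewards of the round, given the past and the context. -/
theorem neg_mul_integral_le (h𝒟 : ∀ᵐ w ∂𝒟, ∀ a, w.2 a ∈ Set.Icc (0 : ℝ) 1) {ε : ℝ}
    {fstar : X → Fin A → ℝ} (hfm : ∀ a, Measurable fun x => fstar x a)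
    (hf1 : ∀ x a, fstar x a ∈ Set.Icc (0 : ℝ) 1) (hε : EpsRealizable 𝒟 ε fstar) (ht : t < T)
    {ξ : Ω → ℝ} (hξ : Measurable[R.obs t] ξ) {C : ℝ} (hC : ∀ᵐ ω ∂P, |ξ ω| ≤ C) (a : Fin A) :
    -(ε * ∫ ω, |ξ ω| * ind {ω | a ∈ R.Φ t ω} ω ∂P)
      ≤ ∫ ω, ξ ω * (fstar (R.x t ω) a - R.r t ω a) * ind {ω | a ∈ R.Φ t ω} ω ∂P := by
  have hm := obs_le (R := R) ht
  have hrm : Measurable (R.r t) := (R.measurable_r t ht).mono (R.ℋ.le _) le_rfl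
  have hra : Measurable fun ω => R.r t ω a := (measurable_pi_apply a).comp hrm
  have hmr : R.obs t ⊔ MeasurableSpace.comap (R.r t) inferInstance ≤ mΩ := sup_le hm hrm.comap_le
  have hr1 : ∀ᵐ ω ∂P, ∀ a, R.r t ω a ∈ Set.Icc (0 : ℝ) 1 := ae_of_law (R := R) ht h𝒟
  have hri : Integrable (fun ω => R.r t ω a) P := by
    refine integrable_of_abs_le (C := 1) hra ?_
    filter_upwards [hr1] with ω h
    rw [abs_of_nonneg (h a).1]
    exact (h a).2
  have hfo : Measurable[R.obs t] fun ω => fstar (R.x t ω) a := (hfm a).comp measurable_x_obs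
  set η : Ω → ℝ := fun ω => ξ ω * (fstar (R.x t ω) a - R.r t ω a) with hη
  have hηm : Measurable[R.obs t ⊔ MeasurableSpace.comap (R.r t) inferInstance] η := by
    refine (hξ.mono le_sup_left le_rfl).mul ((hfo.mono le_sup_left le_rfl).sub ?_)
    exact (measurable_pi_apply a).comp ((comap_measurable (R.r t)).mono le_sup_right le_rfl)
  have hηC : ∀ᵐ ω ∂P, |η ω| ≤ C := by
    filter_upwards [hC, hr1] with ω h h'
    rw [hη, abs_mul]
    refine (mul_le_of_le_one_right (abs_nonneg _) (abs_le.2 ⟨?_, ?_⟩)).trans h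
    · linarith [(hf1 (R.x t ω) a).1, (h' a).2]
    · linarith [(hf1 (R.x t ω) a).2, (h' a).1]
  have habsm : Measurable[R.obs t] fun ω => |ξ ω| := by
    have := hξ.max hξ.neg
    exact this
  have habsC : ∀ᵐ ω ∂P, |(|ξ ω|)| ≤ C := hC.mono fun ω h => by rwa [abs_abs]
  -- the joint values of the choices of the learner and of the feedback set
  set ev : Fin Z × Finset (Fin A) × Finset (Fin A) → Set Ω := fun i =>
    {ω | R.explore t ω = i.1 ∧ R.B t ω = i.2.1 ∧ R.Φ t ω = i.2.2} with hev
  have hevm : ∀ i, MeasurableSet (ev i) := fun i => R.ℋ.le _ _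
    ((R.measurable_explore t ht i.1).inter
      ((R.measurable_B t ht i.2.1).inter (R.measurable_Φ t ht i.2.2)))
  have hev1 : ∀ i, -(ε * ∫ ω, |ξ ω| * ind (ev i) ω ∂P) ≤ ∫ ω, η ω * ind (ev i) ω ∂P := by
    intro i
    set q := P⟦ev i | R.obs t⟧ with hq
    have hqm : Measurable[R.obs t] q := stronglyMeasurable_condExp.measurable
    have hq1 := condProb_mem_Icc (P := P) hm (hevm i)
    have hξqm : Measurable[R.obs t] fun ω => ξ ω * q ω := hξ.mul hqm
    have hξqC : ∀ᵐ ω ∂P, |ξ ω * q ω| ≤ C := by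
      filter_upwards [hC, hq1] with ω h h'
      rw [abs_mul, abs_of_nonneg h'.1]
      exact (mul_le_of_le_one_right (abs_nonneg _) h'.2).trans h
    have e1 : ∫ ω, η ω * ind (ev i) ω ∂P = ∫ ω, η ω * q ω ∂P := by
      rw [integral_mul_ind_eq hmr hηm hηC (hevm i)]
      refine integral_congr_ae ?_
      filter_upwards [R.choice_indep t ht i.1 i.2.1 i.2.2] with ω h
      exact congrArg (η ω * ·) h
    have hi1 : Integrable (fun ω => ξ ω * q ω * fstar (R.x t ω) a) P := by
      refine integrable_of_abs_le (C := C) ((hξqm.mul hfo).mono hm le_rfl) ?_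
      filter_upwards [hξqC] with ω h
      rw [abs_mul, abs_of_nonneg (hf1 _ a).1]
      exact (mul_le_of_le_one_right (abs_nonneg _) (hf1 _ a).2).trans h
    have hi2 : Integrable (fun ω => ξ ω * q ω * R.r t ω a) P := by
      refine integrable_of_abs_le (C := C) ((hξqm.mono hm le_rfl).mul hra) ?_
      filter_upwards [hξqC, hr1] with ω h h'
      rw [abs_mul, abs_of_nonneg (h' a).1]
      exact (mul_le_of_le_one_right (abs_nonneg _) (h' a).2).trans h
    have hbound : ∀ᵐ ω ∂P, |(P[fun ω => R.r t ω a | R.obs t]) ω - fstar (R.x t ω) a| ≤ ε :=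
      abs_condExp_reward_sub_le h𝒟 hε ht a
    have hi3 : Integrable (fun ω => ξ ω * q ω * (P[fun ω => R.r t ω a | R.obs t]) ω) P := by
      refine (integrable_condExp (m := R.obs t) (f := fun ω => R.r t ω a)).bdd_mul
        (hξqm.mono hm le_rfl).aestronglyMeasurable (c := C) hξqC
    have hi4 : Integrable (fun ω => |ξ ω| * q ω) P := by
      refine integrable_of_abs_le (C := C) ((habsm.mul hqm).mono hm le_rfl) ?_
      filter_upwards [hξqC] with ω h
      rwa [abs_mul, abs_abs, ← abs_mul]
    have e2 : ∫ ω, η ω * q ω ∂P = ∫ ω, (ξ ω * q ω * fstar (R.x t ω) a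
        - ξ ω * q ω * (P[fun ω => R.r t ω a | R.obs t]) ω) ∂P := by
      rw [integral_sub hi1 hi3, integral_mul_condExp hm hξqm hξqC hri, ← integral_sub hi1 hi2]
      refine integral_congr_ae (ae_of_all _ fun ω => ?_)
      simp only [hη]
      ring
    rw [e1, e2, integral_mul_ind_eq hm habsm habsC (hevm i), ← integral_const_mul, ← integral_neg]
    refine integral_mono_ae (hi4.const_mul ε).neg (hi1.sub hi3) ?_
    filter_upwards [hq1, hbound] with ω h1 h2
    have h3 : |ξ ω * q ω * fstar (R.x t ω) a
        - ξ ω * q ω * (P[fun ω => R.r t ω a | R.obs t]) ω| ≤ |ξ ω| * q ω * ε := by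
      rw [← mul_sub, abs_mul, abs_mul, abs_of_nonneg h1.1, abs_sub_comm]
      exact mul_le_mul_of_nonneg_left h2 (mul_nonneg (abs_nonneg _) h1.1)
    have h4 := (abs_le.1 h3).1
    linarith
  have hsum : ∀ ω, ind {ω | a ∈ R.Φ t ω} ω
      = ∑ i ∈ Finset.univ.filter fun i : Fin Z × Finset (Fin A) × Finset (Fin A) => a ∈ i.2.2,
        ind (ev i) ω := by
    intro ω
    by_cases h : a ∈ R.Φ t ω
    · rw [Finset.sum_eq_single_of_mem (R.explore t ω, R.B t ω, R.Φ t ω) (by simpa using h)]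
      · simp [hev, h]
      · rintro ⟨z, s, φ⟩ - hne
        refine Set.indicator_of_notMem ?_ _
        rintro ⟨rfl, rfl, rfl⟩
        exact hne rfl
    · rw [Finset.sum_eq_zero]
      · simp [h]
      · rintro ⟨z, s, φ⟩ hi
        refine Set.indicator_of_notMem ?_ _
        rintro ⟨rfl, rfl, rfl⟩
        exact h (by simpa using hi)
  have hηi : ∀ i, Integrable (fun ω => η ω * ind (ev i) ω) P := fun i =>
    integrable_mul_ind hmr hηm hηC (hevm i)
  have hξi : ∀ i, Integrable (fun ω => |ξ ω| * ind (ev i) ω) P := fun i =>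
    integrable_mul_ind hm habsm habsC (hevm i)
  simp only [hsum, Finset.mul_sum]
  rw [integral_finsetSum _ fun i _ => hηi i, integral_finsetSum _ fun i _ => hξi i, Finset.mul_sum,
    ← Finset.sum_neg_distrib]
  exact Finset.sum_le_sum fun i _ => hev1 i

end ExtremeRun

/-! ### Concentration of the regression error -/

namespace ExtremeRun

variable {A p m H b Z : ℕ} {X : Type*} [MeasurableSpace X] {𝒯 : ArmTree A p m H}
  {g : ℕ → ℕ → X → ℝ} {Ω : Type*} [mΩ : MeasurableSpace Ω] {P : Measure Ω}
  {ord : ArmOrder 𝒯 g b Z} {𝒟 : Measure (X × (Fin A → ℝ))}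
  {F : Finset (X → Fin A → ℝ)}
  {k T : ℕ} {γ : ℕ → ℝ} {R : ExtremeRun P ord 𝒟 F k T γ} {t : ℕ} {f f' : X → Fin A → ℝ}

theorem measurable_excess (hf : ∀ a, Measurable fun x => f x a)
    (hf' : ∀ a, Measurable fun x => f' x a) (ht : t < T) :
    Measurable[R.ℋ (t + 1)] (R.excess f f' t) := by
  have hx := R.measurable_x t ht
  have hr : ∀ a, Measurable[R.ℋ (t + 1)] fun ω => R.r t ω a := fun a =>
    (measurable_pi_apply a).comp (R.measurable_r t ht)
  have h : R.excess f f' t = fun ω => ∑ a, ((f (R.x t ω) a - R.r t ω a) ^ 2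
      - (f' (R.x t ω) a - R.r t ω a) ^ 2) * ind {ω | a ∈ R.Φ t ω} ω :=
    funext fun ω => sum_Φ_eq _ ω
  rw [h]
  refine Finset.measurable_sum _ fun a _ => ?_
  exact (((((hf a).comp hx).sub (hr a)).pow_const 2).sub
    ((((hf' a).comp hx).sub (hr a)).pow_const 2)).mul (measurable_ind (measurableSet_mem_Φ ht a))

theorem measurable_sqDist (hf : ∀ a, Measurable fun x => f x a)
    (hf' : ∀ a, Measurable fun x => f' x a) (ht : t < T) :
    Measurable[R.ℋ (t + 1)] (R.sqDist f f' t) := by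
  have hx := R.measurable_x t ht
  have h : R.sqDist f f' t = fun ω => ∑ a, (f (R.x t ω) a - f' (R.x t ω) a) ^ 2
      * ind {ω | a ∈ R.Φ t ω} ω := funext fun ω => sum_Φ_eq _ ω
  rw [h]
  refine Finset.measurable_sum _ fun a _ => ?_
  exact ((((hf a).comp hx).sub ((hf' a).comp hx)).pow_const 2).mul
    (measurable_ind (measurableSet_mem_Φ ht a))

theorem sqDist_nonneg (ω : Ω) : 0 ≤ R.sqDist f f' t ω :=
  Finset.sum_nonneg fun _ _ => sq_nonneg _

theorem sqDist_le (hk : 1 ≤ k) (hf1 : ∀ x a, f x a ∈ Set.Icc (0 : ℝ) 1)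
    (hf1' : ∀ x a, f' x a ∈ Set.Icc (0 : ℝ) 1) (ht : t < T) (ω : Ω) : R.sqDist f f' t ω ≤ k := by
  refine (Finset.sum_le_card_nsmul _ _ 1 fun a _ => sq_sub_le_one (hf1 _ a) (hf1' _ a)).trans ?_
  rw [nsmul_eq_mul, mul_one]
  exact card_Φ_le hk ht ω

/-- The excess error of a round is at most `k`, and its square is controlled by the squared distance.
The factor `k` is lost since the rewards of the played arms may be dependent. -/
theorem abs_excess_le_and_sq_le (hk : 1 ≤ k) (h𝒟 : ∀ᵐ w ∂𝒟, ∀ a, w.2 a ∈ Set.Icc (0 : ℝ) 1)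
    (hf1 : ∀ x a, f x a ∈ Set.Icc (0 : ℝ) 1) (hf1' : ∀ x a, f' x a ∈ Set.Icc (0 : ℝ) 1)
    (ht : t < T) : ∀ᵐ ω ∂P, |R.excess f f' t ω| ≤ k ∧
      R.excess f f' t ω ^ 2 ≤ 4 * k * R.sqDist f f' t ω := by
  filter_upwards [ae_of_law (R := R) ht h𝒟] with ω hr
  have hcard := card_Φ_le (R := R) hk ht ω
  constructor
  · refine (Finset.abs_sum_le_sum_abs _ _).trans ?_
    refine (Finset.sum_le_card_nsmul _ _ 1 fun a _ => ?_).trans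
      (by rwa [nsmul_eq_mul, mul_one])
    have h1 := sq_sub_le_one (hf1 (R.x t ω) a) (hr a)
    have h2 := sq_sub_le_one (hf1' (R.x t ω) a) (hr a)
    have h3 := sq_nonneg (f (R.x t ω) a - R.r t ω a)
    have h4 := sq_nonneg (f' (R.x t ω) a - R.r t ω a)
    rw [abs_le]
    constructor <;> linarith
  · refine sq_sum_le_card_mul_sum_sq.trans ?_
    have h1 : ∑ a ∈ R.Φ t ω,
        ((f (R.x t ω) a - R.r t ω a) ^ 2 - (f' (R.x t ω) a - R.r t ω a) ^ 2) ^ 2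
          ≤ 4 * R.sqDist f f' t ω := by
      rw [sqDist, Finset.mul_sum]
      refine Finset.sum_le_sum fun a _ => ?_
      have h2 : ((f (R.x t ω) a - R.r t ω a) ^ 2 - (f' (R.x t ω) a - R.r t ω a) ^ 2) ^ 2
          = (f (R.x t ω) a - f' (R.x t ω) a) ^ 2
            * (f (R.x t ω) a + f' (R.x t ω) a - 2 * R.r t ω a) ^ 2 := by ring
      have h3 : (f (R.x t ω) a + f' (R.x t ω) a - 2 * R.r t ω a) ^ 2 ≤ 2 ^ 2 := by
        refine sq_le_sq' ?_ ?_
        · linarith [(hf1 (R.x t ω) a).1, (hf1' (R.x t ω) a).1, (hr a).2]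
        · linarith [(hf1 (R.x t ω) a).2, (hf1' (R.x t ω) a).2, (hr a).1]
      have h4 := mul_le_mul_of_nonneg_left h3 (sq_nonneg (f (R.x t ω) a - f' (R.x t ω) a))
      rw [h2]
      linarith
    calc ((R.Φ t ω).card : ℝ) * _ ≤ k * (4 * R.sqDist f f' t ω) :=
          mul_le_mul hcard h1 (Finset.sum_nonneg fun _ _ => sq_nonneg _) (Nat.cast_nonneg k)
      _ = 4 * k * R.sqDist f f' t ω := by ring

theorem reduced_mem_Icc (hf1 : ∀ x a, f x a ∈ Set.Icc (0 : ℝ) 1) (x : X) (z : Fin Z) :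
    reduced ord.rep f x z ∈ Set.Icc (0 : ℝ) 1 := hf1 x _

theorem one_le_slots (hkZ : k ≤ Z) : (1 : ℝ) ≤ (Z : ℝ) - k + 1 := by
  have : (k : ℝ) ≤ Z := by exact_mod_cast hkZ
  linarith

theorem meanError_nonneg (hkZ : k ≤ Z) (hγ : ∀ l, 0 ≤ γ (l + 1)) (ω : Ω) :
    0 ≤ R.meanError f f' t ω :=
  integral_nonneg fun _ => coveredError_nonneg (one_le_slots hkZ) (hγ _) _ _ _

theorem meanError_le [IsProbabilityMeasure 𝒟] (hkZ : k ≤ Z) (hγ : ∀ l, 0 ≤ γ (l + 1))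
    (hf1 : ∀ x a, f x a ∈ Set.Icc (0 : ℝ) 1) (hf1' : ∀ x a, f' x a ∈ Set.Icc (0 : ℝ) 1) (ω : Ω) :
    R.meanError f f' t ω ≤ Z := by
  have : IsProbabilityMeasure (𝒟.map (Prod.fst : X × (Fin A → ℝ) → X)) :=
    Measure.isProbabilityMeasure_map measurable_fst.aemeasurable
  have h : ∀ x, coveredError k ((Z : ℝ) - k + 1) (γ (Nat.log 2 t + 1)) (R.score t ω x)
    (reduced ord.rep f' x) (reduced ord.rep f x) ≤ Z := fun x =>
      (coveredError_le (one_le_slots hkZ) (hγ _) _ (reduced_mem_Icc hf1' x)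
        (reduced_mem_Icc hf1 x)).trans (by rw [Fintype.card_fin])
  have h1 := integral_mono_of_nonneg (μ := 𝒟.map Prod.fst)
    (ae_of_all _ fun x => coveredError_nonneg (one_le_slots hkZ) (hγ _) (R.score t ω x) _ _)
    (integrable_const (Z : ℝ)) (ae_of_all _ h)
  rw [integral_const, probReal_univ, one_smul] at h1
  exact h1

variable [IsProbabilityMeasure P] {G : Ω → ℝ} {C : ℝ}

/-- The context of a round is independent of the scores in use, so it may be replaced by a fresh
one. -/
theorem integral_mul_meanError (hF : IsRegularClass 𝒯 g b F) (hkZ : k ≤ Z)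
    (hγ : ∀ l, 0 ≤ γ (l + 1)) (hf : f ∈ F) (hf' : f' ∈ F) (ht : t < T)
    (hG : Measurable[R.ℋ t] G) (hC : ∀ᵐ ω ∂P, |G ω| ≤ C) :
    ∫ ω, G ω * R.meanError f f' t ω ∂P = ∫ ω, G ω * coveredError k ((Z : ℝ) - k + 1)
      (γ (Nat.log 2 t + 1)) (R.score t ω (R.x t ω)) (reduced ord.rep f' (R.x t ω))
      (reduced ord.rep f (R.x t ω)) ∂P := by
  set φ : (X → Fin Z → ℝ) → X → ℝ := fun w x => coveredError k ((Z : ℝ) - k + 1)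
    (γ (Nat.log 2 t + 1)) (w x) (reduced ord.rep f' x) (reduced ord.rep f x) with hφ
  have hK := one_le_slots (k := k) hkZ
  have hm := R.ℋ.le t
  have hφm : ∀ w ∈ R.scoreClass, Measurable (φ w) := by
    intro w hw
    obtain ⟨f₀, hf₀, rfl⟩ := mem_scoreClass.1 hw
    exact measurable_coveredError k _ _ (ord.measurable_reduced (hF.measurable _ hf₀))
      (ord.measurable_reduced (hF.measurable _ hf')) (ord.measurable_reduced (hF.measurable _ hf))
  have hφ1 : ∀ w x, |φ w x| ≤ Z := by
    intro w x
    rw [abs_of_nonneg (coveredError_nonneg hK (hγ _) _ _ _)]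
    exact (coveredError_le hK (hγ _) _ (reduced_mem_Icc (hF.mem_Icc _ hf') x)
      (reduced_mem_Icc (hF.mem_Icc _ hf) x)).trans (by rw [Fintype.card_fin])
  have hsplit : ∀ (ψ : (X → Fin Z → ℝ) → ℝ) (ω : Ω),
      ψ (R.score t ω) = ∑ w ∈ R.scoreClass, ind {ω | R.score t ω = w} ω * ψ w := by
    intro ψ ω
    rw [Finset.sum_eq_single_of_mem (R.score t ω) (score_mem ht ω)]
    · simp
    · intro w _ hw
      have h : ω ∉ {ω | R.score t ω = w} := fun h => hw (Eq.symm h)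
      simp [h]
  have hi : ∀ w ∈ R.scoreClass, Integrable (fun ω => G ω * ind {ω | R.score t ω = w} ω) P :=
    fun w hw => integrable_mul_ind hm hG hC (hm _ (measurableSet_score ht w hw))
  have hi2 : ∀ w ∈ R.scoreClass,
      Integrable (fun ω => G ω * ind {ω | R.score t ω = w} ω * φ w (R.x t ω)) P := by
    intro w hw
    refine (hi w hw).mul_bdd (c := Z) ((hφm w hw).comp
      (measurable_x_ambient ht)).aestronglyMeasurable (ae_of_all _ fun ω => hφ1 w _)
  have e1 : ∀ ω, G ω * R.meanError f f' t ω = ∑ w ∈ R.scoreClass,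
      G ω * ind {ω | R.score t ω = w} ω * ∫ x, φ w x ∂(𝒟.map Prod.fst) := by
    intro ω
    rw [meanError, hsplit (fun w => ∫ x, φ w x ∂(𝒟.map Prod.fst)) ω, Finset.mul_sum]
    simp only [mul_assoc]
  have e2 : ∀ ω, G ω * φ (R.score t ω) (R.x t ω) = ∑ w ∈ R.scoreClass,
      G ω * ind {ω | R.score t ω = w} ω * φ w (R.x t ω) := by
    intro ω
    rw [hsplit (fun w => φ w (R.x t ω)) ω, Finset.mul_sum]
    simp only [mul_assoc]
  simp only [e1]
  rw [integral_congr_ae (ae_of_all _ e2), integral_finsetSum _ fun w hw => (hi w hw).mul_const _,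
    integral_finsetSum _ hi2]
  refine Finset.sum_congr rfl fun w hw => ?_
  have h := integral_mul_comp_of_indep (measurable_x_ambient ht) hm (indep_x ht)
    (hG.mul (measurable_ind (measurableSet_score ht w hw))) (hφm w hw)
  rw [map_x ht] at h
  rw [integral_mul_const]
  exact h.symm

/-- The revealed data cover the reduced class. -/
theorem mul_integral_meanError_le (hF : IsRegularClass 𝒯 g b F) (hk : 1 ≤ k) (hkZ : k ≤ Z)
    (hγ : ∀ l, 0 ≤ γ (l + 1)) {c : ℝ} (hc : 0 ≤ c) (hR : R.Feedback c) (hf : f ∈ F) (hf' : f' ∈ F)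
    (ht : t < T) (hG : Measurable[R.ℋ t] G) (h0 : ∀ ω, 0 ≤ G ω) (hC : ∀ᵐ ω ∂P, |G ω| ≤ C) :
    c * ∫ ω, G ω * R.meanError f f' t ω ∂P ≤ ∫ ω, G ω * R.sqDist f f' t ω ∂P := by
  have hm := obs_le (R := R) ht
  have hK := one_le_slots (k := k) hkZ
  have hGo : Measurable[R.obs t] G := hG.mono le_obs le_rfl
  have hd : ∀ (q : X → ℝ), Measurable q → (∀ x, 0 ≤ q x) → (∀ x, q x ≤ 1) →
      Measurable[R.obs t] (fun ω => G ω * q (R.x t ω)) ∧ (∀ ω, 0 ≤ G ω * q (R.x t ω)) ∧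
        ∀ᵐ ω ∂P, |G ω * q (R.x t ω)| ≤ C := by
    intro q hq hq0 hq1
    refine ⟨hGo.mul (hq.comp measurable_x_obs), fun ω => mul_nonneg (h0 ω) (hq0 _), ?_⟩
    filter_upwards [hC] with ω h
    rw [abs_mul, abs_of_nonneg (hq0 _)]
    exact (mul_le_of_le_one_right (abs_nonneg _) (hq1 _)).trans h
  have hA : ∀ a, _ := fun a => hd (fun x => (f x a - f' x a) ^ 2)
    (((hF.measurable _ hf a).sub (hF.measurable _ hf' a)).pow_const 2) (fun _ => sq_nonneg _)
    fun x => sq_sub_le_one (hF.mem_Icc _ hf x a) (hF.mem_Icc _ hf' x a)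
  have hZ : ∀ z, _ := fun z => hd
    (fun x => (reduced ord.rep f x z - reduced ord.rep f' x z) ^ 2)
    (((ord.measurable_reduced (hF.measurable _ hf) z).sub
      (ord.measurable_reduced (hF.measurable _ hf') z)).pow_const 2) (fun _ => sq_nonneg _)
    fun x => sq_sub_le_one (reduced_mem_Icc (hF.mem_Icc _ hf) x z)
      (reduced_mem_Icc (hF.mem_Icc _ hf') x z)
  have hBm : ∀ a, MeasurableSet {ω | a ∈ R.B t ω} := fun a => R.ℋ.le _ _ (measurableSet_mem_B ht a)
  have hΦm : ∀ a, MeasurableSet {ω | a ∈ R.Φ t ω} := fun a => R.ℋ.le _ _ (measurableSet_mem_Φ ht a)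
  have hcm : ∀ z, MeasurableSet {ω | z ∈ R.chosen t ω} := fun z =>
    R.ℋ.le _ _ (measurableSet_mem_chosen ht z)
  -- the mean over the fresh context is the mean over the context of the round
  rw [integral_mul_meanError hF hkZ hγ hf hf' ht hG hC]
  have hcov : ∀ ω, G ω * coveredError k ((Z : ℝ) - k + 1)
      (γ (Nat.log 2 t + 1)) (R.score t ω (R.x t ω)) (reduced ord.rep f' (R.x t ω))
      (reduced ord.rep f (R.x t ω))
      = ∑ z, G ω * (reduced ord.rep f (R.x t ω) z - reduced ord.rep f' (R.x t ω) z) ^ 2 *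
        coverage k ((Z : ℝ) - k + 1) (γ (Nat.log 2 t + 1)) (R.score t ω (R.x t ω)) z := by
    intro ω
    rw [coveredError, Finset.mul_sum]
    exact Finset.sum_congr rfl fun z _ => by ring
  have hcovm : ∀ z, Measurable fun ω =>
      coverage k ((Z : ℝ) - k + 1) (γ (Nat.log 2 t + 1)) (R.score t ω (R.x t ω)) z :=
    measurable_coverage (V := fun ω => R.score t ω (R.x t ω)) k _ _
      (fun z => (measurable_score_apply hF ht z).mono hm le_rfl)
  have hicov : ∀ z, Integrable (fun ω => G ω *
      (reduced ord.rep f (R.x t ω) z - reduced ord.rep f' (R.x t ω) z) ^ 2 *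
        coverage k ((Z : ℝ) - k + 1) (γ (Nat.log 2 t + 1)) (R.score t ω (R.x t ω)) z) P := by
    intro z
    refine integrable_of_abs_le (C := C) (((hZ z).1.mono hm le_rfl).mul (hcovm z)) ?_
    filter_upwards [(hZ z).2.2] with ω h
    rw [abs_mul, abs_of_pos (coverage_pos hK (hγ _) _ z)]
    exact (mul_le_of_le_one_right (abs_nonneg _) (coverage_le_one hK (hγ _) _ z)).trans h
  have h1 : ∫ ω, G ω * coveredError k ((Z : ℝ) - k + 1)
      (γ (Nat.log 2 t + 1)) (R.score t ω (R.x t ω)) (reduced ord.rep f' (R.x t ω))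
      (reduced ord.rep f (R.x t ω)) ∂P
      ≤ ∑ z, ∫ ω, G ω * (reduced ord.rep f (R.x t ω) z - reduced ord.rep f' (R.x t ω) z) ^ 2 *
        ind {ω | z ∈ R.chosen t ω} ω ∂P := by
    rw [integral_congr_ae (ae_of_all _ hcov), integral_finsetSum _ fun z _ => hicov z]
    exact Finset.sum_le_sum fun z _ =>
      integral_coverage_le hF hk hkZ hγ ht (hZ z).1 (hZ z).2.1 (hZ z).2.2 z
  have h2 : ∑ z, ∫ ω, G ω * (reduced ord.rep f (R.x t ω) z - reduced ord.rep f' (R.x t ω) z) ^ 2 *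
        ind {ω | z ∈ R.chosen t ω} ω ∂P
      = ∑ a, ∫ ω, G ω * (f (R.x t ω) a - f' (R.x t ω) a) ^ 2 * ind {ω | a ∈ R.B t ω} ω ∂P := by
    rw [← integral_finsetSum _ fun z _ =>
        integrable_mul_ind hm (hZ z).1 (hZ z).2.2 (hcm z),
      ← integral_finsetSum _ fun a _ => integrable_mul_ind hm (hA a).1 (hA a).2.2 (hBm a)]
    refine integral_congr_ae (ae_of_all _ fun ω => ?_)
    have := sum_B_eq (R := R) ht ω (fun a => (f (R.x t ω) a - f' (R.x t ω) a) ^ 2)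
      (fun z => (reduced ord.rep f (R.x t ω) z - reduced ord.rep f' (R.x t ω) z) ^ 2)
      fun z a ha => by
        rw [ord.eq_reduced (hF.const _ hf) ha, ord.eq_reduced (hF.const _ hf') ha]
    rw [sum_B_eq_ind, sum_chosen_eq_ind] at this
    simp only [mul_assoc, ← Finset.mul_sum]
    rw [this]
  have h3 : ∫ ω, G ω * R.sqDist f f' t ω ∂P
      = ∑ a, ∫ ω, G ω * (f (R.x t ω) a - f' (R.x t ω) a) ^ 2 * ind {ω | a ∈ R.Φ t ω} ω ∂P := by
    rw [← integral_finsetSum _ fun a _ => integrable_mul_ind hm (hA a).1 (hA a).2.2 (hΦm a)]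
    refine integral_congr_ae (ae_of_all _ fun ω => ?_)
    simp only [sqDist, sum_Φ_eq, mul_assoc, ← Finset.mul_sum]
  rw [h3]
  refine (mul_le_mul_of_nonneg_left (h1.trans h2.le) hc).trans ?_
  rw [Finset.mul_sum]
  exact Finset.sum_le_sum fun a _ => mul_integral_B_le hR ht (hA a).1 (hA a).2.1 (hA a).2.2 a

variable [IsProbabilityMeasure 𝒟]

/-- The excess error is, up to the misspecification, at least half the squared distance in mean. -/
theorem integral_sqDist_le (hF : IsRegularClass 𝒯 g b F) (hk : 1 ≤ k)
    (h𝒟 : ∀ᵐ w ∂𝒟, ∀ a, w.2 a ∈ Set.Icc (0 : ℝ) 1) {ε : ℝ}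
    (hf : f ∈ F) (hf' : f' ∈ F) (hε : EpsRealizable 𝒟 ε f')
    (ht : t < T) (hG : Measurable[R.ℋ t] G) (h0 : ∀ ω, 0 ≤ G ω) (hC : ∀ᵐ ω ∂P, |G ω| ≤ C) :
    1 / 2 * ∫ ω, G ω * R.sqDist f f' t ω ∂P - 2 * k * ε ^ 2 * ∫ ω, G ω ∂P
      ≤ ∫ ω, G ω * R.excess f f' t ω ∂P := by
  have hm := obs_le (R := R) ht
  have hGo : Measurable[R.obs t] G := hG.mono le_obs le_rfl
  have hGm : Measurable G := hG.mono (R.ℋ.le t) le_rfl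
  have hΦm : ∀ a, MeasurableSet {ω | a ∈ R.Φ t ω} := fun a => R.ℋ.le _ _ (measurableSet_mem_Φ ht a)
  have hr1 : ∀ᵐ ω ∂P, ∀ a, R.r t ω a ∈ Set.Icc (0 : ℝ) 1 := ae_of_law (R := R) ht h𝒟
  have hrm : ∀ a, Measurable fun ω => R.r t ω a := fun a =>
    (measurable_pi_apply a).comp ((R.measurable_r t ht).mono (R.ℋ.le _) le_rfl)
  set d : Fin A → Ω → ℝ := fun a ω => f (R.x t ω) a - f' (R.x t ω) a with hd
  have hdm : ∀ a, Measurable[R.obs t] (d a) := fun a =>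
    ((hF.measurable _ hf a).comp measurable_x_obs).sub
      ((hF.measurable _ hf' a).comp measurable_x_obs)
  have hd1 : ∀ a ω, |d a ω| ≤ 1 := fun a ω => by
    rw [← sq_le_one_iff_abs_le_one]
    exact sq_sub_le_one (hF.mem_Icc _ hf _ a) (hF.mem_Icc _ hf' _ a)
  set ξ : Fin A → Ω → ℝ := fun a ω => G ω * (2 * d a ω) with hξ
  have hξm : ∀ a, Measurable[R.obs t] (ξ a) := fun a => hGo.mul (measurable_const.mul (hdm a))
  have hξC : ∀ a, ∀ᵐ ω ∂P, |ξ a ω| ≤ C * 2 := fun a => by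
    filter_upwards [hC] with ω h
    rw [hξ, abs_mul, abs_mul, abs_two]
    exact mul_le_mul h (by linarith [hd1 a ω]) (by positivity) ((abs_nonneg _).trans h)
  have hGi : Integrable G P := integrable_of_abs_le hGm hC
  have hDi : Integrable (fun ω => G ω * R.sqDist f f' t ω) P :=
    hGi.mul_bdd (c := k) ((measurable_sqDist (hF.measurable _ hf) (hF.measurable _ hf') ht).mono
      (R.ℋ.le _) le_rfl).aestronglyMeasurable (ae_of_all _ fun ω => by
        rw [Real.norm_eq_abs, abs_of_nonneg (sqDist_nonneg ω)]
        exact sqDist_le hk (hF.mem_Icc _ hf) (hF.mem_Icc _ hf') ht ω)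
  have hηi : ∀ a, Integrable (fun ω => ξ a ω * (f' (R.x t ω) a - R.r t ω a)
      * ind {ω | a ∈ R.Φ t ω} ω) P := by
    intro a
    refine integrable_of_abs_le (C := C * 2) ((((hξm a).mono hm le_rfl).mul
      (((hF.measurable _ hf' a).comp (measurable_x_ambient ht)).sub (hrm a))).mul
        (measurable_ind (hΦm a))) ?_
    filter_upwards [hξC a, hr1] with ω h h'
    refine abs_mul_ind_le ?_ _ ω
    rw [abs_mul]
    refine (mul_le_of_le_one_right (abs_nonneg _) ?_).trans h
    rw [← sq_le_one_iff_abs_le_one]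
    exact sq_sub_le_one (hF.mem_Icc _ hf' _ a) (h' a)
  have hξi : ∀ a, Integrable (fun ω => |ξ a ω| * ind {ω | a ∈ R.Φ t ω} ω) P := by
    intro a
    have habsm : Measurable[R.obs t] fun ω => |ξ a ω| := by
      have := (hξm a).max (hξm a).neg
      exact this
    exact integrable_mul_ind hm habsm ((hξC a).mono fun ω h => by rwa [abs_abs]) (hΦm a)
  have e1 : ∀ ω, G ω * R.excess f f' t ω = G ω * R.sqDist f f' t ω
      + ∑ a, ξ a ω * (f' (R.x t ω) a - R.r t ω a) * ind {ω | a ∈ R.Φ t ω} ω := by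
    intro ω
    rw [excess, sqDist, sum_Φ_eq, sum_Φ_eq, Finset.mul_sum, Finset.mul_sum, ← Finset.sum_add_distrib]
    refine Finset.sum_congr rfl fun a _ => ?_
    simp only [hξ, hd]
    ring
  have e2 : ∀ a, -(ε * ∫ ω, |ξ a ω| * ind {ω | a ∈ R.Φ t ω} ω ∂P)
      ≤ ∫ ω, ξ a ω * (f' (R.x t ω) a - R.r t ω a) * ind {ω | a ∈ R.Φ t ω} ω ∂P := fun a =>
    neg_mul_integral_le h𝒟 (hF.measurable _ hf') (hF.mem_Icc _ hf') hε ht (hξm a) (hξC a) a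
  -- `2 |d| ε ≤ d ^ 2 / 2 + 2 ε ^ 2` on each of the at most `k` revealed arms
  have e3 : ε * ∑ a, ∫ ω, |ξ a ω| * ind {ω | a ∈ R.Φ t ω} ω ∂P
      ≤ 1 / 2 * ∫ ω, G ω * R.sqDist f f' t ω ∂P + 2 * k * ε ^ 2 * ∫ ω, G ω ∂P := by
    rw [← integral_finsetSum _ fun a _ => hξi a, ← integral_const_mul, ← integral_const_mul,
      ← integral_const_mul, ← integral_add (hDi.const_mul _) (hGi.const_mul _)]
    refine integral_mono ((integrable_finsetSum _ fun a _ => hξi a).const_mul _)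
      ((hDi.const_mul _).add (hGi.const_mul _)) fun ω => ?_
    simp only
    rw [← sum_Φ_eq (R := R) (t := t) (fun a => |ξ a ω|) ω, sqDist, Finset.mul_sum]
    have h1 : ∀ a ∈ R.Φ t ω, ε * |ξ a ω| ≤ G ω * (1 / 2 * (f (R.x t ω) a - f' (R.x t ω) a) ^ 2
        + 2 * ε ^ 2) := by
      intro a _
      have h2 : |ξ a ω| = G ω * (2 * |d a ω|) := by
        rw [hξ, abs_mul, abs_mul, abs_two, abs_of_nonneg (h0 ω)]
      have h3 : (f (R.x t ω) a - f' (R.x t ω) a) ^ 2 = |d a ω| ^ 2 := by rw [sq_abs]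
      rw [h2, h3]
      have h4 := mul_nonneg (h0 ω) (sq_nonneg (|d a ω| - 2 * ε))
      linarith
    refine (Finset.sum_le_sum h1).trans ?_
    rw [← Finset.mul_sum, Finset.sum_add_distrib, ← Finset.mul_sum, Finset.sum_const, nsmul_eq_mul]
    have h5 := mul_le_mul_of_nonneg_left (mul_le_mul_of_nonneg_right (card_Φ_le (R := R) hk ht ω)
      (mul_nonneg zero_le_two (sq_nonneg ε))) (h0 ω)
    linarith
  rw [integral_congr_ae (ae_of_all _ e1), integral_add hDi (integrable_finsetSum _ fun a _ => hηi a),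
    integral_finsetSum _ fun a _ => hηi a]
  have e4 := Finset.sum_le_sum fun a (_ : a ∈ Finset.univ) => e2 a
  rw [Finset.sum_neg_distrib, ← Finset.mul_sum] at e4
  linarith

end ExtremeRun

namespace ExtremeRun

variable {A p m H b Z : ℕ} {X : Type*} [MeasurableSpace X] {𝒯 : ArmTree A p m H}
  {g : ℕ → ℕ → X → ℝ} {Ω : Type*} [mΩ : MeasurableSpace Ω] {P : Measure Ω}
  {ord : ArmOrder 𝒯 g b Z} {𝒟 : Measure (X × (Fin A → ℝ))}
  {F : Finset (X → Fin A → ℝ)}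
  {k T : ℕ} {γ : ℕ → ℝ} {R : ExtremeRun P ord 𝒟 F k T γ} {t : ℕ} {f f' : X → Fin A → ℝ}

variable (R) in
/-- The increment, in round `t`, of the logarithm of the supermartingale that controls the
regression error. -/
def increment (c ε : ℝ) (f f' : X → Fin A → ℝ) (t : ℕ) (ω : Ω) : ℝ :=
  -(1 / (16 * k) * R.excess f f' t ω) + (c / (64 * k) * R.meanError f f' t ω - ε ^ 2 / 8)

theorem measurable_increment (hF : IsRegularClass 𝒯 g b F) (hf : f ∈ F) (hf' : f' ∈ F) (c ε : ℝ)
    (ht : t < T) : Measurable[R.ℋ (t + 1)] (R.increment c ε f f' t) :=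
  ((measurable_excess (hF.measurable _ hf) (hF.measurable _ hf') ht).const_mul _).neg.add
    ((((measurable_meanError f f' ht).mono (R.ℋ.mono (Nat.le_succ t)) le_rfl).const_mul _).sub_const _)

/-- Over the data of the earlier epochs, the least squares estimate has no positive excess error. -/
theorem sum_excess_nonpos (hF : IsRegularClass 𝒯 g b F) (hf : f ∈ F) (hf' : f' ∈ F) {l : ℕ}
    (hl : epochEnd l < T) {ω : Ω} (hω : R.yhat (l + 1) ω = reduced ord.rep f) :
    ∑ t ∈ Finset.range (epochEnd l), R.excess f f' t ω ≤ 0 := by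
  have key : ∀ f₀ ∈ F, ∀ t ∈ Finset.range (epochEnd l),
      ∑ z ∈ insert (R.explore t ω) (R.greedy t ω), ∑ a ∈ R.Φ t ω ∩ ord.arm (R.x t ω) z,
        (reduced ord.rep f₀ (R.x t ω) z - R.r t ω a) ^ 2
      = ∑ a ∈ R.Φ t ω, (f₀ (R.x t ω) a - R.r t ω a) ^ 2 := by
    intro f₀ hf₀ t ht
    have htT : t < T := (Finset.mem_range.1 ht).trans hl
    rw [← sum_inter_arm _ htT ω (R.Φ_subset t htT ω)]
    refine Finset.sum_congr rfl fun z _ => Finset.sum_congr rfl fun a ha => ?_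
    rw [ord.eq_reduced (hF.const _ hf₀) (Finset.mem_inter.1 ha).2]
  have h := R.yhat_argmin l hl ω f' hf'
  rw [hω, Finset.sum_congr rfl (key f hf), Finset.sum_congr rfl (key f' hf')] at h
  simp only [excess, Finset.sum_sub_distrib]
  linarith

variable [IsProbabilityMeasure P] [IsProbabilityMeasure 𝒟] {G : Ω → ℝ} {C : ℝ}

/-- The exponential moment of the excess error in one round. The excess is bounded by `k` and its
second moment by `4 k` times the mean of the squared distance, so that `exp (-y) ≤ 1 - y + y ^ 2`
with `y` the excess divided by `16 k` loses only half of the drift. -/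
theorem integral_mul_exp_le (hF : IsRegularClass 𝒯 g b F) (hk : 1 ≤ k) (hkZ : k ≤ Z)
    (h𝒟 : ∀ᵐ w ∂𝒟, ∀ a, w.2 a ∈ Set.Icc (0 : ℝ) 1)
    (hγ : ∀ l, 0 ≤ γ (l + 1)) {c ε : ℝ} (hc : 0 ≤ c) (hR : R.Feedback c) (hf : f ∈ F) (hf' : f' ∈ F)
    (hε : EpsRealizable 𝒟 ε f') (ht : t < T) (hG : Measurable[R.ℋ t] G) (h0 : ∀ ω, 0 ≤ G ω)
    (hC : ∀ᵐ ω ∂P, |G ω| ≤ C) :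
    ∫ ω, G ω * Real.exp (-(1 / (16 * k) * R.excess f f' t ω)) ∂P
      ≤ ∫ ω, G ω * Real.exp (-(c / (64 * k) * R.meanError f f' t ω - ε ^ 2 / 8)) ∂P := by
  have hkpos : (1 : ℝ) ≤ k := by exact_mod_cast hk
  have hGi : Integrable G P := integrable_of_abs_le (hG.mono (R.ℋ.le t) le_rfl) hC
  have hem : Measurable (R.excess f f' t) :=
    (measurable_excess (hF.measurable _ hf) (hF.measurable _ hf') ht).mono (R.ℋ.le _) le_rfl
  have hqm : Measurable (R.meanError f f' t) :=
    (measurable_meanError f f' ht).mono (R.ℋ.le _) le_rfl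
  have hebd := abs_excess_le_and_sq_le (R := R) hk h𝒟 (hF.mem_Icc _ hf) (hF.mem_Icc _ hf') ht
  have hq0 : ∀ ω, 0 ≤ R.meanError f f' t ω := meanError_nonneg hkZ hγ
  have hqZ : ∀ ω, R.meanError f f' t ω ≤ Z :=
    meanError_le hkZ hγ (hF.mem_Icc _ hf) (hF.mem_Icc _ hf')
  have hYi : Integrable (fun ω => G ω * R.excess f f' t ω) P :=
    hGi.mul_bdd (c := k) hem.aestronglyMeasurable (hebd.mono fun ω h => h.1)
  have hDi : Integrable (fun ω => G ω * R.sqDist f f' t ω) P :=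
    hGi.mul_bdd (c := k) ((measurable_sqDist (hF.measurable _ hf) (hF.measurable _ hf') ht).mono
      (R.ℋ.le _) le_rfl).aestronglyMeasurable (ae_of_all _ fun ω => by
        rw [Real.norm_eq_abs, abs_of_nonneg (sqDist_nonneg ω)]
        exact sqDist_le hk (hF.mem_Icc _ hf) (hF.mem_Icc _ hf') ht ω)
  have hQi : Integrable (fun ω => G ω * R.meanError f f' t ω) P :=
    hGi.mul_bdd (c := Z) hqm.aestronglyMeasurable (ae_of_all _ fun ω => by
        rw [Real.norm_eq_abs, abs_of_nonneg (hq0 ω)]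
        exact hqZ ω)
  have hEi : Integrable (fun ω => G ω * Real.exp (-(1 / (16 * k) * R.excess f f' t ω))) P := by
    refine hGi.mul_bdd (c := Real.exp 1)
      (Real.measurable_exp.comp (hem.const_mul _).neg).aestronglyMeasurable ?_
    filter_upwards [hebd] with ω h
    rw [Real.norm_eq_abs, abs_of_pos (Real.exp_pos _), Real.exp_le_exp]
    have h1 := (abs_le.1 h.1).1
    have h2 : 1 / (16 * (k : ℝ)) * (-R.excess f f' t ω) ≤ 1 / (16 * (k : ℝ)) * k :=
      mul_le_mul_of_nonneg_left (by linarith) (by positivity)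
    have h3 : 1 / (16 * (k : ℝ)) * k = 1 / 16 := by field_simp
    linarith
  have hEi2 : Integrable (fun ω => G ω *
      Real.exp (-(c / (64 * k) * R.meanError f f' t ω - ε ^ 2 / 8))) P := by
    refine hGi.mul_bdd (c := Real.exp (ε ^ 2 / 8))
      (Real.measurable_exp.comp ((hqm.const_mul _).sub_const _).neg).aestronglyMeasurable
      (ae_of_all _ fun ω => ?_)
    rw [Real.norm_eq_abs, abs_of_pos (Real.exp_pos _), Real.exp_le_exp]
    have : 0 ≤ c / (64 * k) * R.meanError f f' t ω := mul_nonneg (by positivity) (hq0 ω)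
    linarith
  have s1 : ∫ ω, G ω * Real.exp (-(1 / (16 * k) * R.excess f f' t ω)) ∂P
      ≤ ∫ ω, (G ω - 1 / (16 * k) * (G ω * R.excess f f' t ω)
        + 1 / (64 * k) * (G ω * R.sqDist f f' t ω)) ∂P := by
    refine integral_mono_ae hEi ((hGi.sub (hYi.const_mul _)).add (hDi.const_mul _)) ?_
    filter_upwards [hebd] with ω h
    have hy : |-(1 / (16 * (k : ℝ)) * R.excess f f' t ω)| ≤ 1 := by
      rw [abs_neg, abs_mul, abs_of_pos (by positivity : 0 < 1 / (16 * (k : ℝ)))]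
      have h2 : 1 / (16 * (k : ℝ)) * |R.excess f f' t ω| ≤ 1 / (16 * (k : ℝ)) * k :=
        mul_le_mul_of_nonneg_left h.1 (by positivity)
      have h3 : 1 / (16 * (k : ℝ)) * k = 1 / 16 := by field_simp
      linarith
    have h1 := (abs_le.1 (Real.abs_exp_sub_one_sub_id_le hy)).2
    have h2 : (-(1 / (16 * (k : ℝ)) * R.excess f f' t ω)) ^ 2
        ≤ 1 / (64 * k) * R.sqDist f f' t ω := by
      have h3 : (-(1 / (16 * (k : ℝ)) * R.excess f f' t ω)) ^ 2
        = 1 / (256 * k ^ 2) * R.excess f f' t ω ^ 2 := by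
          field_simp
          ring
      have h4 : 1 / (64 * (k : ℝ)) * R.sqDist f f' t ω
        = 1 / (256 * k ^ 2) * (4 * k * R.sqDist f f' t ω) := by
          field_simp
          ring
      rw [h3, h4]
      exact mul_le_mul_of_nonneg_left h.2 (by positivity)
    have h5 := mul_le_mul_of_nonneg_left
      (show Real.exp (-(1 / (16 * (k : ℝ)) * R.excess f f' t ω))
        ≤ 1 - 1 / (16 * k) * R.excess f f' t ω + 1 / (64 * k) * R.sqDist f f' t ω by linarith) (h0 ω)
    refine h5.trans (le_of_eq ?_)
    ring
  have s2 := integral_sqDist_le (R := R) hF hk h𝒟 hf hf' hε ht hG h0 hC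
  have s3 := mul_integral_meanError_le hF hk hkZ hγ hc hR hf hf' ht hG h0 hC
  have s4 : ∫ ω, (G ω - c / (64 * k) * (G ω * R.meanError f f' t ω) + ε ^ 2 / 8 * G ω) ∂P
      ≤ ∫ ω, G ω * Real.exp (-(c / (64 * k) * R.meanError f f' t ω - ε ^ 2 / 8)) ∂P := by
    refine integral_mono ((hGi.sub (hQi.const_mul _)).add (hGi.const_mul _)) hEi2 fun ω => ?_
    have h1 := mul_le_mul_of_nonneg_left
      (Real.add_one_le_exp (-(c / (64 * k) * R.meanError f f' t ω - ε ^ 2 / 8))) (h0 ω)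
    refine le_trans (le_of_eq ?_) h1
    ring
  have lin : ∀ {U V : Ω → ℝ} (α β : ℝ), Integrable U P → Integrable V P →
      ∫ ω, (G ω - α * U ω + β * V ω) ∂P = ∫ ω, G ω ∂P - α * ∫ ω, U ω ∂P + β * ∫ ω, V ω ∂P := by
    intro U V α β hU hV
    rw [← integral_const_mul, ← integral_const_mul, ← integral_sub hGi (hU.const_mul α)]
    exact integral_add (hGi.sub (hU.const_mul α)) (hV.const_mul β)
  rw [lin _ _ hYi hDi] at s1
  rw [lin _ _ hQi hGi] at s4
  refine s1.trans (le_trans ?_ s4)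
  set IG := ∫ ω, G ω ∂P
  set IY := ∫ ω, G ω * R.excess f f' t ω ∂P
  set ID := ∫ ω, G ω * R.sqDist f f' t ω ∂P
  set IQ := ∫ ω, G ω * R.meanError f f' t ω ∂P
  have h1 : 1 / (16 * (k : ℝ)) * (1 / 2 * ID - 2 * k * ε ^ 2 * IG) ≤ 1 / (16 * k) * IY :=
    mul_le_mul_of_nonneg_left s2 (by positivity)
  have h2 : 1 / (64 * (k : ℝ)) * (c * IQ) ≤ 1 / (64 * k) * ID :=
    mul_le_mul_of_nonneg_left s3 (by positivity)
  have h3 : 1 / (16 * (k : ℝ)) * (1 / 2 * ID - 2 * k * ε ^ 2 * IG)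
      = 2 * (1 / (64 * k) * ID) - ε ^ 2 / 8 * IG := by
    field_simp
    ring
  have h4 : 1 / (64 * (k : ℝ)) * (c * IQ) = c / (64 * k) * IQ := by ring
  linarith

/-- The exponential of the accumulated increments is a supermartingale started at `1`; only the bound
on its mean, and what is needed to prove it by induction, are recorded. -/
theorem integral_exp_sum_increment_le (hF : IsRegularClass 𝒯 g b F) (hk : 1 ≤ k) (hkZ : k ≤ Z)
    (h𝒟 : ∀ᵐ w ∂𝒟, ∀ a, w.2 a ∈ Set.Icc (0 : ℝ) 1)
    (hγ : ∀ l, 0 ≤ γ (l + 1)) {c ε : ℝ} (hc : 0 ≤ c) (hR : R.Feedback c) (hf : f ∈ F) (hf' : f' ∈ F)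
    (hε : EpsRealizable 𝒟 ε f') (n : ℕ) (hn : n ≤ T) :
    Measurable[R.ℋ n] (fun ω => Real.exp (∑ s ∈ Finset.range n, R.increment c ε f f' s ω)) ∧
      (∃ C, ∀ᵐ ω ∂P, |Real.exp (∑ s ∈ Finset.range n, R.increment c ε f f' s ω)| ≤ C) ∧
      ∫ ω, Real.exp (∑ s ∈ Finset.range n, R.increment c ε f f' s ω) ∂P ≤ 1 := by
  induction n with
  | zero => exact ⟨by simp, ⟨1, by simp⟩, by simp⟩
  | succ n ih =>
    obtain ⟨hm, ⟨C, hC⟩, hle⟩ := ih (by omega)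
    have hnT : n < T := by omega
    have hkpos : (1 : ℝ) ≤ k := by exact_mod_cast hk
    set M : Ω → ℝ := fun ω => Real.exp (∑ s ∈ Finset.range n, R.increment c ε f f' s ω) with hM
    set q : Ω → ℝ := fun ω => c / (64 * k) * R.meanError f f' n ω - ε ^ 2 / 8 with hq
    have hqm : Measurable[R.ℋ n] q := ((measurable_meanError f f' hnT).const_mul _).sub_const _
    have hqle : ∀ ω, q ω ≤ c / (64 * k) * Z := by
      intro ω
      have h1 := meanError_le (R := R) (t := n) hkZ hγ (hF.mem_Icc _ hf) (hF.mem_Icc _ hf') ω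
      have h2 : c / (64 * k) * R.meanError f f' n ω ≤ c / (64 * k) * Z :=
        mul_le_mul_of_nonneg_left h1 (by positivity)
      have h3 := sq_nonneg ε
      simp only [hq]
      linarith
    have hsucc : ∀ ω, Real.exp (∑ s ∈ Finset.range (n + 1), R.increment c ε f f' s ω)
        = M ω * Real.exp (q ω) * Real.exp (-(1 / (16 * k) * R.excess f f' n ω)) := by
      intro ω
      rw [Finset.sum_range_succ, Real.exp_add, increment, Real.exp_add]
      simp only [hM, hq]
      ring
    have hG : Measurable[R.ℋ n] fun ω => M ω * Real.exp (q ω) :=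
      hm.mul (Real.measurable_exp.comp hqm)
    have hGC : ∀ᵐ ω ∂P, |M ω * Real.exp (q ω)| ≤ C * Real.exp (c / (64 * k) * Z) := by
      filter_upwards [hC] with ω h
      rw [abs_mul, abs_of_pos (Real.exp_pos (q ω))]
      exact mul_le_mul h (Real.exp_le_exp.2 (hqle ω)) (Real.exp_pos _).le ((abs_nonneg _).trans h)
    refine ⟨?_, ⟨C * Real.exp (c / (64 * k) * Z) * Real.exp 1, ?_⟩, ?_⟩
    · refine Real.measurable_exp.comp (Finset.measurable_sum _ fun s hs => ?_)
      have hs' := Finset.mem_range.1 hs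
      exact (measurable_increment hF hf hf' c ε (by omega)).mono (R.ℋ.mono (by omega)) le_rfl
    · filter_upwards [hGC, abs_excess_le_and_sq_le (R := R) hk h𝒟 (hF.mem_Icc _ hf)
        (hF.mem_Icc _ hf') hnT] with ω h h'
      rw [hsucc, abs_mul, abs_of_pos (Real.exp_pos (-(1 / (16 * k) * R.excess f f' n ω)))]
      refine mul_le_mul h (Real.exp_le_exp.2 ?_) (Real.exp_pos _).le ((abs_nonneg _).trans h)
      have h1 := (abs_le.1 h'.1).1
      have h2 : 1 / (16 * (k : ℝ)) * (-R.excess f f' n ω) ≤ 1 / (16 * (k : ℝ)) * k :=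
        mul_le_mul_of_nonneg_left (by linarith) (by positivity)
      have h3 : 1 / (16 * (k : ℝ)) * k = 1 / 16 := by field_simp
      linarith
    · simp only [hsucc]
      refine (integral_mul_exp_le hF hk hkZ h𝒟 hγ hc hR hf hf' hε hnT hG
        (fun ω => mul_nonneg (Real.exp_pos _).le (Real.exp_pos _).le) hGC).trans ?_
      refine le_trans (le_of_eq (integral_congr_ae (ae_of_all _ fun ω => ?_))) hle
      show M ω * Real.exp (q ω) * Real.exp (-q ω) = M ω
      rw [mul_assoc, ← Real.exp_add, add_neg_cancel, Real.exp_zero, mul_one]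

theorem measureReal_log_le_sum_increment (hF : IsRegularClass 𝒯 g b F) (hk : 1 ≤ k) (hkZ : k ≤ Z)
    (h𝒟 : ∀ᵐ w ∂𝒟, ∀ a, w.2 a ∈ Set.Icc (0 : ℝ) 1)
    (hγ : ∀ l, 0 ≤ γ (l + 1)) {c ε : ℝ} (hc : 0 ≤ c) (hR : R.Feedback c) (hf : f ∈ F) (hf' : f' ∈ F)
    (hε : EpsRealizable 𝒟 ε f') {n : ℕ} (hn : n ≤ T) {y : ℝ} (hy : 0 < y) :
    P.real {ω | Real.log y ≤ ∑ s ∈ Finset.range n, R.increment c ε f f' s ω} ≤ y⁻¹ := by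
  obtain ⟨hm, ⟨C, hC⟩, hle⟩ := integral_exp_sum_increment_le hF hk hkZ h𝒟 hγ hc hR hf hf' hε n hn
  have hi := integrable_of_abs_le (hm.mono (R.ℋ.le n) le_rfl) hC
  have h := mul_meas_ge_le_integral_of_nonneg (ae_of_all P fun ω =>
    (Real.exp_pos (∑ s ∈ Finset.range n, R.increment c ε f f' s ω)).le) hi y
  simp only [← Real.log_le_iff_le_exp hy] at h
  rw [← one_div, le_div_iff₀ hy]
  linarith

/-- With probability at least `1 - δ`, all the regression estimates are close to the truth on the
data they are fitted to. -/
theorem exists_bad_event (hF : IsRegularClass 𝒯 g b F) (hk : 1 ≤ k) (hkZ : k ≤ Z) (hT : 2 ≤ T)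
    (h𝒟 : ∀ᵐ w ∂𝒟, ∀ a, w.2 a ∈ Set.Icc (0 : ℝ) 1)
    (hγ : ∀ l, 0 ≤ γ (l + 1)) {c δ ε : ℝ} (hc : 0 ≤ c) (hδ : 0 < δ) (hR : R.Feedback c)
    (hf' : f' ∈ F) (hε : EpsRealizable 𝒟 ε f') :
    ∃ bad : Set Ω, P.real bad ≤ δ ∧ ∀ ω ∉ bad, ∀ l, epochEnd l < T → ∀ f ∈ F,
      R.yhat (l + 1) ω = reduced ord.rep f →
        c * ∑ t ∈ Finset.range (epochEnd l), R.meanError f f' t ω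
          ≤ 64 * k * Real.log (F.card * T ^ 3 / δ) + 8 * k * ε ^ 2 * epochEnd l := by
  have hcard : (1 : ℝ) ≤ F.card := by exact_mod_cast Finset.card_pos.2 ⟨f', hf'⟩
  have hT' : (2 : ℝ) ≤ T := by exact_mod_cast hT
  have hkpos : (1 : ℝ) ≤ k := by exact_mod_cast hk
  set y : ℝ := F.card * T ^ 3 / δ with hy
  have hypos : 0 < y := by positivity
  set E : (X → Fin A → ℝ) → ℕ → Set Ω := fun f l =>
    {ω | Real.log y ≤ ∑ s ∈ Finset.range (epochEnd l), R.increment c ε f f' s ω} with hE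
  set I : Finset ℕ := (Finset.range T).filter fun l => epochEnd l < T with hI
  refine ⟨⋃ f ∈ F, ⋃ l ∈ I, E f l, ?_, ?_⟩
  · have h1 : ∀ f ∈ F, P.real (⋃ l ∈ I, E f l) ≤ T * y⁻¹ := by
      intro f hf
      refine (measureReal_biUnion_finset_le _ _).trans ?_
      refine (Finset.sum_le_card_nsmul _ _ y⁻¹ fun l hl => ?_).trans ?_
      · exact measureReal_log_le_sum_increment hF hk hkZ h𝒟 hγ hc hR hf hf' hε
          (Finset.mem_filter.1 hl).2.le hypos
      · rw [nsmul_eq_mul]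
        refine mul_le_mul_of_nonneg_right ?_ (by positivity)
        exact_mod_cast (Finset.card_filter_le _ _).trans (Finset.card_range T).le
    refine (measureReal_biUnion_finset_le _ _).trans ?_
    refine (Finset.sum_le_card_nsmul _ _ _ h1).trans ?_
    rw [nsmul_eq_mul]
    have h2 : (F.card : ℝ) * (T * y⁻¹) = δ / T ^ 2 := by
      rw [hy]
      field_simp
    rw [h2]
    exact div_le_self hδ.le (by nlinarith)
  · intro ω hω l hl f hf hyhat
    have hlT : l < T := by
      rcases l with _ | l
      · omega
      · exact (Nat.lt_two_pow_self).trans hl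
    have hnot : ω ∉ E f l := fun h => hω (Set.mem_biUnion hf
      (Set.mem_biUnion (Finset.mem_filter.2 ⟨Finset.mem_range.2 hlT, hl⟩ : l ∈ I) h))
    have h1 : ∑ s ∈ Finset.range (epochEnd l), R.increment c ε f f' s ω < Real.log y :=
      not_le.1 hnot
    have h2 := sum_excess_nonpos hF hf hf' hl hyhat
    simp only [increment, Finset.sum_add_distrib, Finset.sum_sub_distrib, Finset.sum_neg_distrib,
      ← Finset.mul_sum, Finset.sum_const, Finset.card_range, nsmul_eq_mul] at h1
    set S := ∑ t ∈ Finset.range (epochEnd l), R.meanError f f' t ω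
    have h3 : 0 ≤ -(1 / (16 * (k : ℝ)) * ∑ t ∈ Finset.range (epochEnd l), R.excess f f' t ω) := by
      rw [← mul_neg]
      exact mul_nonneg (by positivity) (by linarith)
    have h4 : c / (64 * k) * S ≤ Real.log y + epochEnd l * (ε ^ 2 / 8) := by linarith
    have h5 : c * S = 64 * k * (c / (64 * k) * S) := by field_simp
    rw [h5]
    have h6 := mul_le_mul_of_nonneg_left h4 (by positivity : 0 ≤ 64 * (k : ℝ))
    linarith

end ExtremeRun

/-! ### The regret of a round -/

namespace ExtremeRun

variable {A p m H b Z : ℕ} {X : Type*} [MeasurableSpace X] {𝒯 : ArmTree A p m H}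
  {g : ℕ → ℕ → X → ℝ} {Ω : Type*} [mΩ : MeasurableSpace Ω] {P : Measure Ω}
  {ord : ArmOrder 𝒯 g b Z} {𝒟 : Measure (X × (Fin A → ℝ))}
  {F : Finset (X → Fin A → ℝ)}
  {k T : ℕ} {γ : ℕ → ℝ} {R : ExtremeRun P ord 𝒟 F k T γ} {t : ℕ} {f : X → Fin A → ℝ}

variable (R) in
/-- The regret of round `t`, before taking the conditional expectation. -/
def roundRegret (f : X → Fin A → ℝ) (t : ℕ) (ω : Ω) : ℝ :=
  bestValue k (effectiveArms 𝒯 g b (R.x t ω)) (f (R.x t ω)) - ∑ a ∈ R.B t ω, f (R.x t ω) a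

variable (R) in
/-- The estimated regret of the exploration slot in round `t`. -/
def scoreGap (t : ℕ) (ω : Ω) : ℝ :=
  R.score t ω (R.x t ω) (R.star t ω) - R.score t ω (R.x t ω) (R.explore t ω)

theorem measurable_bestValue (ord : ArmOrder 𝒯 g b Z) (hf : ∀ a, Measurable fun x => f x a) :
    Measurable fun x => bestValue k (effectiveArms 𝒯 g b x) (f x) := by
  refine measurable_of_finite_range (s := Finset.univ) (fun _ => Finset.mem_univ _) ?_
    (φ := fun E x => bestValue k E (f x)) ?_
  · intro E _
    have h : Measurable[_, ⊤] ord.arm := by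
      refine @measurable_to_countable' _ _ ⊤ _ _ _ fun e => ?_
      have h1 : ord.arm ⁻¹' {e} = ⋂ z, {x | ord.arm x z = e z} := by
        ext x
        simp [funext_iff]
      rw [h1]
      exact MeasurableSet.iInter fun z => ord.measurable_arm z _
    have h2 := h (show MeasurableSet[⊤] {q | Finset.univ.image q = E} from trivial)
    simp only [Set.preimage_ofPred_eq, ord.image_eq] at h2
    exact h2
  · intro E _
    exact Measurable.iSup fun s => Finset.measurable_sum _ fun a _ => hf a

theorem measurable_roundRegret (hf : ∀ a, Measurable fun x => f x a) (ht : t < T) :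
    Measurable (R.roundRegret f t) := by
  have h : R.roundRegret f t = fun ω => bestValue k (effectiveArms 𝒯 g b (R.x t ω)) (f (R.x t ω))
      - ∑ a, f (R.x t ω) a * ind {ω | a ∈ R.B t ω} ω :=
    funext fun ω => congrArg _ (sum_B_eq_ind _ ω)
  rw [h]
  refine ((measurable_bestValue ord hf).comp (measurable_x_ambient ht)).sub
    (Finset.measurable_sum _ fun a _ => ?_)
  exact ((hf a).comp (measurable_x_ambient ht)).mul
    (measurable_ind (R.ℋ.le _ _ (measurableSet_mem_B ht a)))

theorem roundRegret_le_topRegret (hF : IsRegularClass 𝒯 g b F) (hkZ : k ≤ Z) (hf : f ∈ F)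
    (ht : t < T) (ω : Ω) :
    R.roundRegret f t ω ≤ topRegret k (reduced ord.rep f (R.x t ω)) (R.chosen t ω) := by
  have h1 := ord.bestValue_le hkZ (hF.const f hf) (fun x a => (hF.mem_Icc f hf x a).1) (R.x t ω)
  have h2 := sum_B_eq (R := R) ht ω (f (R.x t ω)) (reduced ord.rep f (R.x t ω))
    fun z a ha => ord.eq_reduced (hF.const f hf) ha
  rw [roundRegret, topRegret, h2]
  linarith

theorem roundRegret_le (hF : IsRegularClass 𝒯 g b F) (hkZ : k ≤ Z) (hf : f ∈ F)
    (ht : t < T) (ω : Ω) : R.roundRegret f t ω ≤ k :=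
  (roundRegret_le_topRegret hF hkZ hf ht ω).trans
    (topRegret_le (by rwa [Fintype.card_fin]) (reduced_mem_Icc (hF.mem_Icc f hf) _) _)

theorem neg_le_roundRegret (hF : IsRegularClass 𝒯 g b F) (hk : 1 ≤ k) (hf : f ∈ F)
    (ht : t < T) (ω : Ω) : -(k : ℝ) ≤ R.roundRegret f t ω := by
  have h1 : 0 ≤ bestValue k (effectiveArms 𝒯 g b (R.x t ω)) (f (R.x t ω)) :=
    Real.iSup_nonneg fun s => Finset.sum_nonneg fun a _ => (hF.mem_Icc f hf _ a).1
  have h2 : ∑ a ∈ R.B t ω, f (R.x t ω) a ≤ k := by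
    rw [sum_B_eq (R := R) ht ω (f (R.x t ω)) (reduced ord.rep f (R.x t ω))
      fun z a ha => ord.eq_reduced (hF.const f hf) ha]
    refine (Finset.sum_le_card_nsmul _ _ 1 fun z _ =>
      (reduced_mem_Icc (hF.mem_Icc f hf) _ z).2).trans ?_
    rw [nsmul_eq_mul, mul_one]
    exact_mod_cast card_chosen_le hk ht ω
  rw [roundRegret]
  linarith

theorem measurable_scoreGap (hF : IsRegularClass 𝒯 g b F) (ht : t < T) :
    Measurable[R.ℋ (t + 1)] (R.scoreGap t) := by
  have hs : ∀ z, Measurable[R.ℋ (t + 1)] fun ω => R.score t ω (R.x t ω) z := fun z =>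
    (measurable_score_apply hF ht z).mono (obs_le_succ ht) le_rfl
  exact (measurable_of_finite_range (s := Finset.univ) (fun _ => Finset.mem_univ _)
      (fun z _ => obs_le_succ ht _ (R.measurable_star t ht z))
      (φ := fun z ω => R.score t ω (R.x t ω) z) fun z _ => hs z).sub
    (measurable_of_finite_range (s := Finset.univ) (fun _ => Finset.mem_univ _)
      (fun z _ => R.measurable_explore t ht z)
      (φ := fun z ω => R.score t ω (R.x t ω) z) fun z _ => hs z)

theorem abs_score_sub_le (hF : IsRegularClass 𝒯 g b F) (ht : t < T) (ω : Ω) (z z' : Fin Z) :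
    |R.score t ω (R.x t ω) z - R.score t ω (R.x t ω) z'| ≤ 1 := by
  rw [← sq_le_one_iff_abs_le_one]
  exact sq_sub_le_one (score_mem_Icc hF ht ω _ z) (score_mem_Icc hF ht ω _ z')

variable [IsProbabilityMeasure P]

theorem integrable_roundRegret (hF : IsRegularClass 𝒯 g b F) (hk : 1 ≤ k) (hkZ : k ≤ Z)
    (hf : f ∈ F) (ht : t < T) : Integrable (R.roundRegret f t) P :=
  integrable_of_abs_le (measurable_roundRegret (hF.measurable f hf) ht) (C := k)
    (ae_of_all _ fun ω => abs_le.2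
      ⟨neg_le_roundRegret hF hk hf ht ω, roundRegret_le hF hkZ hf ht ω⟩)

theorem integrable_scoreGap (hF : IsRegularClass 𝒯 g b F) (ht : t < T) :
    Integrable (R.scoreGap t) P :=
  integrable_of_abs_le ((measurable_scoreGap hF ht).mono (R.ℋ.le _) le_rfl) (C := 1)
    (ae_of_all _ fun ω => abs_score_sub_le hF ht ω _ _)

theorem condExp_scoreGap_le (hF : IsRegularClass 𝒯 g b F) (hk : 1 ≤ k) (hkZ : k ≤ Z) (ht : t < T)
    (hγ : 0 < γ (Nat.log 2 t + 1)) :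
    ∀ᵐ ω ∂P, (P[R.scoreGap t | R.ℋ t]) ω ≤ ((Z : ℝ) - k + 1) / γ (Nat.log 2 t + 1) := by
  have hm := obs_le (R := R) ht
  set d : Fin Z → Ω → ℝ := fun z ω =>
    R.score t ω (R.x t ω) (R.star t ω) - R.score t ω (R.x t ω) z with hd
  have hdm : ∀ z, Measurable[R.obs t] (d z) := fun z =>
    (measurable_of_finite_range (s := Finset.univ) (fun _ => Finset.mem_univ _)
      (fun z _ => R.measurable_star t ht z)
      (φ := fun z ω => R.score t ω (R.x t ω) z) fun z _ => measurable_score_apply hF ht z).sub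
      (measurable_score_apply hF ht z)
  have hem : ∀ z, MeasurableSet {ω | R.explore t ω = z} := fun z =>
    R.ℋ.le _ _ (R.measurable_explore t ht z)
  have hd1 : ∀ z, ∀ᵐ ω ∂P, |d z ω| ≤ 1 := fun z =>
    ae_of_all _ fun ω => abs_score_sub_le hF ht ω _ _
  have hsplit : R.scoreGap t = ∑ z, fun ω => d z ω * ind {ω | R.explore t ω = z} ω := by
    funext ω
    rw [Finset.sum_apply, Finset.sum_eq_single_of_mem (R.explore t ω) (Finset.mem_univ _)]
    · simp [hd, scoreGap]
    · intro z _ hz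
      have h : ω ∉ {ω | R.explore t ω = z} := fun h => hz (Eq.symm h)
      simp [h]
  have hobs : ∀ᵐ ω ∂P, (P[R.scoreGap t | R.obs t]) ω
      ≤ ((Z : ℝ) - k + 1) / γ (Nat.log 2 t + 1) := by
    have h1 := condExp_finsetSum (μ := P) (s := Finset.univ)
      (f := fun z ω => d z ω * ind {ω | R.explore t ω = z} ω)
      (fun z _ => integrable_mul_ind hm (hdm z) (hd1 z) (hem z)) (R.obs t)
    rw [← hsplit] at h1
    have h2 : ∀ z, P[fun ω => d z ω * ind {ω | R.explore t ω = z} ω | R.obs t]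
        =ᵐ[P] fun ω => d z ω * (P⟦{ω | R.explore t ω = z} | R.obs t⟧) ω := fun z =>
      condExp_stronglyMeasurable_mul_of_bound₀ hm
        (hdm z).stronglyMeasurable.aestronglyMeasurable
        ((integrable_const (1 : ℝ)).indicator (hem z)) 1 (hd1 z)
    have h3 := fun z => R.explore_law _ t ht (epochEnd_log_le t) (lt_epochEnd_log t) z
    filter_upwards [h1, ae_all_iff.2 h2, ae_all_iff.2 h3] with ω e1 e2 e3
    rw [e1, Finset.sum_apply]
    have hsplitω := isTopSplit (R := R) ht ω
    have h4 := hsplitω.sum_igw_mul_le hγ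
    rw [hsplitω.card_compl hk hkZ] at h4
    refine le_trans (le_of_eq (Finset.sum_congr rfl fun z _ => ?_)) h4
    rw [e2 z]
    exact congrArg (d z ω * ·) (e3 z)
  have htower := condExp_condExp_of_le (μ := P) (f := R.scoreGap t) (le_obs (R := R) (t := t)) hm
  have hmono := condExp_mono (m := R.ℋ t) integrable_condExp
    (integrable_const (((Z : ℝ) - k + 1) / γ (Nat.log 2 t + 1))) hobs
  rw [condExp_const (R.ℋ.le t)] at hmono
  filter_upwards [htower, hmono] with ω h1 h2
  rw [← h1]
  exact h2

/-- The conditional expected regret of a round whose scores admit a slack function. -/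
theorem condExp_roundRegret_le (hF : IsRegularClass 𝒯 g b F) (hk : 1 ≤ k) (hkZ : k ≤ Z)
    (hf : f ∈ F) (ht : t < T) (hγ : 0 < γ (Nat.log 2 t + 1)) {w : X → Fin Z → ℝ}
    (hw : w ∈ R.scoreClass) {W : X → ℝ} (hWm : Measurable W)
    (hWi : Integrable W (𝒟.map Prod.fst))
    (hW : ∀ x, ∀ S : Finset (Fin Z), S.card = k →
      topRegret k (reduced ord.rep f x) S ≤ 2 * topRegret k (w x) S + 2 * W x) :
    ∀ᵐ ω ∂P, R.score t ω = w → (P[R.roundRegret f t | R.ℋ t]) ω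
      ≤ 2 * (((Z : ℝ) - k + 1) / γ (Nat.log 2 t + 1)) + 2 * ∫ x, W x ∂(𝒟.map Prod.fst) := by
  have hm := R.ℋ.le t
  set E : Set Ω := {ω | R.score t ω = w} with hE
  have hEm : MeasurableSet[R.ℋ t] E := measurableSet_score ht w hw
  have hxW : Integrable (fun ω => W (R.x t ω)) P := by
    rw [← map_x (R := R) ht] at hWi
    exact hWi.comp_measurable (measurable_x_ambient ht)
  have hgi := integrable_scoreGap (R := R) (P := P) hF ht
  have hri := integrable_roundRegret (R := R) (P := P) hF hk hkZ hf ht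
  set G : Ω → ℝ := fun ω => 2 * R.scoreGap t ω + 2 * W (R.x t ω) with hG
  have hGi : Integrable G P := (hgi.const_mul 2).add (hxW.const_mul 2)
  have hle : E.indicator (R.roundRegret f t) ≤ᵐ[P] E.indicator G := by
    filter_upwards [ae_explore_notMem (R := R) ht] with ω hω
    by_cases h : ω ∈ E
    · rw [Set.indicator_of_mem h, Set.indicator_of_mem h]
      have hs := isTopSplit (R := R) ht ω
      have h1 := roundRegret_le_topRegret (R := R) hF hkZ hf ht ω
      have h2 := hW (R.x t ω) (R.chosen t ω) (hs.card_insert hk hω)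
      have h3 := hs.topRegret_insert hk hω
      have h4 : R.score t ω = w := h
      rw [h4] at h3
      have h5 : R.scoreGap t ω = w (R.x t ω) (R.star t ω) - w (R.x t ω) (R.explore t ω) := by
        rw [scoreGap, h4]
      simp only [hG, h5, ← h3]
      exact h1.trans h2
    · rw [Set.indicator_of_notMem h, Set.indicator_of_notMem h]
  have h1 := condExp_mono (m := R.ℋ t) (hri.indicator (hm _ hEm)) (hGi.indicator (hm _ hEm)) hle
  have h2 := condExp_indicator hri hEm
  have h3 := condExp_indicator hGi hEm
  have h4 : P[G | R.ℋ t] =ᵐ[P] P[fun ω => 2 * R.scoreGap t ω | R.ℋ t]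
      + P[fun ω => 2 * W (R.x t ω) | R.ℋ t] := condExp_add (hgi.const_mul 2) (hxW.const_mul 2) _
  have h5 : P[fun ω => 2 * R.scoreGap t ω | R.ℋ t] =ᵐ[P] (2 : ℝ) • P[R.scoreGap t | R.ℋ t] :=
    condExp_smul (2 : ℝ) (R.scoreGap t) (R.ℋ t)
  have h6 : P[fun ω => 2 * W (R.x t ω) | R.ℋ t] =ᵐ[P]
      fun _ => ∫ ω, 2 * W (R.x t ω) ∂P := by
    refine condExp_indep_eq (measurable_x_ambient ht).comap_le hm ?_ (indep_x ht)
    exact ((hWm.comp (comap_measurable (R.x t))).const_mul 2).stronglyMeasurable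
  have h7 : ∫ ω, 2 * W (R.x t ω) ∂P = 2 * ∫ x, W x ∂(𝒟.map Prod.fst) := by
    have h := integral_map (μ := P) (measurable_x_ambient (R := R) ht).aemeasurable
      hWm.aestronglyMeasurable
    rw [map_x ht] at h
    rw [integral_const_mul, h]
  filter_upwards [h1, h2, h3, h4, h5, h6, condExp_scoreGap_le (R := R) hF hk hkZ ht hγ]
    with ω e1 e2 e3 e4 e5 e6 e7 hω
  have hωE : ω ∈ E := hω
  rw [e2, e3, Set.indicator_of_mem hωE, Set.indicator_of_mem hωE, e4, Pi.add_apply, e5, e6, h7,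
    Pi.smul_apply, smul_eq_mul] at e1
  linarith

end ExtremeRun

/-! ### The regret bound -/

theorem sum_inv_sqrt_le (T : ℕ) :
    ∑ t ∈ Finset.range T, 1 / Real.sqrt ((t : ℝ) + 1) ≤ 2 * Real.sqrt T := by
  induction T with
  | zero => simp
  | succ n ih =>
    rw [Finset.sum_range_succ]
    push_cast
    have h1 : 0 < Real.sqrt ((n : ℝ) + 1) := Real.sqrt_pos.2 (by positivity)
    have h2 : Real.sqrt ((n : ℝ) + 1) ^ 2 = n + 1 := Real.sq_sqrt (by positivity)
    have h3 : Real.sqrt (n : ℝ) ^ 2 = n := Real.sq_sqrt (by positivity)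
    have h4 : 1 / Real.sqrt ((n : ℝ) + 1) ≤ 2 * Real.sqrt ((n : ℝ) + 1) - 2 * Real.sqrt n := by
      rw [div_le_iff₀ h1]
      nlinarith [sq_nonneg (Real.sqrt ((n : ℝ) + 1) - Real.sqrt n)]
    linarith

namespace ExtremeRun

variable {A p m H b Z : ℕ} {X : Type*} [MeasurableSpace X] {𝒯 : ArmTree A p m H}
  {g : ℕ → ℕ → X → ℝ} {Ω : Type*} [mΩ : MeasurableSpace Ω] {P : Measure Ω}
  {ord : ArmOrder 𝒯 g b Z} {𝒟 : Measure (X × (Fin A → ℝ))}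
  {F : Finset (X → Fin A → ℝ)}
  {k T : ℕ} {γ : ℕ → ℝ} {R : ExtremeRun P ord 𝒟 F k T γ} {fstar : X → Fin A → ℝ}
  [IsProbabilityMeasure P] [IsProbabilityMeasure 𝒟]

/-- The conditional regret of a round after the first epoch, outside the bad event. Only finitely
many scores `w` can occur; for each of those that admit a slack function, the bound holds almost
surely where `w` is the score in use, and `exists_slack` shows that the score in use does admit one
wherever the regression estimates are accurate. -/
theorem ae_condExp_roundRegret_le (hF : IsRegularClass 𝒯 g b F) (hk : 1 ≤ k) (hkZ : k ≤ Z)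
    (hs : fstar ∈ F) (hγ1 : γ 1 = 0) (hmono : Monotone fun l => γ (l + 1))
    (hpos : ∀ l, 1 ≤ l → 0 < γ (l + 1)) {c ε L : ℝ} (hc : 0 < c)
    (hfit : ∀ l, 1 ≤ l → γ (l + 1) ^ 2 * (64 * L + 8 * ε ^ 2 * 2 ^ l)
      ≤ c * ((Z : ℝ) - k + 1) * 2 ^ l) {t : ℕ} (ht : t < T) (hl : 1 ≤ Nat.log 2 t) :
    ∀ᵐ ω ∂P, (∀ l, epochEnd l < T → ∀ f ∈ F, R.yhat (l + 1) ω = reduced ord.rep f →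
        c * ∑ t ∈ Finset.range (epochEnd l), R.meanError f fstar t ω
          ≤ 64 * k * L + 8 * k * ε ^ 2 * epochEnd l) →
      (P[R.roundRegret fstar t | R.ℋ t]) ω
        ≤ 12 * (k * (((Z : ℝ) - k + 1) / γ (Nat.log 2 t + 1))) := by
  have : IsProbabilityMeasure (𝒟.map (Prod.fst : X × (Fin A → ℝ) → X)) :=
    Measure.isProbabilityMeasure_map measurable_fst.aemeasurable
  have hK := one_le_slots (k := k) hkZ
  have hkpos : (1 : ℝ) ≤ k := by exact_mod_cast hk
  set K : ℝ := (Z : ℝ) - k + 1 with hKdef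
  set l₀ := Nat.log 2 t with hl₀
  have hγ₀ := hpos l₀ hl
  have hw : ∀ w ∈ R.scoreClass, ∀ᵐ ω ∂P, (∃ W : X → ℝ, Measurable W ∧
      Integrable W (𝒟.map Prod.fst) ∧ γ (l₀ + 1) * ∫ x, W x ∂(𝒟.map Prod.fst) ≤ 5 * (k * K) ∧
      ∀ x, ∀ S : Finset (Fin Z), S.card = k →
        topRegret k (reduced ord.rep fstar x) S ≤ 2 * topRegret k (w x) S + 2 * W x) →
      R.score t ω = w → (P[R.roundRegret fstar t | R.ℋ t]) ω ≤ 12 * (k * (K / γ (l₀ + 1))) := by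
    intro w hw
    by_cases hex : ∃ W : X → ℝ, Measurable W ∧
      Integrable W (𝒟.map Prod.fst) ∧ γ (l₀ + 1) * ∫ x, W x ∂(𝒟.map Prod.fst) ≤ 5 * (k * K) ∧
      ∀ x, ∀ S : Finset (Fin Z), S.card = k →
        topRegret k (reduced ord.rep fstar x) S ≤ 2 * topRegret k (w x) S + 2 * W x
    · obtain ⟨W, hWm, hWi, hWγ, hW⟩ := hex
      filter_upwards [condExp_roundRegret_le hF hk hkZ hs ht hγ₀ hw hWm hWi hW] with ω h _ hω
      refine (h hω).trans ?_
      have h1 : ∫ x, W x ∂(𝒟.map Prod.fst) ≤ 5 * (k * (K / γ (l₀ + 1))) := by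
        have h2 : 5 * (k * (K / γ (l₀ + 1))) = 5 * (k * K) / γ (l₀ + 1) := by ring
        rw [h2, le_div_iff₀ hγ₀]
        linarith
      have h3 : 1 * (K / γ (l₀ + 1)) ≤ k * (K / γ (l₀ + 1)) :=
        mul_le_mul_of_nonneg_right hkpos (by positivity)
      linarith
    · exact ae_of_all _ fun ω h => absurd h hex
  filter_upwards [(Finset.eventually_all _).2 hw] with ω hω hgood
  refine hω _ (score_mem ht ω) ?_ rfl
  have hlT : ∀ l ≤ l₀, epochEnd l < T := by
    intro l hle
    refine lt_of_le_of_lt ?_ ((epochEnd_log_le t).trans_lt ht)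
    rcases l with _ | l
    · exact Nat.zero_le _
    · obtain ⟨n, hn⟩ : ∃ n, l₀ = n + 1 := ⟨l₀ - 1, by omega⟩
      rw [← hl₀, hn, epochEnd, epochEnd]
      exact Nat.pow_le_pow_right (by norm_num) (by omega)
  have hclass : ∀ l ≤ l₀, ∃ f ∈ F, R.yhat (l + 1) ω = reduced ord.rep f := fun l hle =>
    R.yhat_mem l (hlT l hle) ω
  obtain ⟨W, hWm, hWi, hWγ, hW⟩ := exists_slack (𝒟.map Prod.fst) (k := k) (K := K) hk
    (by rwa [Fintype.card_fin]) hK (γ := fun l => γ (l + 1)) hγ1 hmono hpos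
    (U := reduced ord.rep fstar) (V := fun l => R.yhat (l + 1) ω) l₀
    (ord.measurable_reduced (hF.measurable _ hs))
    (fun l hle => by
      obtain ⟨f, hf, h⟩ := hclass l hle
      simp only [h]
      exact ord.measurable_reduced (hF.measurable _ hf))
    (reduced_mem_Icc (hF.mem_Icc _ hs))
    (fun l hle => by
      obtain ⟨f, hf, h⟩ := hclass l hle
      simp only [h]
      exact reduced_mem_Icc (hF.mem_Icc _ hf))
    (fun l hl1 hle => by
      obtain ⟨f, hf, h⟩ := hclass l hle
      have hN : epochEnd l = 2 ^ l := by
        obtain ⟨n, rfl⟩ : ∃ n, l = n + 1 := ⟨l - 1, by omega⟩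
        rfl
      have h1 := hgood l (hlT l hle) f hf h
      rw [hN] at h1
      push_cast at h1
      have h2 := hfit l hl1
      have h3 : ∀ s, ∫ x, coveredError k K (γ (Nat.log 2 s + 1)) (R.yhat (Nat.log 2 s + 1) ω x)
          (reduced ord.rep fstar x) (R.yhat (l + 1) ω x) ∂(𝒟.map Prod.fst)
          = R.meanError f fstar s ω := fun s => by rw [h]; rfl
      simp only [h3]
      set S := ∑ s ∈ Finset.range (2 ^ l), R.meanError f fstar s ω
      have h4 := mul_le_mul_of_nonneg_left h1 (sq_nonneg (γ (l + 1)))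
      have h5 := mul_le_mul_of_nonneg_left h2 (by positivity : (0 : ℝ) ≤ k)
      have h6 : c * (γ (l + 1) ^ 2 * S) ≤ c * (k * K * 2 ^ l) := by linarith
      exact le_of_mul_le_mul_left h6 hc)
    l₀ le_rfl
  exact ⟨W, hWm, hWi, hWγ, fun x S hS => (hW x S hS).2⟩

/-- The regret bound for scaling factors which are small enough for the accuracy of the regression
estimates (`hfit`) and large enough for the exploration to be cheap (`hslow`). -/
theorem regret_le (hF : IsRegularClass 𝒯 g b F) (hk : 1 ≤ k) (hkZ : k ≤ Z) (hT : 2 ≤ T)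
    (h𝒟 : ∀ᵐ w ∂𝒟, ∀ a, w.2 a ∈ Set.Icc (0 : ℝ) 1) (hs : fstar ∈ F)
    (hγ1 : γ 1 = 0) (hmono : Monotone fun l => γ (l + 1))
    (hpos : ∀ l, 1 ≤ l → 0 < γ (l + 1)) {c δ ε : ℝ} (hc : 0 < c) (hδ : 0 < δ)
    (hε : EpsRealizable 𝒟 ε fstar) (hR : R.Feedback c)
    (hfit : ∀ l, 1 ≤ l → γ (l + 1) ^ 2 *
      (64 * Real.log (F.card * T ^ 3 / δ) + 8 * ε ^ 2 * 2 ^ l) ≤ c * ((Z : ℝ) - k + 1) * 2 ^ l)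
    {α β : ℝ} (hα : 1 ≤ α) (hβ : 0 ≤ β) (hslow : ∀ l, 1 ≤ l →
      ((Z : ℝ) - k + 1) / γ (l + 1) ≤ α / Real.sqrt (2 ^ l) + β) :
    1 - δ ≤ P.real {ω | R.regret fstar ω ≤ k * (34 * (α * Real.sqrt T) + 12 * (β * T))} := by
  have hγ : ∀ l, 0 ≤ γ (l + 1) := fun l => by
    have h := hmono (Nat.zero_le l)
    simp only [zero_add, hγ1] at h
    exact h
  obtain ⟨bad, hbad, hgood⟩ := exists_bad_event hF hk hkZ hT h𝒟 hγ hc.le hδ hR hs hε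
  have hkpos : (1 : ℝ) ≤ k := by exact_mod_cast hk
  have hround : ∀ t ∈ Finset.range T, ∀ᵐ ω ∂P, ω ∉ bad →
      (P[R.roundRegret fstar t | R.ℋ t]) ω
        ≤ k * (12 * Real.sqrt 2 * α * (1 / Real.sqrt ((t : ℝ) + 1)) + 12 * β) := by
    intro t ht
    have htT := Finset.mem_range.1 ht
    have hsqrt : 0 < Real.sqrt ((t : ℝ) + 1) := Real.sqrt_pos.2 (by positivity)
    by_cases hl : 1 ≤ Nat.log 2 t
    · filter_upwards [ae_condExp_roundRegret_le (R := R) hF hk hkZ hs hγ1 hmono hpos hc hfit htT hl]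
        with ω h hω
      refine (h (hgood ω hω)).trans ?_
      -- the epoch of round `t` is fitted to at least `(t + 1) / 2` rounds
      have h1 : Real.sqrt ((t : ℝ) + 1) ≤ Real.sqrt 2 * Real.sqrt (2 ^ Nat.log 2 t) := by
        rw [← Real.sqrt_mul (by norm_num), ← pow_succ']
        refine Real.sqrt_le_sqrt ?_
        exact_mod_cast Nat.lt_pow_succ_log_self (by norm_num) t
      have h2 : α / Real.sqrt (2 ^ Nat.log 2 t)
          ≤ Real.sqrt 2 * α * (1 / Real.sqrt ((t : ℝ) + 1)) := by
        rw [mul_one_div, div_le_div_iff₀ (Real.sqrt_pos.2 (by positivity)) hsqrt]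
        have := mul_le_mul_of_nonneg_left h1 (by linarith : 0 ≤ α)
        linarith
      have h3 := mul_le_mul_of_nonneg_left (hslow _ hl) (by linarith : (0 : ℝ) ≤ k)
      have h4 := mul_le_mul_of_nonneg_left h2 (by linarith : (0 : ℝ) ≤ k)
      linarith
    · have h1 := condExp_mono (m := R.ℋ t)
        (integrable_roundRegret (R := R) (P := P) hF hk hkZ hs htT)
        (integrable_const (k : ℝ)) (ae_of_all _ fun ω => roundRegret_le hF hkZ hs htT ω)
      rw [condExp_const (R.ℋ.le t)] at h1
      filter_upwards [h1] with ω h _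
      refine h.trans ?_
      have ht2 : t < 2 := by
        by_contra hcon
        exact hl (Nat.le_log_of_pow_le (by norm_num) (by omega))
      have h2 : Real.sqrt ((t : ℝ) + 1) ≤ Real.sqrt 2 := by
        refine Real.sqrt_le_sqrt ?_
        have : (t : ℝ) + 1 ≤ 2 := by exact_mod_cast ht2
        linarith
      have h3 : 1 ≤ Real.sqrt 2 * (1 / Real.sqrt ((t : ℝ) + 1)) := by
        rw [mul_one_div, le_div_iff₀ hsqrt]
        linarith
      have h4 : 1 ≤ α * (Real.sqrt 2 * (1 / Real.sqrt ((t : ℝ) + 1))) := by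
        nlinarith
      refine le_mul_of_one_le_right (by linarith) ?_
      linarith
  have hincl : ∀ᵐ ω ∂P, ω ∈ {ω | R.regret fstar ω
      ≤ k * (34 * (α * Real.sqrt T) + 12 * (β * T))} ∪ bad := by
    filter_upwards [(Finset.eventually_all _).2 hround] with ω hω
    by_cases hb : ω ∈ bad
    · exact Or.inr hb
    · refine Or.inl ?_
      have h1 : R.regret fstar ω ≤ ∑ t ∈ Finset.range T,
          k * (12 * Real.sqrt 2 * α * (1 / Real.sqrt ((t : ℝ) + 1)) + 12 * β) :=
        Finset.sum_le_sum fun t ht => hω t ht hb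
      refine h1.trans ?_
      rw [← Finset.mul_sum, Finset.sum_add_distrib, ← Finset.mul_sum, Finset.sum_const,
        Finset.card_range, nsmul_eq_mul]
      refine mul_le_mul_of_nonneg_left ?_ (by linarith)
      have h2 := mul_le_mul_of_nonneg_left (sum_inv_sqrt_le T)
        (by positivity : 0 ≤ 12 * Real.sqrt 2 * α)
      have h3 : Real.sqrt 2 ≤ 34 / 24 := Real.sqrt_le_iff.2 ⟨by norm_num, by norm_num⟩
      have h4 := mul_le_mul_of_nonneg_right h3
        (mul_nonneg (by linarith : 0 ≤ α) (Real.sqrt_nonneg T))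
      linarith
  have h1 : P Set.univ ≤ P ({ω | R.regret fstar ω
      ≤ k * (34 * (α * Real.sqrt T) + 12 * (β * T))} ∪ bad) :=
    measure_mono_ae (hincl.mono fun ω h _ => h)
  have h2 := ENNReal.toReal_mono (measure_ne_top P _) h1
  have h3 := measureReal_union_le (μ := P) {ω | R.regret fstar ω
      ≤ k * (34 * (α * Real.sqrt T) + 12 * (β * T))} bad
  rw [measure_univ, ENNReal.toReal_one] at h2
  rw [measureReal_def] at h3
  linarith

end ExtremeRun

/-! ### The scaling factors -/

theorem epochEnd_eq_pow {l : ℕ} (hl : 1 ≤ l) : epochEnd l = 2 ^ l := by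
  obtain ⟨n, rfl⟩ : ∃ n, l = n + 1 := ⟨l - 1, by omega⟩
  rfl

theorem epochEnd_mono : Monotone epochEnd := by
  refine monotone_nat_of_le_succ fun l => ?_
  rcases l with _ | l
  · exact Nat.zero_le _
  · exact Nat.pow_le_pow_right (by norm_num) (Nat.le_succ _)

section Scaling

variable {c δ ε : ℝ} {n k M T : ℕ}

theorem one_le_log (hM : 1 ≤ M) (hT : 2 ≤ T) (hδ : 0 < δ) (hδ1 : δ < 1) :
    1 ≤ Real.log ((M : ℝ) * (T : ℝ) ^ 3 / δ) := by
  have hM' : (1 : ℝ) ≤ M := by exact_mod_cast hM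
  have hT' : (2 : ℝ) ≤ T := by exact_mod_cast hT
  have h8 : (8 : ℝ) ≤ (M : ℝ) * (T : ℝ) ^ 3 := by
    have h1 : (2 : ℝ) ^ 3 ≤ (T : ℝ) ^ 3 := pow_le_pow_left₀ (by norm_num) hT' 3
    nlinarith
  rw [Real.le_log_iff_exp_le (by positivity), le_div_iff₀ hδ]
  have := Real.exp_one_lt_d9
  nlinarith [Real.exp_pos 1]

theorem log_pow_three_le (hM : 1 ≤ M) (hT : 2 ≤ T) (hδ : 0 < δ) (hδ1 : δ < 1) :
    Real.log ((M : ℝ) * (T : ℝ) ^ 3 / δ) ≤ 3 * Real.log (M * T / δ) := by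
  have hM' : (1 : ℝ) ≤ M := by exact_mod_cast hM
  have hT' : (2 : ℝ) ≤ T := by exact_mod_cast hT
  have h : Real.log (((M : ℝ) * T / δ) ^ 3) = 3 * Real.log (M * T / δ) := by
    simp [Real.log_pow]
  rw [← h]
  refine Real.log_le_log (by positivity) ?_
  rw [div_pow, mul_pow]
  refine div_le_div₀ (by positivity) ?_ (by positivity) ?_
  · exact mul_le_mul_of_nonneg_right (le_self_pow₀ hM' (by norm_num)) (by positivity)
  · exact pow_le_of_le_one hδ.le hδ1.le (by norm_num)

theorem gammaExact_mono (hc : 0 ≤ c) (hK : 0 ≤ (n : ℝ) - k + 1)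
    (hL : 0 ≤ Real.log ((M : ℝ) * (T : ℝ) ^ 3 / δ)) :
    Monotone fun l => gammaExact c n k M T δ (l + 1) := by
  intro l l' hle
  have h : (epochEnd l : ℝ) ≤ epochEnd l' := by exact_mod_cast epochEnd_mono hle
  simp only [gammaExact, Nat.add_sub_cancel]
  gcongr

theorem gammaEps_mono (hL : 0 ≤ Real.log ((M : ℝ) * (T : ℝ) ^ 3 / δ))
    (hpos : ∀ l, 1 ≤ l → 0 < gammaEps c ε n k M T δ (l + 1)) :
    Monotone fun l => gammaEps c ε n k M T δ (l + 1) := by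
  refine monotone_nat_of_le_succ fun l => ?_
  rcases l with _ | l
  · have h := hpos 1 le_rfl
    simpa [gammaEps, epochEnd] using h.le
  · have h := hpos (l + 1) (by omega)
    have h2 : (0 : ℝ) < epochEnd (l + 1) := by rw [epochEnd]; positivity
    have h3 : (epochEnd (l + 1) : ℝ) ≤ epochEnd (l + 2) := by
      exact_mod_cast epochEnd_mono (Nat.le_succ _)
    have h4 : epochEnd (l + 1) ≠ 0 := by exact_mod_cast h2.ne'
    have h5 : epochEnd (l + 2) ≠ 0 := by exact_mod_cast (h2.trans_le h3).ne'
    simp only [gammaEps, Nat.add_sub_cancel, if_neg h4, if_neg h5] at h ⊢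
    have hden : 0 < 420 / (epochEnd (l + 2) : ℝ) * Real.log ((M : ℝ) * (T : ℝ) ^ 3 / δ)
        + 2 * ε ^ 2 := by
      have h6 := hpos (l + 2) (by omega)
      simp only [gammaEps, Nat.add_sub_cancel, if_neg h5] at h6
      by_contra hcon
      rw [Real.sqrt_eq_zero_of_nonpos (not_lt.1 hcon)] at h6
      simp at h6
    gcongr

variable {K L N : ℝ}

theorem exact_sq_mul_le (hc : 0 < c) (hK : 1 ≤ K) (hL : 1 ≤ L) (hN : 0 < N) :
    (1 / 32 * Real.sqrt (c * K * N / (162 * L))) ^ 2 * (64 * L) ≤ c * K * N := by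
  rw [mul_pow, Real.sq_sqrt (by positivity)]
  have h : (1 / 32 : ℝ) ^ 2 * (c * K * N / (162 * L)) * (64 * L) = c * K * N / 2592 := by
    field_simp
    norm_num
  rw [h]
  exact div_le_self (by positivity) (by norm_num)

theorem div_exact_le (hc : 0 < c) (hK : 1 ≤ K) (hL : 1 ≤ L) (hN : 0 < N) :
    K / (1 / 32 * Real.sqrt (c * K * N / (162 * L)))
      ≤ 32 * Real.sqrt (420 * K * L * c⁻¹) / Real.sqrt N := by
  rw [div_le_div_iff₀ (mul_pos (by norm_num) (Real.sqrt_pos.2 (by positivity)))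
    (Real.sqrt_pos.2 hN)]
  have h1 : 32 * Real.sqrt (420 * K * L * c⁻¹) * (1 / 32 * Real.sqrt (c * K * N / (162 * L)))
      = Real.sqrt (420 / 162) * (K * Real.sqrt N) := by
    have h2 : 420 * K * L * c⁻¹ * (c * K * N / (162 * L)) = 420 / 162 * (K ^ 2 * N) := by
      field_simp
    have h3 : Real.sqrt (K ^ 2 * N) = K * Real.sqrt N := by
      rw [Real.sqrt_mul (by positivity), Real.sqrt_sq (by linarith)]
    calc 32 * Real.sqrt (420 * K * L * c⁻¹) * (1 / 32 * Real.sqrt (c * K * N / (162 * L)))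
        = Real.sqrt (420 * K * L * c⁻¹) * Real.sqrt (c * K * N / (162 * L)) := by ring
      _ = Real.sqrt (420 / 162) * (K * Real.sqrt N) := by
        rw [← Real.sqrt_mul (by positivity), h2, Real.sqrt_mul (by norm_num), h3]
  rw [h1]
  refine le_mul_of_one_le_left (by positivity) ?_
  rw [Real.one_le_sqrt]
  norm_num

theorem eps_sq_mul_le (hc : 0 < c) (hK : 1 ≤ K) (hL : 1 ≤ L) (hN : 0 < N) :
    (Real.sqrt (c * K) / (32 * Real.sqrt (420 / N * L + 2 * ε ^ 2))) ^ 2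
      * (64 * L + 8 * ε ^ 2 * N) ≤ c * K * N := by
  have hq : 0 < 420 / N * L + 2 * ε ^ 2 := by positivity
  rw [div_pow, mul_pow, Real.sq_sqrt (by positivity), Real.sq_sqrt hq.le, div_mul_eq_mul_div,
    div_le_iff₀ (by positivity), mul_assoc (c * K) N]
  refine mul_le_mul_of_nonneg_left ?_ (by positivity)
  have h : N * (32 ^ 2 * (420 / N * L + 2 * ε ^ 2)) = 430080 * L + 2048 * (ε ^ 2 * N) := by
    field_simp
    ring
  have h2 : 0 ≤ ε ^ 2 * N := by positivity
  rw [h]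
  linarith

theorem div_eps_le (hc : 0 < c) (hε : 0 ≤ ε) (hK : 1 ≤ K) (hL : 1 ≤ L) (hN : 0 < N) :
    K / (Real.sqrt (c * K) / (32 * Real.sqrt (420 / N * L + 2 * ε ^ 2)))
      ≤ 32 * Real.sqrt (420 * K * L * c⁻¹) / Real.sqrt N + 48 * (ε * Real.sqrt (c⁻¹ * K)) := by
  have hcK : 0 < Real.sqrt (c * K) := Real.sqrt_pos.2 (by positivity)
  have h1 : K / Real.sqrt (c * K) = Real.sqrt (c⁻¹ * K) := by
    have h2 : c⁻¹ * K = K ^ 2 / (c * K) := by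
      field_simp
    rw [h2, Real.sqrt_div (by positivity), Real.sqrt_sq (by linarith)]
  have h3 : Real.sqrt (420 / N * L + 2 * ε ^ 2)
      ≤ Real.sqrt (420 * L) / Real.sqrt N + 3 / 2 * ε := by
    rw [← Real.sqrt_div (by positivity)]
    refine Real.sqrt_le_iff.2 ⟨by positivity, ?_⟩
    have h4 := Real.sq_sqrt (by positivity : 0 ≤ 420 * L / N)
    have h5 : 0 ≤ Real.sqrt (420 * L / N) * ε := by positivity
    have h6 : 420 / N * L = 420 * L / N := by ring
    rw [h6]
    nlinarith [sq_nonneg ε]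
  have h4 : Real.sqrt (420 * K * L * c⁻¹) = Real.sqrt (c⁻¹ * K) * Real.sqrt (420 * L) := by
    rw [← Real.sqrt_mul (by positivity)]
    congr 1
    ring
  rw [div_div_eq_mul_div, mul_div_right_comm, h1, h4]
  have h5 := mul_le_mul_of_nonneg_left h3 (Real.sqrt_nonneg (c⁻¹ * K))
  calc Real.sqrt (c⁻¹ * K) * (32 * Real.sqrt (420 / N * L + 2 * ε ^ 2))
      = 32 * (Real.sqrt (c⁻¹ * K) * Real.sqrt (420 / N * L + 2 * ε ^ 2)) := by ring
    _ ≤ 32 * (Real.sqrt (c⁻¹ * K) * (Real.sqrt (420 * L) / Real.sqrt N + 3 / 2 * ε)) := by linarith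
    _ = _ := by ring

/-- The leading term of the regret bound in terms of the logarithm that appears in the claim. -/
theorem mul_sqrt_mul_sqrt_le {L' : ℝ} {T : ℝ} (hc : 0 < c) (hK : 1 ≤ K) (hL : 1 ≤ L)
    (hT : 0 ≤ T) (hL3 : L ≤ 3 * L') :
    34 * (32 * Real.sqrt (420 * K * L * c⁻¹) * Real.sqrt T)
      ≤ 40000 * Real.sqrt (c⁻¹ * K * T * L') := by
  have h1 : Real.sqrt (420 * K * L * c⁻¹) * Real.sqrt T
      ≤ Real.sqrt (36 ^ 2) * Real.sqrt (c⁻¹ * K * T * L') := by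
    rw [← Real.sqrt_mul' _ hT, ← Real.sqrt_mul (by norm_num)]
    refine Real.sqrt_le_sqrt ?_
    have h2 : 0 ≤ c⁻¹ * K * T := by positivity
    have h3 := mul_le_mul_of_nonneg_left hL3 h2
    have h4 := mul_nonneg h2 (by linarith : 0 ≤ L')
    linarith
  rw [Real.sqrt_sq (by norm_num)] at h1
  have h3 := Real.sqrt_nonneg (c⁻¹ * K * T * L')
  linarith

end Scaling

end XBandit

end

theorem corollary1 :
    ∃ C : ℝ, 0 < C ∧ ∀ p m b : ℕ, 2 ≤ p → p < m → 1 ≤ b → ∃ D : ℝ, 0 < D ∧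
    ∀ (A Z k T : ℕ), 1 ≤ k → k ≤ Z → 2 ≤ T →
    ∀ (X : Type*) [MeasurableSpace X] [Nonempty X]
      (𝒯 : XBandit.ArmTree A p m (XBandit.treeHeight A p m)) (g : ℕ → ℕ → X → ℝ),
      (∀ h i x, g h i x ∈ Set.Icc (0 : ℝ) 1) →
    ∀ ord : XBandit.ArmOrder 𝒯 g b Z,
      -- the number of effective arms
      Z ≤ (p - 1) * b * (XBandit.treeHeight A p m - 1) + b * m ∧
      (2 ≤ A → (Z : ℝ) ≤ D * Real.log A) ∧
    ∀ (F : Finset (X → Fin A → ℝ)),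
      (∀ f ∈ F, ∀ a, Measurable fun x => f x a) →
      (∀ f ∈ F, ∀ x a, f x a ∈ Set.Icc (0 : ℝ) 1) →
      (∀ f ∈ F, XBandit.IsTreeConstant 𝒯 g b f) →
    ∀ fstar ∈ F,
    ∀ (𝒟 : MeasureTheory.Measure (X × (Fin A → ℝ))) [MeasureTheory.IsProbabilityMeasure 𝒟],
      (∀ᵐ w ∂𝒟, ∀ a, w.2 a ∈ Set.Icc (0 : ℝ) 1) →
    ∀ (Ω : Type*) [MeasurableSpace Ω] (P : MeasureTheory.Measure Ω)
      [MeasureTheory.IsProbabilityMeasure P]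
      (c δ : ℝ), 0 < c → c ≤ 1 → 0 < δ → δ < 1 →
      -- (i) exact realizability
      (XBandit.Realizable 𝒟 fstar →
        ∀ R : XBandit.ExtremeRun P ord 𝒟 F k T (XBandit.gammaExact c Z k F.card T δ),
          R.Feedback c →
          1 - δ ≤ P.real {ω | R.regret fstar ω ≤
            C * (k * Real.sqrt (c⁻¹ * ((Z : ℝ) - k + 1) * T * Real.log (F.card * T / δ)))}) ∧
      -- (ii) realizability up to an error
      (∀ ε : ℝ, 0 ≤ ε → XBandit.EpsRealizable 𝒟 ε fstar →
        ∀ R : XBandit.ExtremeRun P ord 𝒟 F k T (XBandit.gammaEps c ε Z k F.card T δ),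
          R.Feedback c →
          1 - δ ≤ P.real {ω | R.regret fstar ω ≤
            C * (k * Real.sqrt (c⁻¹ * ((Z : ℝ) - k + 1) * T * Real.log (F.card * T / δ))
              + ε * k * T * Real.sqrt (c⁻¹ * ((Z : ℝ) - k + 1)))}) := by
  refine ⟨40000, by norm_num, fun p m b hp hpm hb => ?_⟩
  have hlog2 : 0 < Real.log 2 := Real.log_pos (by norm_num)
  refine ⟨2 * ((p - 1 : ℕ) * b) / Real.log 2 + b * m / Real.log 2, ?_, ?_⟩
  · have h1 : (1 : ℝ) ≤ b := by exact_mod_cast hb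
    have h2 : (1 : ℝ) ≤ m := by exact_mod_cast (by omega : 1 ≤ m)
    positivity
  intro A Z k T hk hkZ hT X _ _ 𝒯 g _ ord
  have hZ : Z ≤ (p - 1) * b * (XBandit.treeHeight A p m - 1) + b * m := by
    rw [← ord.card_eq 𝒯 g b (Classical.arbitrary X)]
    exact XBandit.card_effectiveArms_le 𝒯 g b _ (by omega) hb
  refine ⟨hZ, fun hA => ?_, ?_⟩
  · have h1 := XBandit.treeHeight_sub_one_le (p := p) (m := m) hp hA (by omega)
    have h2 : (Z : ℝ) ≤ ((p - 1 : ℕ) * b : ℝ) * ((XBandit.treeHeight A p m - 1 : ℕ) : ℝ)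
        + (b * m : ℝ) := by
      exact_mod_cast hZ
    have h3 : Real.log 2 ≤ Real.log A := Real.log_le_log (by norm_num) (by exact_mod_cast hA)
    have h4 := mul_le_mul_of_nonneg_left h1 (by positivity : (0 : ℝ) ≤ ((p - 1 : ℕ) : ℝ) * b)
    have h5 : (b * m : ℝ) ≤ b * m / Real.log 2 * Real.log A := by
      rw [div_mul_eq_mul_div, le_div_iff₀ hlog2]
      exact mul_le_mul_of_nonneg_left h3 (by positivity)
    calc (Z : ℝ) ≤ _ := h2
      _ ≤ ((p - 1 : ℕ) * b : ℝ) * (2 / Real.log 2 * Real.log A)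
          + b * m / Real.log 2 * Real.log A := add_le_add h4 h5
      _ = _ := by ring
  intro F hFm hF1 hFc fstar hs 𝒟 _ h𝒟 Ω _ P _ c δ hc hc1 hδ hδ1
  have hF : XBandit.IsRegularClass 𝒯 g b F := ⟨hFm, hF1, hFc⟩
  have hM : 1 ≤ F.card := Finset.card_pos.2 ⟨fstar, hs⟩
  have hK : (1 : ℝ) ≤ (Z : ℝ) - k + 1 := XBandit.ExtremeRun.one_le_slots hkZ
  have hL := XBandit.one_le_log hM hT hδ hδ1
  have hL3 := XBandit.log_pow_three_le hM hT hδ hδ1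
  have hlead := XBandit.mul_sqrt_mul_sqrt_le hc hK hL (Nat.cast_nonneg T) hL3
  have hα : 1 ≤ 32 * Real.sqrt (420 * ((Z : ℝ) - k + 1)
      * Real.log ((F.card : ℝ) * (T : ℝ) ^ 3 / δ) * c⁻¹) := by
    have h1 : 1 ≤ Real.sqrt (420 * ((Z : ℝ) - k + 1)
        * Real.log ((F.card : ℝ) * (T : ℝ) ^ 3 / δ) * c⁻¹) := by
      rw [Real.one_le_sqrt]
      have h2 : 1 ≤ c⁻¹ := (one_le_inv₀ hc).2 hc1
      exact one_le_mul_of_one_le_of_one_le (one_le_mul_of_one_le_of_one_le (by linarith) hL) h2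
    linarith
  have hpow : ∀ l : ℕ, (0 : ℝ) < 2 ^ l := fun l => by positivity
  constructor
  · intro hreal R hR
    have hsucc : ∀ l, 1 ≤ l → XBandit.gammaExact c Z k F.card T δ (l + 1)
        = 1 / 32 * Real.sqrt (c * ((Z : ℝ) - k + 1) * 2 ^ l
          / (162 * Real.log ((F.card : ℝ) * (T : ℝ) ^ 3 / δ))) := by
      intro l hl
      simp only [XBandit.gammaExact, Nat.add_sub_cancel, XBandit.epochEnd_eq_pow hl]
      push_cast
      rfl
    have hε : XBandit.EpsRealizable 𝒟 0 fstar := by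
      intro a
      filter_upwards [hreal a] with w hw
      rw [hw, sub_self, abs_zero]
    have h := XBandit.ExtremeRun.regret_le hF hk hkZ hT h𝒟 hs
      (by simp [XBandit.gammaExact, XBandit.epochEnd])
      (XBandit.gammaExact_mono hc.le (by linarith) (by linarith))
      (fun l hl => by
        rw [hsucc l hl]
        have := hpow l
        positivity)
      hc hδ hε hR
      (fun l hl => by
        rw [hsucc l hl]
        have := XBandit.exact_sq_mul_le hc hK hL (hpow l)
        simpa using this)
      hα le_rfl
      (fun l hl => by
        rw [hsucc l hl, add_zero]
        exact XBandit.div_exact_le hc hK hL (hpow l))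
    refine h.trans (measureReal_mono fun ω hω => ?_)
    have hω' : R.regret fstar ω ≤ _ := hω
    refine le_trans hω' ?_
    rw [zero_mul, mul_zero, add_zero]
    have := mul_le_mul_of_nonneg_left hlead (Nat.cast_nonneg (α := ℝ) k)
    linarith
  · intro ε hε0 hε R hR
    have hsucc : ∀ l, 1 ≤ l → XBandit.gammaEps c ε Z k F.card T δ (l + 1)
        = Real.sqrt (c * ((Z : ℝ) - k + 1)) / (32 * Real.sqrt (420 / 2 ^ l
          * Real.log ((F.card : ℝ) * (T : ℝ) ^ 3 / δ) + 2 * ε ^ 2)) := by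
      intro l hl
      have h0 : 2 ^ l ≠ 0 := by positivity
      simp only [XBandit.gammaEps, Nat.add_sub_cancel, XBandit.epochEnd_eq_pow hl, if_neg h0]
      push_cast
      rfl
    have hpos : ∀ l, 1 ≤ l → 0 < XBandit.gammaEps c ε Z k F.card T δ (l + 1) := fun l hl => by
      rw [hsucc l hl]
      have := hpow l
      positivity
    have h := XBandit.ExtremeRun.regret_le hF hk hkZ hT h𝒟 hs
      (by simp [XBandit.gammaEps, XBandit.epochEnd])
      (XBandit.gammaEps_mono (by linarith) hpos) hpos hc hδ hε hR
      (fun l hl => by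
        rw [hsucc l hl]
        exact XBandit.eps_sq_mul_le hc hK hL (hpow l))
      hα (β := 48 * (ε * Real.sqrt (c⁻¹ * ((Z : ℝ) - k + 1)))) (by positivity)
      (fun l hl => by
        rw [hsucc l hl]
        exact XBandit.div_eps_le hc hε0 hK hL (hpow l))
    refine h.trans (measureReal_mono fun ω hω => ?_)
    have hω' : R.regret fstar ω ≤ _ := hω
    refine le_trans hω' ?_
    have h1 := mul_le_mul_of_nonneg_left hlead (Nat.cast_nonneg (α := ℝ) k)
    have h2 : 0 ≤ ε * k * T * Real.sqrt (c⁻¹ * ((Z : ℝ) - k + 1)) := by positivity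
    linarith
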